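/- **Setting.** Let $\mathcal S,\mathcal A$ be finite nonempty sets of sizes $S,A$, let $H,K\ge 1$, and let $M$ be a time-inhomogeneous finite-horizon MDP: for every $h\in\{1,\dots,H\}$ and $(s,a)\in\mathcal S\times\mathcal A$ there are a transition distribution $P_h(\cdot\mid s,a)$ on $\mathcal S$ (also written $P_{s,a,h}$) and a reward distribution $R_h(s,a)$ on $[0,1]$. No other condition is imposed (neither time-homogeneity nor a bound $1$ on the total reward). Put $\Gamma=\max_{h,s,a}|\{s':P_h(s'\mid s,a)>0\}|$, and for a vector $p$ and a function $y$ put $\mathbb V(p,y)=\sum_x p_x\,(y_x-\sum_z p_zy_z)^2$; $\mathbb V(R_h(s,a))$ is the variance of the reward distribution. $\Pi$ is the set of deterministic history-independent policies $\pi=(\pi_h:\mathcal S\to\mathcal A)_{h\le H}$, $V_h^\pi(s)=\mathbb E_\pi[\sum_{t=h}^H r_t\mid s_h=s]$ and $V_h^\star(s)=\max_{\pi\in\Pi}V_h^\pi(s)$. An agent interacts with $M$ for $K$ episodes. In episode $k$ the initial state $s_1^k$ is generated exogenously, the agent fixes a policy $\pi^k\in\Pi$ depending on the past, and for $h=1,\dots,H$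 plays $a_h^k=\pi_h^k(s_h^k)$ and, given the past, receives independent $r_h^k\sim R_h(s_h^k,a_h^k)$ and $s_{h+1}^k\sim P_h(\cdot\mid s_h^k,a_h^k)$. Define $$\mathsf{Regret}(K)=\sum_{k=1}^K\bigl(V_1^\star(s_1^k)-V_1^{\pi^k}(s_1^k)\bigr),\qquad \mathsf{Var}_K^\Sigma=\sum_{k=1}^K\sum_{h=1}^H\bigl(\mathbb V(R_h(s_h^k,a_h^k))+\mathbb V(P_{s_h^k,a_h^k,h},V_{h+1}^\star)\bigr),$$ $$\mathsf{Var}^\star=\max_{\pi\in\Pi}\max_{s\in\mathcal S}\ \mathbb E_\pi\Bigl[\sum_{h=1}^H\bigl(\mathbb V(R_h(s_h,a_h))+\mathbb V(P_{s_h,a_h,h},V_{h+1}^\pi)\bigr)\Bigm|s_1=s\Bigr].$$ **Algorithm MVP-V (with parameter $\iota$, on a finite state space $\mathcal X$).** Initially the counters $N(x,a),n(x,a),\theta(x,a),\phi(x,a),N(x,a,x')$ and the estimates $\hat r,\widehat{\mathsf{VarR}},\hat P$ are $0$, all $Q_h(x,a)$ and $V_h(x)$ ($h\le H$) are $1$,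 and $V_{H+1}=0$. In each episode the action at step $h$ in state $x$ is some $a\in\arg\max_{a}Q_h(x,a)$. After observing $(x,a,r,x')$ add $1,r,r^2,1$ to $N(x,a),\theta(x,a),\phi(x,a),N(x,a,x')$; if now $N(x,a)\in\{2^{i-1}:i\ge1,\ 2^i\le KH\}$, set $\hat r(x,a)=\theta(x,a)/N(x,a)$, $\widehat{\mathsf{VarR}}(x,a)=\phi(x,a)/N(x,a)-\hat r(x,a)^2$, $\hat P_{x,a,\cdot}=N(x,a,\cdot)/N(x,a)$, $n(x,a)=N(x,a)$. At the end of every episode in which this happened at least once, recompute for $h=H,\dots,1$ and all $(x,a)$, with $m=\max\{n(x,a),1\}$, $$b_h(x,a)=4\sqrt{\tfrac{\mathbb V(\hat P_{x,a},V_{h+1})\,\iota}{m}}+2\sqrt{\tfrac{\widehat{\mathsf{VarR}}(x,a)\,\iota}{m}}+\tfrac{21\iota}{m},$$ $$Q_h(x,a)=\min\{1,\ \hat r(x,a)+\hat P_{x,a}V_{h+1}+b_h(x,a)\},\qquad V_h(x)=\max_aQ_h(x,a).$$ **Reductions.** MVP-V is run on $M$ as follows: its state space is the layered space $\mathcal X=\{1,\dots,H\}\times\mathcal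 S$, the state $s$ at step $h$ being shown to it as $(h,s)$, and every reward $r$ is shown to it as $r/H$. (The layer given to the state reached after step $H$ is immaterial.) Thus $\pi^k_h(s)\in\arg\max_aQ_h((h,s),a)$ with the current $Q$. **Statement.** There are universal constants $C>0$ and $p\in\mathbb N$ such that for all such $\mathcal S,\mathcal A,H,K,M$, every $\delta\in(0,1)$ and every tie-breaking, if MVP-V is run on $M$ in this way with $$\iota=99\left(\ln\left(\frac{3000^2H^{12}S^7A^5K^5}{\delta^2}\right)+1\right),$$ then with probability at least $1-\delta$ $$\mathsf{Regret}(K)\le C\Bigl(1+\ln\frac{HSAK}{\delta}\Bigr)^{p}\left(\sqrt{\min\{\mathsf{Var}_K^\Sigma,\ \mathsf{Var}^\star K\}\,HSA}+H^2\Gamma SA\right).$$ -/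

import Mathlib

namespace RL

open MeasureTheory ProbabilityTheory

noncomputable section

/-- A (time-inhomogeneous) tabular finite-horizon MDP with states `S`, actions `A` and horizon `H`.
Steps are indexed by `Fin H`, so step `h` of the usual numbering `1, …, H` is `h - 1` here. -/
structure MDP (S A : Type*) [Fintype S] (H : ℕ) where
  /-- transition probabilities `P_h(· | s, a) ∈ Δ(S)` -/
  P : Fin H → S → A → stdSimplex ℝ S
  /-- reward distributions `R_h(s, a) ∈ Δ([0, 1])` -/
  R : Fin H → S → A → ProbabilityMeasure unitInterval

/-- Deterministic history-independent policies (the set `Π`). -/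
abbrev Policy (S A : Type*) (H : ℕ) : Type _ := Fin H → S → A

/-- `𝕍(p, y) = ∑ x, p x * (y x - ∑ z, p z * y z) ^ 2`. -/
def wvar {X : Type*} [Fintype X] (p y : X → ℝ) : ℝ :=
  ∑ x, p x * (y x - ∑ z, p z * y z) ^ 2

namespace MDP

variable {S A : Type*} [Fintype S] {H : ℕ} (M : MDP S A H)

/-- `𝕍(R_h(s, a))`, the variance of the reward distribution. -/
def rewardVar (h : Fin H) (s : S) (a : A) : ℝ :=
  variance (fun x : unitInterval => (x : ℝ)) (M.R h s a : Measure unitInterval)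

open Classical in
/-- `Γ = max_{h, s, a} supp(P_h(· | s, a))`. -/
def Gam [Fintype A] : ℕ :=
  Finset.univ.sup fun q : Fin H × S × A =>
    (Finset.univ.filter fun y : S => 0 < M.P q.1 q.2.1 q.2.2 y).card

open Classical in
/-- Probability of the state path `s_h, …, s_{H+1}` under `π` given `s_h = s`.  A path is stored as
a function on all of `Fin (H + 1)`; its entries before `h` are padded by the constant `s`. -/
def pathProb (π : Policy S A H) (h : Fin (H + 1)) (s : S) (τ : Fin (H + 1) → S) : ℝ :=
  (if ∀ i, i ≤ h → τ i = s then 1 else 0) *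
    ∏ t : Fin H, if h ≤ t.castSucc then
      M.P t (τ t.castSucc) (π t (τ t.castSucc)) (τ t.succ) else 1

/-- `𝔼_π[g | s_h = s]` for a function `g` of the state path and of the rewards: given the path, the
rewards are independent with `r_t ∼ R_t(s_t, π_t(s_t))`. -/
def expect (π : Policy S A H) (h : Fin (H + 1)) (s : S)
    (g : (Fin (H + 1) → S) → (Fin H → unitInterval) → ℝ) : ℝ :=
  ∑ τ : Fin (H + 1) → S, M.pathProb π h s τ *
    ∫ ρ, g τ ρ ∂(Measure.pi fun t : Fin H =>
      (M.R t (τ t.castSucc) (π t (τ t.castSucc)) : Measure unitInterval))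

/-- `V_h^π(s) = 𝔼_π[∑_{t ≥ h} r_t | s_h = s]`; in particular `V_{H+1}^π = 0`. -/
def V (π : Policy S A H) (h : Fin (H + 1)) (s : S) : ℝ :=
  M.expect π h s fun _ ρ => ∑ t : Fin H, if h ≤ t.castSucc then (ρ t : ℝ) else 0

/-- `V_h^⋆(s) = max_{π ∈ Π} V_h^π(s)`. -/
def Vstar (h : Fin (H + 1)) (s : S) : ℝ :=
  ⨆ π : Policy S A H, M.V π h s

/-- `Var_1^π(s)`, the expected total conditional variance of `π` from `s` at the first step. -/
def policyVar (π : Policy S A H) (s : S) : ℝ :=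
  M.expect π 0 s fun τ _ => ∑ t : Fin H,
    (M.rewardVar t (τ t.castSucc) (π t (τ t.castSucc)) +
      wvar (M.P t (τ t.castSucc) (π t (τ t.castSucc))) (M.V π t.succ))

/-- `Var^⋆ = max_{π ∈ Π} max_{s} Var_1^π(s)`, the maximum policy-value variance. -/
def maxVar : ℝ :=
  ⨆ π : Policy S A H, ⨆ s : S, M.policyVar π s

/-- `Var_τ^Σ`, the total multi-step conditional variance of the state-action trajectory that has
states `s` and actions `a`. -/
def trajVar (s : Fin (H + 1) → S) (a : Fin H → A) : ℝ :=
  ∑ t : Fin H, (M.rewardVar t (s t.castSucc) (a t) +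
    wvar (M.P t (s t.castSucc) (a t)) (M.Vstar t.succ))

end MDP

/-! ### The algorithm, for an arbitrary finite state space `X` -/

/-- Memory of the algorithm MVP-V.  `NT x a x'` is the number of observed transitions
`(x, a) ↦ x'`; `V_h(x)` is not stored separately since it always equals `max_a Q_h(x, a)`. -/
structure MVPState (X A : Type*) (H : ℕ) where
  N : X → A → ℕ
  n : X → A → ℕ
  θ : X → A → ℝ
  φ : X → A → ℝ
  NT : X → A → X → ℕ
  rHat : X → A → ℝ
  varR : X → A → ℝ
  pHat : X → A → X → ℝ
  Q : Fin H → X → A → ℝ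
  triggered : Bool

namespace MVPState

variable {X A : Type*} {H : ℕ}

/-- Initialisation. -/
def init (X A : Type*) (H : ℕ) : MVPState X A H where
  N _ _ := 0
  n _ _ := 0
  θ _ _ := 0
  φ _ _ := 0
  NT _ _ _ := 0
  rHat _ _ := 0
  varR _ _ := 0
  pHat _ _ _ := 0
  Q _ _ _ := 1
  triggered := false

/-- The trigger set `{2^(i-1) | 2^i ≤ K H, i = 1, 2, …}`. -/
def triggerSet (K H : ℕ) : Set ℕ :=
  {m | ∃ i : ℕ, 1 ≤ i ∧ 2 ^ i ≤ K * H ∧ m = 2 ^ (i - 1)}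

open Classical in
/-- Counter updates after playing `a` in `x`, receiving `r` and moving to `x'`. -/
def count (σ : MVPState X A H) (x : X) (a : A) (r : ℝ) (x' : X) : MVPState X A H :=
  { σ with
    N := fun y b => σ.N y b + if y = x ∧ b = a then 1 else 0
    θ := fun y b => σ.θ y b + if y = x ∧ b = a then r else 0
    φ := fun y b => σ.φ y b + if y = x ∧ b = a then r ^ 2 else 0
    NT := fun y b z => σ.NT y b z + if y = x ∧ b = a ∧ z = x' then 1 else 0 }

open Classical in
/-- Refresh of the empirical model at the pair `(x, a)`. -/
def refresh (σ : MVPState X A H) (x : X) (a : A) : MVPState X A H :=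
  { σ with
    rHat := fun y b => if y = x ∧ b = a then σ.θ y b / σ.N y b else σ.rHat y b
    varR := fun y b => if y = x ∧ b = a then
      σ.φ y b / σ.N y b - (σ.θ y b / σ.N y b) ^ 2 else σ.varR y b
    pHat := fun y b z => if y = x ∧ b = a then (σ.NT y b z : ℝ) / σ.N y b else σ.pHat y b z
    n := fun y b => if y = x ∧ b = a then σ.N y b else σ.n y b
    triggered := true }

open Classical in
/-- Processing of one observation `(x, a, r, x')`. -/
def observe (K : ℕ) (σ : MVPState X A H) (x : X) (a : A) (r : ℝ) (x' : X) : MVPState X A H :=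
  if (σ.count x a r x').N x a ∈ triggerSet K H then (σ.count x a r x').refresh x a
  else σ.count x a r x'

variable [Fintype X]

/-- The bonus `b(x, a)` computed from the next-step value function `W`. -/
def bonus (ι : ℝ) (σ : MVPState X A H) (W : X → ℝ) (x : X) (a : A) : ℝ :=
  4 * √(wvar (σ.pHat x a) W * ι / (max (σ.n x a) 1 : ℕ)) +
    2 * √(σ.varR x a * ι / (max (σ.n x a) 1 : ℕ)) + 21 * ι / (max (σ.n x a) 1 : ℕ)

/-- The truncated optimistic backup of the next-step value function `W`. -/
def backup (ι : ℝ) (σ : MVPState X A H) (W : X → ℝ) (x : X) (a : A) : ℝ :=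
  min 1 (σ.rHat x a + ∑ y, σ.pHat x a y * W y + σ.bonus ι W x a)

/-- Planned value function with `j` steps to go: `0` after the last step, and
`max_a Q(x, a)` before it. -/
def planV (ι : ℝ) (σ : MVPState X A H) : ℕ → X → ℝ
  | 0 => fun _ => 0
  | j + 1 => fun x => ⨆ a : A, σ.backup ι (planV ι σ j) x a

open Classical in
/-- End of an episode: if an update was triggered, all `Q_h` are recomputed by backward induction
(after step `h : Fin H` there are `H - 1 - h` steps to go) and the flag is cleared. -/
def replan (ι : ℝ) (σ : MVPState X A H) : MVPState X A H :=
  if σ.triggered then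
    { σ with
      Q := fun h x a => σ.backup ι (σ.planV ι (H - 1 - h)) x a
      triggered := false }
  else σ

end MVPState

/-! ### Running MVP-V on a general MDP through normalisation and layering -/

variable {S A : Type*} [Fintype S] {H : ℕ}

/-- Memory of MVP-V at the end of an episode with states `s`, actions `a` and rewards `r`, from its
memory `σ` at the beginning.  The algorithm works on the layered state space
`Fin H × S` (the state `x` at step `h` is shown to it as `(h, x)`) with rewards divided by `H`.  The
state reached after the last step is, arbitrarily, put in the first layer; its value is `0` as the
episode is over. -/
def runEpisode (K : ℕ) (ι : ℝ) (σ : MVPState (Fin H × S) A H)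
    (s : Fin (H + 1) → S) (a : Fin H → A) (r : Fin H → unitInterval) :
    MVPState (Fin H × S) A H :=
  ((List.finRange H).foldl (fun σ h =>
    σ.observe K (h, s h.castSucc) (a h) ((r h : ℝ) / H) (finRotate H h, s h.succ)) σ).replan ι

/-- Memory of MVP-V at the beginning of episode `k` (episodes are numbered from `0`). -/
def memory (K : ℕ) (ι : ℝ) (s : ℕ → Fin (H + 1) → S) (a : ℕ → Fin H → A)
    (r : ℕ → Fin H → unitInterval) : ℕ → MVPState (Fin H × S) A H
  | 0 => MVPState.init _ _ _
  | k + 1 => runEpisode K ι (memory K ι s a r k) (s k) (a k) (r k)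

/-- The actions played by the policies `π k` along the states `s k`. -/
def actions (s : ℕ → Fin (H + 1) → S) (π : ℕ → Policy S A H) (k : ℕ) (h : Fin H) : A :=
  π k h (s k h.castSucc)

/-- MVP-V (with normalisation and layering) plays in each of the `K` episodes a policy that is
greedy with respect to its current `Q`; ties may be broken in any way. -/
def FollowsMVPV (K : ℕ) (ι : ℝ) (s : ℕ → Fin (H + 1) → S) (π : ℕ → Policy S A H)
    (r : ℕ → Fin H → unitInterval) : Prop :=
  ∀ k < K, ∀ (h : Fin H) (x : S) (b : A),
    (memory K ι s (actions s π) r k).Q h (h, x) b ≤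
      (memory K ι s (actions s π) r k).Q h (h, x) (π k h x)

/-- Interaction with the MDP `M` for `K` episodes: random states `s k h`, rewards `r k h` and
policies `π k`.  `𝓕 (k * (H + 1) + h)` is the information available once the state of step `h` of
episode `k` has been observed.  The policy of an episode is fixed at its beginning, the initial
state `s k 0` is exogenous (its law is unconstrained), and given the past, the reward and the next
state are independent with laws `R_h(s, a)` and `P_h(· | s, a)`. -/
structure IsInteraction [MeasurableSpace S] [MeasurableSpace A] (M : MDP S A H) (K : ℕ)
    {Ω : Type*} {mΩ : MeasurableSpace Ω} (μ : Measure Ω) (𝓕 : Filtration ℕ mΩ)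
    (s : ℕ → Fin (H + 1) → Ω → S) (π : ℕ → Ω → Policy S A H)
    (r : ℕ → Fin H → Ω → unitInterval) : Prop where
  state_meas : ∀ k < K, ∀ h : Fin (H + 1), Measurable[𝓕 (k * (H + 1) + h)] (s k h)
  policy_meas : ∀ k < K, ∀ (h : Fin H) (x : S),
    Measurable[𝓕 (k * (H + 1))] (fun ω => π k ω h x)
  reward_meas : ∀ k < K, ∀ h : Fin H, Measurable[𝓕 (k * (H + 1) + h + 1)] (r k h)
  law : ∀ k < K, ∀ (h : Fin H) (B : Set unitInterval) (y : S), MeasurableSet B →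
    μ[Set.indicator {ω | r k h ω ∈ B ∧ s k h.succ ω = y} (fun _ => (1 : ℝ)) |
        𝓕 (k * (H + 1) + h)] =ᵐ[μ]
      fun ω => (M.R h (s k h.castSucc ω) (π k ω h (s k h.castSucc ω)) :
          Measure unitInterval).real B *
        M.P h (s k h.castSucc ω) (π k ω h (s k h.castSucc ω)) y

/-- `Regret(K) = ∑_{k} (V_1^⋆(s_1^k) - V_1^{π^k}(s_1^k))`. -/
def regret (M : MDP S A H) (K : ℕ) (s : ℕ → Fin (H + 1) → S) (π : ℕ → Policy S A H) : ℝ :=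
  ∑ k ∈ Finset.range K, (M.Vstar 0 (s k 0) - M.V (π k) 0 (s k 0))

/-- `Var_K^Σ = ∑_k Var_{(k)}^Σ`. -/
def totalVar (M : MDP S A H) (K : ℕ) (s : ℕ → Fin (H + 1) → S) (π : ℕ → Policy S A H) : ℝ :=
  ∑ k ∈ Finset.range K, M.trajVar (s k) (actions s π k)

/-- `ι = 99 (ln(3000² H¹² S⁷ A⁵ K⁵ / δ²) + 1)`. -/
def iota (H nS nA K : ℕ) (δ : ℝ) : ℝ :=
  99 * (Real.log (3000 ^ 2 * (H : ℝ) ^ 12 * (nS : ℝ) ^ 7 * (nA : ℝ) ^ 5 * (K : ℝ) ^ 5 / δ ^ 2) + 1)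

end

end RL

/-!
Values are scaled by `1 / H`, so that they lie in `[0, 1]`. Layering makes the cell of MVP-V for
`((h, x), a)` change only at step `h`, once per episode, and only towards the next layer, so the
algorithm runs a separate estimate for each triple `(h, x, a)` and plans by backward induction on the
original state space.

All concentration comes from one principle: a product over the interaction of nonnegative factors
with conditional expectation at most `1` has expectation at most `1`
(`IsInteraction.lintegral_prod_le_one`), so by Markov's inequality it exceeds `exp L` with probability
at most `exp (-L)`. It is used in two ways.

* Over the visits of a triple it gives empirical Bernstein bounds (`Concentrated`) for the reward, the
  optimal value of the next state, and the indicators of the next states. These give optimism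
  (`GoodEvent.Vstar_le_optV`) and bound the surplus of the optimistic backup over the true one (`GoodEvent.surplus_le`) by
  `√((𝕍(R) + 𝕍(P, V⋆)) e) + √(Γ 𝕍(P, Δ) e) + Γ e` up to constants, where `e` is `ι` over the sample size
  and `Δ` is the excess of the optimistic values over `V⋆`.
* With a potential function of the state (`IsInteraction.measure_potential_le`) it replaces Freedman's
  inequality. Four potentials are used: `1 - X / 4` for the excess `X` over the value of the played
  policy bounds the regret by the sum of the surpluses; `2 - Δ²` bounds the sum of `𝕍(P, Δ)` by the sum
  of the surpluses; `1 + 2 Y - Y²` for the gap `Y = V⋆ - V^π` bounds the sum of `𝕍(P, Y)` by the regret;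
  and `1 + Z` for the expected remaining total variance `Z` of the policy, which is at most `1` by the
  law of total variance, bounds the variances met for `V^π` by `Var⋆ K`.

The sum of `e` along the trajectories is `H S A` times a logarithm (`sum_inv_samples_le`), so
Cauchy-Schwarz turns the surplus bound into an inequality between the regret, the total variance and
the sum of `𝕍(P, Δ)`, and `regret_le_of_system` solves the resulting system. The total variance is
`Var_K^Σ` itself, or, since `𝕍(P, V⋆) ≤ 2 𝕍(P, V^π) + 2 𝕍(P, Y)`, it is bounded by `Var⋆ K` and the
regret; this gives the minimum. Undoing the scaling multiplies by `H`, which turns `H Γ S A` into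
`H² Γ S A` and cancels in the leading term, where the variance is scaled by `H²`.
-/

namespace RL

open MeasureTheory ProbabilityTheory

open scoped ENNReal

set_option linter.unusedSectionVars false

noncomputable section

/-! ### Weighted variances -/

theorem wvar_nonneg {X : Type*} [Fintype X] {p : X → ℝ} (hp : ∀ x, 0 ≤ p x) (y : X → ℝ) :
    0 ≤ wvar p y :=
  Finset.sum_nonneg fun x _ => mul_nonneg (hp x) (sq_nonneg _)

theorem sum_mul_sq_sub_eq {X : Type*} [Fintype X] {p : X → ℝ} (hp : ∑ x, p x = 1)
    (y : X → ℝ) (c : ℝ) :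
    ∑ x, p x * (y x - c) ^ 2 = ∑ x, p x * y x ^ 2 - 2 * c * ∑ x, p x * y x + c ^ 2 := by
  have : ∀ x, p x * (y x - c) ^ 2 = p x * y x ^ 2 - 2 * c * (p x * y x) + c ^ 2 * p x :=
    fun x => by ring
  simp only [this, Finset.sum_add_distrib, Finset.sum_sub_distrib, ← Finset.mul_sum, hp, mul_one]

theorem wvar_eq {X : Type*} [Fintype X] {p : X → ℝ} (hp : ∑ x, p x = 1) (y : X → ℝ) :
    wvar p y = ∑ x, p x * y x ^ 2 - (∑ x, p x * y x) ^ 2 := by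
  rw [wvar, sum_mul_sq_sub_eq hp]; ring

/-- The variance is the smallest mean squared deviation from a constant. -/
theorem wvar_le_sum_sq_sub {X : Type*} [Fintype X] {p : X → ℝ} (hp : ∑ x, p x = 1)
    (y : X → ℝ) (c : ℝ) : wvar p y ≤ ∑ x, p x * (y x - c) ^ 2 := by
  rw [wvar_eq hp, sum_mul_sq_sub_eq hp]
  nlinarith [sq_nonneg (c - ∑ x, p x * y x)]

theorem wvar_le_two_mul {X : Type*} [Fintype X] {p : X → ℝ} (hp : ∀ x, 0 ≤ p x) (f g : X → ℝ) :
    wvar p f ≤ 2 * wvar p g + 2 * wvar p fun x => f x - g x := by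
  simp only [wvar, Finset.mul_sum, ← Finset.sum_add_distrib]
  refine Finset.sum_le_sum fun x _ => ?_
  simp only [mul_sub, Finset.sum_sub_distrib]
  nlinarith [mul_nonneg (hp x) (sq_nonneg ((g x - ∑ z, p z * g z) -
    ((f x - g x) - (∑ z, p z * f z - ∑ z, p z * g z))))]

theorem wvar_div {X : Type*} [Fintype X] (p y : X → ℝ) (c : ℝ) :
    wvar p (fun x => y x / c) = wvar p y / c ^ 2 := by
  simp only [wvar, Finset.sum_div]
  refine Finset.sum_congr rfl fun x _ => ?_
  have : ∑ z, p z * (y z / c) = (∑ z, p z * y z) / c := by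
    rw [Finset.sum_div]; exact Finset.sum_congr rfl fun z _ => by ring
  rw [this, ← sub_div, div_pow]; ring

namespace MDP

variable {S A : Type*} [Fintype S] {H : ℕ} (M : MDP S A H)

/-! ### Bellman equations -/

/-- The mean of the reward distribution `R_h(s, a)`. -/
def meanR (h : Fin H) (s : S) (a : A) : ℝ :=
  ∫ x : unitInterval, (x : ℝ) ∂(M.R h s a : Measure unitInterval)

theorem P_nonneg (h : Fin H) (s : S) (a : A) (y : S) : 0 ≤ M.P h s a y := (M.P h s a).2.1 y

theorem P_sum (h : Fin H) (s : S) (a : A) : ∑ y, M.P h s a y = 1 := (M.P h s a).2.2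

/-- The expectation of `y ↦ f y` under `P_h(· | s, a)`. -/
def PV (h : Fin H) (s : S) (a : A) (f : S → ℝ) : ℝ := ∑ y, M.P h s a y * f y

variable {M} in
theorem PV_mono {h : Fin H} {s : S} {a : A} {f g : S → ℝ} (hfg : ∀ y, f y ≤ g y) :
    M.PV h s a f ≤ M.PV h s a g :=
  Finset.sum_le_sum fun y _ => mul_le_mul_of_nonneg_left (hfg y) (M.P_nonneg h s a y)

theorem PV_const (h : Fin H) (s : S) (a : A) (c : ℝ) : M.PV h s a (fun _ => c) = c := by
  simp [PV, ← Finset.sum_mul]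

variable {M} in
theorem PV_nonneg {h : Fin H} {s : S} {a : A} {f : S → ℝ} (hf : ∀ y, 0 ≤ f y) :
    0 ≤ M.PV h s a f := by
  simpa [PV_const] using M.PV_mono (h := h) (s := s) (a := a) (f := fun _ => 0) hf

variable {M} in
theorem PV_le {h : Fin H} {s : S} {a : A} {f : S → ℝ} {c : ℝ} (hf : ∀ y, f y ≤ c) :
    M.PV h s a f ≤ c := by
  simpa [PV_const] using M.PV_mono (h := h) (s := s) (a := a) (g := fun _ => c) hf

theorem PV_sub (h : Fin H) (s : S) (a : A) (f g : S → ℝ) :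
    M.PV h s a (fun y => f y - g y) = M.PV h s a f - M.PV h s a g := by
  simp [PV, mul_sub, Finset.sum_sub_distrib]

theorem PV_add (h : Fin H) (s : S) (a : A) (f g : S → ℝ) :
    M.PV h s a (fun y => f y + g y) = M.PV h s a f + M.PV h s a g := by
  simp [PV, mul_add, Finset.sum_add_distrib]

theorem PV_smul (h : Fin H) (s : S) (a : A) (c : ℝ) (f : S → ℝ) :
    M.PV h s a (fun y => c * f y) = c * M.PV h s a f := by
  simp only [PV, Finset.mul_sum]
  exact Finset.sum_congr rfl fun y _ => by ring

theorem PV_div (h : Fin H) (s : S) (a : A) (c : ℝ) (f : S → ℝ) :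
    M.PV h s a (fun y => f y / c) = M.PV h s a f / c := by
  simp only [PV, Finset.sum_div]
  exact Finset.sum_congr rfl fun y _ => by ring

/-- The one-step split of a path probability: the step `h` contributes `P_h(τ_{h+1} | s, π_h(s))`
and the remainder only sees the path after `h`. -/
theorem sum_pathProb_castSucc (π : Policy S A H) (h : Fin H) (s : S)
    (F : (Fin (H + 1) → S) → ℝ)
    (hF : ∀ τ τ' : Fin (H + 1) → S, (∀ i, h.succ ≤ i → τ i = τ' i) → F τ = F τ') :
    ∑ τ, M.pathProb π h.castSucc s τ * F τ =
      M.PV h s (π h s) fun y => ∑ τ, M.pathProb π h.succ y τ * F τ := by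
  classical
  rw [← Finset.sum_fiberwise (s := Finset.univ) (g := fun τ : Fin (H + 1) → S => τ h.succ), PV]
  refine Finset.sum_congr rfl fun y _ => ?_
  have e1 : ∑ τ ∈ Finset.univ.filter (fun τ : Fin (H + 1) → S => τ h.succ = y),
      M.pathProb π h.castSucc s τ * F τ =
      ∑ τ ∈ Finset.univ.filter (fun τ : Fin (H + 1) → S =>
        (∀ i, i ≤ h.castSucc → τ i = s) ∧ τ h.succ = y),
      M.pathProb π h.castSucc s τ * F τ := by
    refine (Finset.sum_subset ?_ ?_).symm
    · intro τ; simp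
    · intro τ h1 h2
      simp only [Finset.mem_filter, Finset.mem_univ, true_and] at h1 h2
      rw [pathProb, if_neg (fun h3 => h2 ⟨h3, h1⟩)]; simp
  have e2 : ∑ τ, M.pathProb π h.succ y τ * F τ =
      ∑ τ ∈ Finset.univ.filter (fun τ : Fin (H + 1) → S => ∀ i, i ≤ h.succ → τ i = y),
      M.pathProb π h.succ y τ * F τ := by
    refine (Finset.sum_subset (Finset.subset_univ _) ?_).symm
    intro τ _ h2
    simp only [Finset.mem_filter, Finset.mem_univ, true_and] at h2
    rw [pathProb, if_neg h2]; simp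
  rw [e1, e2, Finset.mul_sum]
  -- exchange the padding by `s` up to step `h` for the padding by `y`
  refine Finset.sum_nbij' (fun τ i => if i ≤ h.castSucc then y else τ i)
    (fun τ i => if i ≤ h.castSucc then s else τ i) ?_ ?_ ?_ ?_ ?_
  · intro τ hτ
    simp only [Finset.mem_filter, Finset.mem_univ, true_and] at hτ ⊢
    intro i hi
    split_ifs with h1
    · rfl
    · have : i = h.succ := by
        apply le_antisymm hi
        rw [not_le] at h1
        exact Fin.castSucc_lt_iff_succ_le.mp h1
      rw [this, hτ.2]
  · intro τ hτ
    simp only [Finset.mem_filter, Finset.mem_univ, true_and] at hτ ⊢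
    refine ⟨fun i hi => by simp [hi], ?_⟩
    rw [if_neg (by simp), hτ _ le_rfl]
  · intro τ hτ
    simp only [Finset.mem_filter, Finset.mem_univ, true_and] at hτ
    funext i
    by_cases h1 : i ≤ h.castSucc
    · simp [h1, hτ.1 i h1]
    · simp [h1]
  · intro τ hτ
    simp only [Finset.mem_filter, Finset.mem_univ, true_and] at hτ
    funext i
    by_cases h1 : i ≤ h.castSucc
    · simp [h1, hτ i (h1.trans h.castSucc_le_succ)]
    · simp [h1]
  · intro τ hτ
    simp only [Finset.mem_filter, Finset.mem_univ, true_and] at hτ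
    have hagree : ∀ i, h.succ ≤ i → (if i ≤ h.castSucc then y else τ i) = τ i := by
      intro i hi
      rw [if_neg]
      rw [not_le]
      exact Fin.castSucc_lt_iff_succ_le.mpr hi
    rw [hF τ (fun i => if i ≤ h.castSucc then y else τ i) fun i hi => (hagree i hi).symm,
      ← mul_assoc]
    congr 1
    rw [pathProb, pathProb, if_pos hτ.1, if_pos, one_mul, one_mul,
      Fintype.prod_eq_mul_prod_compl h, Fintype.prod_eq_mul_prod_compl h, if_pos le_rfl,
      if_neg (by simp), one_mul, hτ.1 _ le_rfl, hτ.2]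
    · congr 1
      refine Finset.prod_congr rfl fun t ht => ?_
      have hne : t ≠ h := by simpa using ht
      by_cases hlt : h < t
      · have h1 : h.succ ≤ t.castSucc := by
          rw [Fin.le_def]; simpa using hlt
        have h2 : h.castSucc ≤ t.castSucc := by
          rw [Fin.le_def]; simpa using hlt.le
        have h3 : h.succ ≤ t.succ := by
          rw [Fin.le_def]; simpa using hlt.le
        rw [if_pos h1, if_pos h2, hagree _ h1, hagree _ h3]
      · have hth : t < h := lt_of_le_of_ne (not_lt.mp hlt) hne
        rw [if_neg, if_neg]
        · rw [not_le, Fin.lt_def]; simp; omega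
        · rw [not_le, Fin.lt_def]; simpa using hth
    · intro i hi
      split_ifs with h1
      · rfl
      · have : i = h.succ :=
          le_antisymm hi (Fin.castSucc_lt_iff_succ_le.mp (not_le.mp h1))
        rw [this, hτ.2]

theorem sum_pathProb (π : Policy S A H) (h : Fin (H + 1)) (s : S) :
    ∑ τ, M.pathProb π h s τ = 1 := by
  classical
  induction h using Fin.reverseInduction generalizing s with
  | last =>
    rw [Finset.sum_eq_single (fun _ => s)]
    · rw [pathProb, if_pos (by simp), one_mul]
      refine Finset.prod_eq_one fun t _ => if_neg ?_
      rw [not_le]; exact Fin.castSucc_lt_last t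
    · intro τ _ hne
      rw [pathProb, if_neg, zero_mul]
      intro h1
      exact hne (funext fun i => h1 i (Fin.le_last i))
    · simp
  | cast h ih =>
    have := M.sum_pathProb_castSucc π h s (fun _ => 1) (by simp)
    simp only [mul_one, ih] at this
    rw [this, PV_const]

/-- The expected sum of the state costs `c t (s_t)` over the steps `t ≥ h`, from `s_h = s`. -/
def addV (π : Policy S A H) (c : Fin H → S → ℝ) (h : Fin (H + 1)) (s : S) : ℝ :=
  ∑ τ, M.pathProb π h s τ * ∑ t : Fin H, if h ≤ t.castSucc then c t (τ t.castSucc) else 0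

theorem addV_last (π : Policy S A H) (c : Fin H → S → ℝ) (s : S) :
    M.addV π c (Fin.last H) s = 0 := by
  refine Finset.sum_eq_zero fun τ _ => ?_
  rw [Finset.sum_eq_zero, mul_zero]
  intro t _
  rw [if_neg]
  rw [not_le]; exact Fin.castSucc_lt_last t

theorem addV_castSucc (π : Policy S A H) (c : Fin H → S → ℝ) (h : Fin H) (s : S) :
    M.addV π c h.castSucc s = c h s + M.PV h s (π h s) (M.addV π c h.succ) := by
  classical
  have key := M.sum_pathProb_castSucc π h s
    (fun τ => ∑ t : Fin H, if h.succ ≤ t.castSucc then c t (τ t.castSucc) else 0) (by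
      intro τ τ' h1
      refine Finset.sum_congr rfl fun t _ => ?_
      split_ifs with h2
      · rw [h1 _ h2]
      · rfl)
  change _ = c h s + M.PV h s (π h s) fun y => M.addV π c h.succ y
  simp only [addV]
  rw [← key]
  have : c h s = ∑ τ, M.pathProb π h.castSucc s τ * c h s := by
    rw [← Finset.sum_mul, sum_pathProb, one_mul]
  rw [this, ← Finset.sum_add_distrib]
  refine Finset.sum_congr rfl fun τ _ => ?_
  rw [← mul_add]
  by_cases hτ : ∀ i, i ≤ h.castSucc → τ i = s
  · congr 1
    rw [Fintype.sum_eq_add_sum_compl h, Fintype.sum_eq_add_sum_compl h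
      (fun t : Fin H => if h.succ ≤ t.castSucc then c t (τ t.castSucc) else 0),
      if_pos le_rfl, if_neg (by simp), zero_add, hτ _ le_rfl]
    congr 1
    refine Finset.sum_congr rfl fun t ht => ?_
    have hne : t ≠ h := by simpa using ht
    have : h.castSucc ≤ t.castSucc ↔ h.succ ≤ t.castSucc := by
      simp only [Fin.le_def, Fin.val_castSucc, Fin.val_succ]
      have : (t : ℕ) ≠ h := fun h1 => hne (Fin.ext h1)
      omega
    simp only [this]
  · rw [pathProb, if_neg hτ]; simp

theorem V_eq_addV (π : Policy S A H) :
    M.V π = M.addV π fun t s => M.meanR t s (π t s) := by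
  funext h s
  simp only [V, expect, addV]
  refine Finset.sum_congr rfl fun τ _ => ?_
  congr 1
  rw [integral_finsetSum]
  · refine Finset.sum_congr rfl fun t _ => ?_
    split_ifs with h1
    · rw [integral_comp_eval (μ := fun t : Fin H =>
        (M.R t (τ t.castSucc) (π t (τ t.castSucc)) : Measure unitInterval))
        (i := t) (f := fun x : unitInterval => (x : ℝ)), meanR]
      exact measurable_subtype_coe.aestronglyMeasurable
    · simp
  · intro t _
    split_ifs with h1
    · refine Integrable.of_bound (C := 1) ?_ ?_
      · exact (measurable_subtype_coe.comp (measurable_pi_apply t)).aestronglyMeasurable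
      · refine Filter.Eventually.of_forall fun ρ => ?_
        rw [Real.norm_eq_abs, abs_of_nonneg (ρ t).2.1]
        exact (ρ t).2.2
    · simp

theorem policyVar_eq_addV (π : Policy S A H) :
    M.policyVar π = M.addV π (fun t s => M.rewardVar t s (π t s) +
      wvar (M.P t s (π t s)) (M.V π t.succ)) 0 := by
  funext s
  simp only [policyVar, expect, addV]
  refine Finset.sum_congr rfl fun τ _ => ?_
  simp

theorem V_last (π : Policy S A H) (s : S) : M.V π (Fin.last H) s = 0 := by
  rw [V_eq_addV, addV_last]

theorem V_castSucc (π : Policy S A H) (h : Fin H) (s : S) :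
    M.V π h.castSucc s = M.meanR h s (π h s) + M.PV h s (π h s) (M.V π h.succ) := by
  rw [V_eq_addV, addV_castSucc]

theorem coe_integrable (ν : Measure unitInterval) [IsProbabilityMeasure ν] :
    Integrable (fun x : unitInterval => (x : ℝ)) ν :=
  Integrable.of_bound (C := 1) measurable_subtype_coe.aestronglyMeasurable
    (Filter.Eventually.of_forall fun ρ => by
      rw [Real.norm_eq_abs, abs_of_nonneg ρ.2.1]; exact ρ.2.2)

theorem meanR_nonneg (h : Fin H) (s : S) (a : A) : 0 ≤ M.meanR h s a :=
  integral_nonneg fun x => x.2.1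

theorem meanR_le_one (h : Fin H) (s : S) (a : A) : M.meanR h s a ≤ 1 := by
  have := integral_mono (coe_integrable (M.R h s a : Measure unitInterval))
    (integrable_const (1 : ℝ)) (fun x => x.2.2)
  simpa [meanR] using this

theorem V_nonneg (π : Policy S A H) (h : Fin (H + 1)) (s : S) : 0 ≤ M.V π h s := by
  induction h using Fin.reverseInduction generalizing s with
  | last => rw [V_last]
  | cast h ih =>
    rw [V_castSucc]
    exact add_nonneg (M.meanR_nonneg _ _ _) (PV_nonneg ih)

theorem V_le (π : Policy S A H) (h : Fin (H + 1)) (s : S) : M.V π h s ≤ H - h := by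
  induction h using Fin.reverseInduction generalizing s with
  | last => rw [V_last]; simp
  | cast h ih =>
    rw [V_castSucc]
    have h1 := M.meanR_le_one h s (π h s)
    have h2 := M.PV_le (h := h) (s := s) (a := π h s) ih
    simp only [Fin.val_succ, Nat.cast_add, Nat.cast_one, Fin.val_castSucc] at h2 ⊢
    linarith

theorem V_le_H (π : Policy S A H) (h : Fin (H + 1)) (s : S) : M.V π h s ≤ H :=
  (M.V_le π h s).trans (by simp)

/-! ### Optimal values -/

theorem V_congr {π π' : Policy S A H} (h : Fin (H + 1))
    (hπ : ∀ t : Fin H, h ≤ t.castSucc → π t = π' t) : M.V π h = M.V π' h := by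
  induction h using Fin.reverseInduction with
  | last => funext s; rw [V_last, V_last]
  | cast h ih =>
    funext s
    rw [V_castSucc, V_castSucc, ih fun t ht => hπ t (h.castSucc_le_succ.trans ht), hπ h le_rfl]

/-- One policy is optimal from every step `h' ≥ h` and every state at once: act greedily with respect
to the values of the next step. -/
theorem exists_optimal_from [Finite A] [Nonempty A] (h : Fin (H + 1)) :
    ∃ π : Policy S A H, ∀ h', h ≤ h' → ∀ s π', M.V π' h' s ≤ M.V π h' s := by
  classical
  induction h using Fin.reverseInduction with
  | last =>
    refine ⟨fun _ _ => Classical.arbitrary A, fun h' hh s π' => ?_⟩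
    rw [Fin.last_le_iff.mp hh, V_last, V_last]
  | cast h ih =>
    obtain ⟨π, hπ⟩ := ih
    choose g hg using fun s => Finite.exists_max
      (fun a => M.meanR h s a + M.PV h s a (M.V π h.succ))
    refine ⟨Function.update π h g, fun h' hh s π' => ?_⟩
    have hV : ∀ h' : Fin (H + 1), h.succ ≤ h' → M.V (Function.update π h g) h' = M.V π h' := by
      intro h' hh'
      refine M.V_congr h' fun t ht => ?_
      rw [Function.update_of_ne]
      rintro rfl
      exact absurd (hh'.trans ht) (by simp)
    rcases hh.eq_or_lt with rfl | hlt
    · rw [V_castSucc, V_castSucc, hV _ le_rfl, Function.update_self]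
      refine le_trans ?_ (hg s (π' h s))
      gcongr
      exact PV_mono fun y => hπ _ le_rfl y π'
    · have := Fin.castSucc_lt_iff_succ_le.mp hlt
      rw [hV _ this]
      exact hπ _ this s π'

theorem exists_optimal [Finite A] [Nonempty A] :
    ∃ π : Policy S A H, ∀ h s, M.Vstar h s = M.V π h s := by
  obtain ⟨π, hπ⟩ := M.exists_optimal_from 0
  refine ⟨π, fun h s => le_antisymm (ciSup_le fun π' => hπ h (Fin.zero_le h) s π') ?_⟩
  exact le_ciSup (f := fun π => M.V π h s) (Set.finite_range _).bddAbove π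

theorem V_le_Vstar [Finite A] (π : Policy S A H) (h : Fin (H + 1)) (s : S) :
    M.V π h s ≤ M.Vstar h s :=
  le_ciSup (f := fun π => M.V π h s) (Set.finite_range _).bddAbove π

theorem Vstar_last [Finite A] [Nonempty A] (s : S) : M.Vstar (Fin.last H) s = 0 := by
  obtain ⟨π, hπ⟩ := M.exists_optimal
  rw [hπ, V_last]

theorem Vstar_nonneg [Finite A] [Nonempty A] (h : Fin (H + 1)) (s : S) : 0 ≤ M.Vstar h s := by
  obtain ⟨π, hπ⟩ := M.exists_optimal
  rw [hπ]; exact M.V_nonneg π h s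

theorem Vstar_le_H [Finite A] [Nonempty A] (h : Fin (H + 1)) (s : S) : M.Vstar h s ≤ H := by
  obtain ⟨π, hπ⟩ := M.exists_optimal
  rw [hπ]; exact M.V_le_H π h s

theorem le_Vstar_castSucc [Finite A] [Nonempty A] (h : Fin H) (s : S) (a : A) :
    M.meanR h s a + M.PV h s a (M.Vstar h.succ) ≤ M.Vstar h.castSucc s := by
  classical
  obtain ⟨π, hπ⟩ := M.exists_optimal
  have h1 := M.V_le_Vstar (Function.update π h fun _ => a) h.castSucc s
  rw [V_castSucc, Function.update_self] at h1
  have h2 : M.V (Function.update π h fun _ => a) h.succ = M.V π h.succ := by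
    refine M.V_congr _ fun t ht => ?_
    rw [Function.update_of_ne]
    rintro rfl
    exact absurd ht (by simp)
  rw [h2, ← show M.Vstar h.succ = M.V π h.succ from funext (hπ _)] at h1
  exact h1

theorem exists_Vstar_castSucc_eq [Finite A] [Nonempty A] (h : Fin H) (s : S) :
    ∃ a, M.Vstar h.castSucc s = M.meanR h s a + M.PV h s a (M.Vstar h.succ) := by
  obtain ⟨π, hπ⟩ := M.exists_optimal
  refine ⟨π h s, ?_⟩
  rw [hπ, V_castSucc, show M.Vstar h.succ = M.V π h.succ from funext (hπ _)]

/-! ### The total variance of a policy -/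

theorem rewardVar_nonneg (h : Fin H) (s : S) (a : A) : 0 ≤ M.rewardVar h s a :=
  variance_nonneg _ _

theorem rewardVar_eq (h : Fin H) (s : S) (a : A) :
    M.rewardVar h s a =
      ∫ x : unitInterval, (x : ℝ) ^ 2 ∂(M.R h s a : Measure unitInterval) - M.meanR h s a ^ 2 := by
  rw [rewardVar, variance_eq_sub]
  · rfl
  · refine MemLp.of_bound measurable_subtype_coe.aestronglyMeasurable 1
      (Filter.Eventually.of_forall fun ρ => ?_)
    rw [Real.norm_eq_abs, abs_of_nonneg ρ.2.1]; exact ρ.2.2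

theorem rewardVar_le (h : Fin H) (s : S) (a : A) :
    M.rewardVar h s a ≤ M.meanR h s a - M.meanR h s a ^ 2 := by
  rw [rewardVar_eq]
  refine sub_le_sub_right (integral_mono ?_ (coe_integrable _) fun x => ?_) _
  · refine Integrable.of_bound (C := 1)
      (measurable_subtype_coe.pow_const 2).aestronglyMeasurable
      (Filter.Eventually.of_forall fun ρ => ?_)
    rw [Real.norm_eq_abs, abs_of_nonneg (sq_nonneg _)]
    exact pow_le_one₀ ρ.2.1 ρ.2.2
  · exact pow_le_of_le_one x.2.1 x.2.2 two_ne_zero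

/-- The conditional variance incurred at step `h` in state `s` under `π`. -/
def stepVar (π : Policy S A H) (h : Fin H) (s : S) : ℝ :=
  M.rewardVar h s (π h s) + wvar (M.P h s (π h s)) (M.V π h.succ)

theorem stepVar_nonneg (π : Policy S A H) (h : Fin H) (s : S) : 0 ≤ M.stepVar π h s :=
  add_nonneg (M.rewardVar_nonneg _ _ _) (wvar_nonneg (M.P_nonneg _ _ _) _)

theorem addV_nonneg {π : Policy S A H} {c : Fin H → S → ℝ} (hc : ∀ h s, 0 ≤ c h s)
    (h : Fin (H + 1)) (s : S) : 0 ≤ M.addV π c h s := by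
  induction h using Fin.reverseInduction generalizing s with
  | last => rw [addV_last]
  | cast h ih =>
    rw [addV_castSucc]
    exact add_nonneg (hc _ _) (PV_nonneg ih)

/-- By the law of total variance, the left side is the second moment of the return from step `h`,
and that return lies in `[0, H - h]`. -/
theorem addV_stepVar_add_sq_le (π : Policy S A H) (h : Fin (H + 1)) (s : S) :
    M.addV π (M.stepVar π) h s + M.V π h s ^ 2 ≤ (H - h) * M.V π h s := by
  induction h using Fin.reverseInduction generalizing s with
  | last => simp [addV_last, V_last]
  | cast h ih =>
    rw [addV_castSucc, V_castSucc, stepVar, wvar_eq (M.P_sum _ _ _)]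
    have h1 := M.rewardVar_le h s (π h s)
    have h2 := M.meanR_le_one h s (π h s)
    have h3 := M.meanR_nonneg h s (π h s)
    have h4 := M.PV_mono (h := h) (s := s) (a := π h s) ih
    rw [PV_add, PV_smul] at h4
    have h5 := M.PV_le (h := h) (s := s) (a := π h s) (M.V_le π h.succ)
    have h6 := M.PV_nonneg (h := h) (s := s) (a := π h s) (M.V_nonneg π h.succ)
    change M.rewardVar h s (π h s) + (M.PV h s (π h s) (fun y => M.V π h.succ y ^ 2) -
      M.PV h s (π h s) (M.V π h.succ) ^ 2) + _ + _ ≤ _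
    simp only [Fin.val_succ, Nat.cast_add, Nat.cast_one, Fin.val_castSucc] at h4 h5 ⊢
    nlinarith [mul_nonneg h3 (sub_nonneg.2 h5), mul_nonneg h6 (sub_nonneg.2 h2)]

theorem addV_stepVar_le (π : Policy S A H) (h : Fin (H + 1)) (s : S) :
    M.addV π (M.stepVar π) h s ≤ (H : ℝ) ^ 2 := by
  have h1 := M.addV_stepVar_add_sq_le π h s
  have h2 := M.V_le_H π h s
  have h3 := M.V_nonneg π h s
  have h4 : (0 : ℝ) ≤ (h : ℕ) := Nat.cast_nonneg _
  nlinarith [sq_nonneg (M.V π h s), mul_nonneg h4 h3,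
    mul_le_mul_of_nonneg_left h2 (Nat.cast_nonneg (α := ℝ) H)]

theorem addV_stepVar_le_maxVar [Finite A] (π : Policy S A H) (s : S) :
    M.addV π (M.stepVar π) 0 s ≤ M.maxVar := by
  have h1 : M.addV π (M.stepVar π) 0 s = M.policyVar π s := by
    rw [policyVar_eq_addV]; rfl
  rw [h1]
  refine (le_ciSup (f := M.policyVar π) (Set.finite_range _).bddAbove s).trans ?_
  exact le_ciSup (f := fun π => ⨆ s, M.policyVar π s) (Set.finite_range _).bddAbove π

end MDP

/-! ### Exponential supermartingales along the interaction -/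

/-- If, on the event `E` of the past `φ`, the past is independent of the pair formed by `r` and the
event `T`, on which `r` has the law `c ν`, then functions of the past and of `r` integrate
accordingly. -/
theorem setLIntegral_eq_of_indep {Ω Ω' I : Type*} [MeasurableSpace Ω] [MeasurableSpace Ω']
    [MeasurableSpace I] (μ : Measure Ω) [IsFiniteMeasure μ] {φ : Ω → Ω'} (hφ : Measurable φ)
    {r : Ω → I} (hr : Measurable r) (T : Set Ω)
    {E : Set Ω'} (ν : Measure I) [IsProbabilityMeasure ν] {c : ℝ≥0∞} (hc : c ≠ ∞)
    (hlaw : ∀ A B, MeasurableSet A → MeasurableSet B →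
      μ (φ ⁻¹' A ∩ r ⁻¹' B ∩ (φ ⁻¹' E ∩ T)) = c * μ (φ ⁻¹' A ∩ φ ⁻¹' E) * ν B)
    {w : Ω' → I → ℝ≥0∞} (hw : Measurable fun q : Ω' × I => w q.1 q.2) :
    ∫⁻ ω in φ ⁻¹' E ∩ T, w (φ ω) (r ω) ∂μ =
      ∫⁻ ω in φ ⁻¹' E, (c * ∫⁻ ρ, w (φ ω) ρ ∂ν) ∂μ := by
  have hprod : (c • (μ.restrict (φ ⁻¹' E)).map φ).prod ν =
      (μ.restrict (φ ⁻¹' E ∩ T)).map fun ω => (φ ω, r ω) := by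
    have : IsFiniteMeasure (c • (μ.restrict (φ ⁻¹' E)).map φ) :=
      Measure.smul_finite _ hc
    refine Measure.prod_eq fun A B hA hB => ?_
    rw [Measure.map_apply (hφ.prodMk hr) (hA.prod hB), Measure.restrict_apply,
      Measure.smul_apply, Measure.map_apply hφ hA, Measure.restrict_apply (hφ hA), smul_eq_mul,
      ← hlaw A B hA hB]
    · rfl
    · exact (hφ.prodMk hr) (hA.prod hB)
  have h1 : ∫⁻ ω in φ ⁻¹' E ∩ T, w (φ ω) (r ω) ∂μ =
      ∫⁻ q, w q.1 q.2 ∂((μ.restrict (φ ⁻¹' E ∩ T)).map fun ω => (φ ω, r ω)) := by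
    rw [lintegral_map hw (hφ.prodMk hr)]
  rw [h1, ← hprod, lintegral_prod _ hw.aemeasurable, lintegral_smul_measure,
    lintegral_map hw.lintegral_prod_right' hφ, lintegral_const_mul, smul_eq_mul]
  exact hw.lintegral_prod_right'.comp hφ

namespace IsInteraction

variable {S A : Type*} [Fintype S] [MeasurableSpace S] [DiscreteMeasurableSpace S]
  [Fintype A] [MeasurableSpace A] [DiscreteMeasurableSpace A] {H K : ℕ} {M : MDP S A H}
  {Ω : Type*} {mΩ : MeasurableSpace Ω} {μ : Measure Ω} [IsProbabilityMeasure μ]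
  {𝓕 : Filtration ℕ mΩ} {s : ℕ → Fin (H + 1) → Ω → S} {π : ℕ → Ω → Policy S A H}
  {r : ℕ → Fin H → Ω → unitInterval}

theorem mono (hI : IsInteraction M K μ 𝓕 s π r) {K' : ℕ} (hK : K' ≤ K) :
    IsInteraction M K' μ 𝓕 s π r where
  state_meas k hk := hI.state_meas k (hk.trans_le hK)
  policy_meas k hk := hI.policy_meas k (hk.trans_le hK)
  reward_meas k hk := hI.reward_meas k (hk.trans_le hK)
  law k hk := hI.law k (hk.trans_le hK)

theorem measurable_state (hI : IsInteraction M K μ 𝓕 s π r) {k : ℕ} (hk : k < K)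
    (h : Fin (H + 1)) {t : ℕ} (ht : k * (H + 1) + h ≤ t) : Measurable[𝓕 t] (s k h) :=
  (hI.state_meas k hk h).mono (𝓕.mono ht) le_rfl

theorem measurable_action (hI : IsInteraction M K μ 𝓕 s π r) {k : ℕ} (hk : k < K)
    (h : Fin H) {t : ℕ} (ht : k * (H + 1) + h ≤ t) :
    Measurable[𝓕 t] fun ω => π k ω h (s k h.castSucc ω) := by
  refine (measurable_from_prod_countable_right (f := fun q : S × Ω => π k q.2 h q.1)
    fun x => ?_).comp
    (Measurable.prodMk (hI.measurable_state hk h.castSucc (t := t) (by simpa using ht))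
      measurable_id)
  exact (hI.policy_meas k hk h x).mono (𝓕.mono (le_trans (Nat.le_add_right _ _) ht)) le_rfl

theorem measurableSet_visit (hI : IsInteraction M K μ 𝓕 s π r) {k : ℕ} (hk : k < K)
    (h : Fin H) (x : S) (a : A) {t : ℕ} (ht : k * (H + 1) + h ≤ t) :
    MeasurableSet[𝓕 t] {ω | s k h.castSucc ω = x ∧ π k ω h (s k h.castSucc ω) = a} := by
  refine MeasurableSet.inter ?_ ?_
  · exact hI.measurable_state hk h.castSucc (by simpa using ht) (measurableSet_singleton x)
  · exact hI.measurable_action hk h ht (measurableSet_singleton a)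

/-- The conditional law of the reward and of the next state, integrated over an event of the
past. -/
theorem measure_visit (hI : IsInteraction M K μ 𝓕 s π r) {k : ℕ} (hk : k < K)
    (h : Fin H) (x : S) (a : A) (y : S) {C : Set Ω} {B : Set unitInterval}
    (hC : MeasurableSet[𝓕 (k * (H + 1) + h)] C) (hB : MeasurableSet B) :
    μ (C ∩ r k h ⁻¹' B ∩ ({ω | s k h.castSucc ω = x ∧ π k ω h (s k h.castSucc ω) = a} ∩
      {ω | s k h.succ ω = y})) =
      ENNReal.ofReal (M.P h x a y) *
        μ (C ∩ {ω | s k h.castSucc ω = x ∧ π k ω h (s k h.castSucc ω) = a}) *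
        (M.R h x a : Measure unitInterval) B := by
  set E := {ω | s k h.castSucc ω = x ∧ π k ω h (s k h.castSucc ω) = a}
  set D := {ω | r k h ω ∈ B ∧ s k h.succ ω = y}
  have hE : MeasurableSet[𝓕 (k * (H + 1) + h)] E := hI.measurableSet_visit hk h x a le_rfl
  have hCE : MeasurableSet[𝓕 (k * (H + 1) + h)] (C ∩ E) := hC.inter hE
  have hD : MeasurableSet D := by
    refine MeasurableSet.inter ?_ ?_
    · exact ((hI.reward_meas k hk h).mono (𝓕.le _) le_rfl) hB
    · exact ((hI.state_meas k hk h.succ).mono (𝓕.le _) le_rfl) (measurableSet_singleton y)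
  have h1 := setIntegral_condExp (μ := μ) (𝓕.le (k * (H + 1) + h))
    ((integrable_const (1 : ℝ)).indicator hD) hCE
  have h2 : ∫ ω in C ∩ E, (μ[D.indicator (fun _ => (1 : ℝ)) | 𝓕 (k * (H + 1) + h)]) ω ∂μ =
      ∫ _ in C ∩ E, (M.R h x a : Measure unitInterval).real B * M.P h x a y ∂μ := by
    refine setIntegral_congr_ae (𝓕.le _ _ hCE) ?_
    filter_upwards [hI.law k hk h B y hB] with ω hω hωE
    rw [hω, hωE.2.2, hωE.2.1]
  rw [h2, setIntegral_indicator hD] at h1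
  simp only [integral_const, measureReal_restrict_apply_univ, smul_eq_mul, mul_one] at h1
  have h3 : C ∩ r k h ⁻¹' B ∩ (E ∩ {ω | s k h.succ ω = y}) = C ∩ E ∩ D := by
    ext ω; simp only [D, Set.mem_inter_iff, Set.mem_preimage, Set.mem_ofPred_eq]; tauto
  rw [h3, ← ofReal_measureReal (s := C ∩ E ∩ D), ← h1,
    ENNReal.ofReal_mul measureReal_nonneg,
    ENNReal.ofReal_mul measureReal_nonneg, ofReal_measureReal, ofReal_measureReal]
  ring

/-- One step of the interaction, integrated: a function of the past, of the reward and of the next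
state has the same integral as its conditional expectation under the model. -/
theorem lintegral_step (hI : IsInteraction M K μ 𝓕 s π r) {k : ℕ} (hk : k < K) (h : Fin H)
    {w : Ω → unitInterval → S → ℝ≥0∞}
    (hw : ∀ y, Measurable[(𝓕 (k * (H + 1) + h)).prod inferInstance]
      fun q : Ω × unitInterval => w q.1 q.2 y) :
    ∫⁻ ω, w ω (r k h ω) (s k h.succ ω) ∂μ =
      ∫⁻ ω, ∑ y, ENNReal.ofReal
        (M.P h (s k h.castSucc ω) (π k ω h (s k h.castSucc ω)) y) *
        ∫⁻ ρ, w ω ρ y ∂(M.R h (s k h.castSucc ω) (π k ω h (s k h.castSucc ω)) :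
          Measure unitInterval) ∂μ := by
  classical
  set E : S × A → Set Ω := fun q =>
    {ω | s k h.castSucc ω = q.1 ∧ π k ω h (s k h.castSucc ω) = q.2} with hEdef
  set T : S → Set Ω := fun y => {ω | s k h.succ ω = y} with hTdef
  have hE : ∀ q, MeasurableSet (E q) := fun q =>
    𝓕.le _ _ (hI.measurableSet_visit hk h q.1 q.2 le_rfl)
  have hT : ∀ y, MeasurableSet (T y) := fun y =>
    ((hI.state_meas k hk h.succ).mono (𝓕.le _) le_rfl) (measurableSet_singleton y)
  have split : ∀ f : Ω → ℝ≥0∞, ∫⁻ ω, f ω ∂μ = ∑ q : S × A, ∫⁻ ω in E q, f ω ∂μ := by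
    intro f
    rw [← lintegral_biUnion_finset (s := Finset.univ)]
    · have : ⋃ q ∈ (Finset.univ : Finset (S × A)), E q = Set.univ := by
        ext ω; simp [hEdef]
      rw [this, Measure.restrict_univ]
    · intro q _ q' _ hne
      refine Set.disjoint_left.2 fun ω h1 h2 => hne ?_
      exact Prod.ext (h1.1.symm.trans h2.1) (h1.2.symm.trans h2.2)
    · exact fun q _ => hE q
  have splitT : ∀ (q : S × A) (f : Ω → ℝ≥0∞),
      ∫⁻ ω in E q, f ω ∂μ = ∑ y, ∫⁻ ω in E q ∩ T y, f ω ∂μ := by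
    intro q f
    rw [← lintegral_biUnion_finset (s := Finset.univ)]
    · have : ⋃ y ∈ (Finset.univ : Finset S), E q ∩ T y = E q := by
        ext ω; simp [hTdef]
      rw [this]
    · intro y _ y' _ hne
      refine Set.disjoint_left.2 fun ω h1 h2 => hne ?_
      exact h1.2.symm.trans h2.2
    · exact fun y _ => (hE q).inter (hT y)
  rw [split, split]
  refine Finset.sum_congr rfl fun q _ => ?_
  rw [splitT]
  have h1 : ∀ y, ∫⁻ ω in E q ∩ T y, w ω (r k h ω) (s k h.succ ω) ∂μ =
      ∫⁻ ω in E q, ENNReal.ofReal (M.P h q.1 q.2 y) *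
        ∫⁻ ρ, w ω ρ y ∂(M.R h q.1 q.2 : Measure unitInterval) ∂μ := by
    intro y
    rw [setLIntegral_congr_fun (g := fun ω => w ω (r k h ω) y) ((hE q).inter (hT y))
      (fun ω hω => by rw [show s k h.succ ω = y from hω.2])]
    -- the past is `Ω` itself, with the smaller σ-algebra
    refine @setLIntegral_eq_of_indep Ω Ω unitInterval mΩ (𝓕 (k * (H + 1) + h)) _ μ _ id
      (measurable_id'' (𝓕.le _)) (r k h) ((hI.reward_meas k hk h).mono (𝓕.le _) le_rfl) (T y)
      (E q) (M.R h q.1 q.2 : Measure unitInterval) inferInstance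
      (ENNReal.ofReal (M.P h q.1 q.2 y)) ENNReal.ofReal_ne_top (fun C B hC hB => ?_)
      (fun ω ρ => w ω ρ y) (hw y)
    exact hI.measure_visit hk h q.1 q.2 y hC hB
  simp only [h1]
  rw [← lintegral_finsetSum]
  · refine setLIntegral_congr_fun (hE q) fun ω hω => ?_
    have h2 : π k ω h q.1 = q.2 := by rw [← hω.1]; exact hω.2
    simp only [hω.1, h2]
  · intro y _
    refine Measurable.const_mul ?_ _
    have := @Measurable.lintegral_prod_right' Ω unitInterval (𝓕 (k * (H + 1) + h)) _
      (M.R h q.1 q.2 : Measure unitInterval) _ _ (hw y)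
    exact this.mono (𝓕.le _) le_rfl

/-- A product of nonnegative factors, each with conditional expectation at most `1`, has expectation
at most `1`. -/
theorem lintegral_prod_le_one (hI : IsInteraction M K μ 𝓕 s π r)
    {w : ℕ → Fin H → Ω → unitInterval → S → ℝ≥0∞}
    (hw : ∀ k < K, ∀ h : Fin H, ∀ y, Measurable[(𝓕 (k * (H + 1) + h)).prod inferInstance]
      fun q : Ω × unitInterval => w k h q.1 q.2 y)
    (hle : ∀ k < K, ∀ (h : Fin H) ω, ∑ y, ENNReal.ofReal
        (M.P h (s k h.castSucc ω) (π k ω h (s k h.castSucc ω)) y) *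
        ∫⁻ ρ, w k h ω ρ y ∂(M.R h (s k h.castSucc ω) (π k ω h (s k h.castSucc ω)) :
          Measure unitInterval) ≤ 1) :
    Measurable (fun ω => ∏ k ∈ Finset.range K, ∏ h, w k h ω (r k h ω) (s k h.succ ω)) ∧
    ∫⁻ ω, ∏ k ∈ Finset.range K, ∏ h, w k h ω (r k h ω) (s k h.succ ω) ∂μ ≤ 1 := by
  have hmeas : ∀ k < K, ∀ h : Fin H, Measurable[𝓕 (k * (H + 1) + h + 1)]
      fun ω => w k h ω (r k h ω) (s k h.succ ω) := by
    intro k hk h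
    have h1 : Measurable[((𝓕 (k * (H + 1) + h)).prod inferInstance).prod inferInstance]
        fun q : (Ω × unitInterval) × S => w k h q.1.1 q.1.2 q.2 := by
      let _ : MeasurableSpace Ω := 𝓕 (k * (H + 1) + h)
      exact measurable_from_prod_countable_left fun y => hw k hk h y
    have h2 : Measurable[𝓕 (k * (H + 1) + h + 1),
        ((𝓕 (k * (H + 1) + h)).prod inferInstance).prod inferInstance]
        fun ω => ((ω, r k h ω), s k h.succ ω) := by
      refine @Measurable.prodMk _ _ _ _ (_) (_) _ _ ?_ (hI.state_meas k hk h.succ)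
      refine @Measurable.prodMk _ _ _ (_) _ (_) _ _ ?_ (hI.reward_meas k hk h)
      exact measurable_id'' (𝓕.mono (Nat.le_succ _))
    exact h1.comp h2
  suffices hmain : ∀ n ≤ K, Measurable[𝓕 (n * (H + 1))]
      (fun ω => ∏ k ∈ Finset.range n, ∏ h, w k h ω (r k h ω) (s k h.succ ω)) ∧
      ∫⁻ ω, ∏ k ∈ Finset.range n, ∏ h, w k h ω (r k h ω) (s k h.succ ω) ∂μ ≤ 1 from
    ⟨(hmain K le_rfl).1.mono (𝓕.le _) le_rfl, (hmain K le_rfl).2⟩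
  intro n
  induction n with
  | zero => intro _; simp
  | succ n ih =>
    intro hn
    obtain ⟨ih1, ih2⟩ := ih (Nat.le_of_succ_le hn)
    -- the factors of the first `m` steps of episode `n`
    have inner : ∀ m ≤ H, Measurable[𝓕 (n * (H + 1) + m)]
        (fun ω => (∏ k ∈ Finset.range n, ∏ h, w k h ω (r k h ω) (s k h.succ ω)) *
          ∏ i ∈ Finset.range m, if hi : i < H then
            w n ⟨i, hi⟩ ω (r n ⟨i, hi⟩ ω) (s n (Fin.succ ⟨i, hi⟩) ω) else 1) ∧
        ∫⁻ ω, (∏ k ∈ Finset.range n, ∏ h, w k h ω (r k h ω) (s k h.succ ω)) *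
          ∏ i ∈ Finset.range m, (if hi : i < H then
            w n ⟨i, hi⟩ ω (r n ⟨i, hi⟩ ω) (s n (Fin.succ ⟨i, hi⟩) ω) else 1) ∂μ ≤ 1 := by
      intro m
      induction m with
      | zero => intro _; simpa using ⟨ih1, ih2⟩
      | succ m ihm =>
        intro hm
        obtain ⟨hm1, hm2⟩ := ihm (Nat.le_of_succ_le hm)
        have hmH : m < H := hm
        simp only [Finset.prod_range_succ, dif_pos hmH, ← mul_assoc]
        constructor
        · exact Measurable.mul (hm1.mono (𝓕.mono (Nat.le_succ _)) le_rfl)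
            (hmeas n hn ⟨m, hmH⟩)
        · refine le_trans (le_of_eq (hI.lintegral_step hn ⟨m, hmH⟩
            (w := fun ω ρ y => (∏ k ∈ Finset.range n, ∏ h, w k h ω (r k h ω) (s k h.succ ω)) *
              (∏ i ∈ Finset.range m, if hi : i < H then
                w n ⟨i, hi⟩ ω (r n ⟨i, hi⟩ ω) (s n (Fin.succ ⟨i, hi⟩) ω) else 1) *
              w n ⟨m, hmH⟩ ω ρ y) fun y => ?_)) ?_
          · exact Measurable.mul (hm1.comp (@measurable_fst _ _ (_) _)) (hw n hn ⟨m, hmH⟩ y)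
          · refine le_trans (lintegral_mono fun ω => ?_) hm2
            simp only
            have hwm : ∀ y, Measurable fun ρ => w n ⟨m, hmH⟩ ω ρ y := fun y =>
              (hw n hn ⟨m, hmH⟩ y).comp (@measurable_prodMk_left _ _ (_) _ ω)
            simp only [fun y => lintegral_const_mul
              ((∏ k ∈ Finset.range n, ∏ h, w k h ω (r k h ω) (s k h.succ ω)) *
              (∏ i ∈ Finset.range m, if hi : i < H then
                w n ⟨i, hi⟩ ω (r n ⟨i, hi⟩ ω) (s n (Fin.succ ⟨i, hi⟩) ω) else 1)) (hwm y)
              (μ := (M.R ⟨m, hmH⟩ (s n (Fin.castSucc ⟨m, hmH⟩) ω)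
                (π n ω ⟨m, hmH⟩ (s n (Fin.castSucc ⟨m, hmH⟩) ω)) : Measure unitInterval))]
            simp only [mul_left_comm (ENNReal.ofReal _), ← Finset.mul_sum]
            exact mul_le_of_le_one_right' (hle n hn ⟨m, hmH⟩ ω)
    have := inner H le_rfl
    simp only [Finset.prod_range (n := H), Fin.is_lt, dite_true, Fin.eta] at this
    simp only [Finset.prod_range_succ]
    refine ⟨this.1.mono (𝓕.mono ?_) le_rfl, this.2⟩
    rw [Nat.succ_mul]; omega

/-- Markov's inequality for the product in `lintegral_prod_le_one`. -/
theorem measure_lt_le (hI : IsInteraction M K μ 𝓕 s π r)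
    {w : ℕ → Fin H → Ω → unitInterval → S → ℝ≥0∞}
    (hw : ∀ k < K, ∀ h : Fin H, ∀ y, Measurable[(𝓕 (k * (H + 1) + h)).prod inferInstance]
      fun q : Ω × unitInterval => w k h q.1 q.2 y)
    (hle : ∀ k < K, ∀ (h : Fin H) ω, ∑ y, ENNReal.ofReal
        (M.P h (s k h.castSucc ω) (π k ω h (s k h.castSucc ω)) y) *
        ∫⁻ ρ, w k h ω ρ y ∂(M.R h (s k h.castSucc ω) (π k ω h (s k h.castSucc ω)) :
          Measure unitInterval) ≤ 1)
    {ξ : Ω → ℝ} (hξ : ∀ ω, ENNReal.ofReal (Real.exp (ξ ω)) ≤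
      ∏ k ∈ Finset.range K, ∏ h, w k h ω (r k h ω) (s k h.succ ω)) (L : ℝ) :
    μ {ω | L < ξ ω} ≤ ENNReal.ofReal (Real.exp (-L)) := by
  obtain ⟨h1, h2⟩ := hI.lintegral_prod_le_one hw hle
  have h3 : {ω | L < ξ ω} ⊆ {ω | ENNReal.ofReal (Real.exp L) ≤
      ∏ k ∈ Finset.range K, ∏ h, w k h ω (r k h ω) (s k h.succ ω)} := fun ω hω =>
    (ENNReal.ofReal_le_ofReal (Real.exp_le_exp.2 (le_of_lt hω))).trans (hξ ω)
  refine (measure_mono h3).trans ((meas_ge_le_lintegral_div h1.aemeasurable ?_ ?_).trans ?_)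
  · simpa using Real.exp_pos L
  · exact ENNReal.ofReal_ne_top
  · rw [Real.exp_neg, ENNReal.ofReal_inv_of_pos (Real.exp_pos L), ← one_div]
    exact ENNReal.div_le_div_right h2 _

end IsInteraction

/-! ### Potential arguments and empirical Bernstein bounds -/

theorem prod_succ_div_castSucc {n : ℕ} (f : Fin (n + 1) → ℝ) (hf : ∀ i, f i ≠ 0) :
    ∏ i : Fin n, f i.succ / f i.castSucc = f (Fin.last n) / f 0 := by
  induction n with
  | zero => simp [div_self (hf 0)]
  | succ n ih =>
    rw [Fin.prod_univ_castSucc]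
    have := ih (fun i => f i.castSucc) fun i => hf _
    simp only [← Fin.succ_castSucc] at this ⊢
    rw [this, Fin.castSucc_zero, Fin.succ_last, div_mul_div_comm, mul_comm,
      mul_div_mul_right _ _ (hf _)]

namespace MDP

variable {S A : Type*} [Fintype S] {H : ℕ} (M : MDP S A H)

/-- The expectation of `q r s'` for the reward `r` and the next state `s'` after playing `a` in the
state `x` at step `h`. -/
def outcomeMean (h : Fin H) (x : S) (a : A) (q : unitInterval → S → ℝ) : ℝ :=
  ∑ y, M.P h x a y * ∫ ρ, q ρ y ∂(M.R h x a : Measure unitInterval)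

theorem sum_ofReal_mul_lintegral_le (h : Fin H) (x : S) (a : A) {u q : unitInterval → S → ℝ}
    (hu : ∀ ρ y, u ρ y ≤ q ρ y) (hq : ∀ ρ y, 0 ≤ q ρ y)
    (hqi : ∀ y, Integrable (fun ρ => q ρ y) (M.R h x a : Measure unitInterval))
    (hle : M.outcomeMean h x a q ≤ 1) :
    ∑ y, ENNReal.ofReal (M.P h x a y) *
      ∫⁻ ρ, ENNReal.ofReal (u ρ y) ∂(M.R h x a : Measure unitInterval) ≤ 1 := by
  calc _ ≤ ∑ y, ENNReal.ofReal (M.P h x a y) *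
      ∫⁻ ρ, ENNReal.ofReal (q ρ y) ∂(M.R h x a : Measure unitInterval) := by
        gcongr with y _ ρ
        exact hu _ _
    _ = ENNReal.ofReal (M.outcomeMean h x a q) := by
        rw [outcomeMean, ENNReal.ofReal_sum_of_nonneg]
        · refine Finset.sum_congr rfl fun y _ => ?_
          rw [ENNReal.ofReal_mul (M.P_nonneg _ _ _ _), ofReal_integral_eq_lintegral_ofReal (hqi y)]
          exact Filter.Eventually.of_forall fun ρ => hq ρ y
        · exact fun y _ => mul_nonneg (M.P_nonneg _ _ _ _) (integral_nonneg fun ρ => hq ρ y)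
    _ ≤ 1 := by simpa using hle

end MDP

namespace IsInteraction

variable {S A : Type*} [Fintype S] [MeasurableSpace S] [DiscreteMeasurableSpace S]
  [Fintype A] [MeasurableSpace A] [DiscreteMeasurableSpace A] {H K : ℕ} {M : MDP S A H}
  {Ω : Type*} {mΩ : MeasurableSpace Ω} {μ : Measure Ω} [IsProbabilityMeasure μ]
  {𝓕 : Filtration ℕ mΩ} {s : ℕ → Fin (H + 1) → Ω → S} {π : ℕ → Ω → Policy S A H}
  {r : ℕ → Fin H → Ω → unitInterval}

/-- A positive potential `Φ` that, discounted by `exp (-c)`, does not increase in expectation along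
the policy of each episode bounds the total gain over cost. The products of the ratios
`Φ (s_{h+1}) exp (-c (s_h)) / Φ (s_h)` form a supermartingale, and over one episode the ratios
telescope to at least `exp (g - ∑ c)`. -/
theorem measure_potential_le (hI : IsInteraction M K μ 𝓕 s π r)
    {Φ : ℕ → Fin (H + 1) → Ω → S → ℝ} {c : ℕ → Fin H → Ω → S → ℝ} {g : ℕ → Ω → ℝ}
    (hΦm : ∀ k < K, ∀ h y, Measurable[𝓕 (k * (H + 1))] fun ω => Φ k h ω y)
    (hcm : ∀ k < K, ∀ h y, Measurable[𝓕 (k * (H + 1))] fun ω => c k h ω y)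
    (hpos : ∀ k < K, ∀ h ω y, 0 < Φ k h ω y)
    (hstep : ∀ k < K, ∀ (h : Fin H) ω x,
      M.PV h x (π k ω h x) (Φ k h.succ ω) * Real.exp (-c k h ω x) ≤ Φ k h.castSucc ω x)
    (hg : ∀ k < K, ∀ ω, Real.exp (g k ω) * Φ k 0 ω (s k 0 ω) ≤
      Φ k (Fin.last H) ω (s k (Fin.last H) ω)) (L : ℝ) :
    μ {ω | L < ∑ k ∈ Finset.range K, (g k ω - ∑ h, c k h ω (s k h.castSucc ω))} ≤
      ENNReal.ofReal (Real.exp (-L)) := by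
  have heval : ∀ k < K, ∀ (h : Fin H) (f : Ω → S → ℝ),
      (∀ y, Measurable[𝓕 (k * (H + 1))] fun ω => f ω y) →
      Measurable[𝓕 (k * (H + 1) + h)] fun ω => f ω (s k h.castSucc ω) := by
    intro k hk h f hf
    have h1 : Measurable[(𝓕 (k * (H + 1) + h)).prod inferInstance]
        fun q : Ω × S => f q.1 q.2 := by
      let _ : MeasurableSpace Ω := 𝓕 (k * (H + 1) + h)
      exact measurable_from_prod_countable_left fun y =>
        (hf y).mono (𝓕.mono (Nat.le_add_right _ _)) le_rfl
    refine h1.comp (@Measurable.prodMk _ _ _ (_) _ (_) _ _ measurable_id ?_)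
    exact hI.measurable_state hk h.castSucc (by simp)
  refine hI.measure_lt_le (w := fun k h ω _ y => ENNReal.ofReal (Φ k h.succ ω y *
    Real.exp (-c k h ω (s k h.castSucc ω)) / Φ k h.castSucc ω (s k h.castSucc ω)))
    (fun k hk h y => ?_) (fun k hk h ω => ?_) (fun ω => ?_) L
  · have h1 : Measurable[𝓕 (k * (H + 1) + h)] fun ω => ENNReal.ofReal (Φ k h.succ ω y *
        Real.exp (-c k h ω (s k h.castSucc ω)) / Φ k h.castSucc ω (s k h.castSucc ω)) := by
      refine ((((hΦm k hk h.succ y).mono (𝓕.mono (Nat.le_add_right _ _)) le_rfl).mul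
        (heval k hk h _ (hcm k hk h)).neg.exp).div
        (heval k hk h _ (hΦm k hk h.castSucc))).ennreal_ofReal
    exact h1.comp (@measurable_fst _ _ (_) _)
  · refine M.sum_ofReal_mul_lintegral_le h _ _ (fun ρ y => le_rfl) (fun ρ y => ?_)
      (fun y => integrable_const _) ?_
    · exact div_nonneg (mul_nonneg (hpos k hk _ _ _).le (Real.exp_pos _).le) (hpos k hk _ _ _).le
    · have h1 := hstep k hk h ω (s k h.castSucc ω)
      simp only [MDP.outcomeMean, integral_const, probReal_univ, smul_eq_mul, one_mul]
      rw [← div_le_one (hpos k hk _ _ _)] at h1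
      refine le_trans (le_of_eq ?_) h1
      rw [MDP.PV, Finset.sum_mul, Finset.sum_div]
      exact Finset.sum_congr rfl fun y _ => by ring
  · have h1 : ∀ k ∈ Finset.range K, ∏ h : Fin H, ENNReal.ofReal (Φ k h.succ ω (s k h.succ ω) *
        Real.exp (-c k h ω (s k h.castSucc ω)) / Φ k h.castSucc ω (s k h.castSucc ω)) =
        ENNReal.ofReal (Φ k (Fin.last H) ω (s k (Fin.last H) ω) / Φ k 0 ω (s k 0 ω) *
          Real.exp (-∑ h, c k h ω (s k h.castSucc ω))) := by
      intro k hk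
      have hk := Finset.mem_range.1 hk
      rw [← ENNReal.ofReal_prod_of_nonneg fun h _ => div_nonneg
        (mul_nonneg (hpos k hk _ _ _).le (Real.exp_pos _).le) (hpos k hk _ _ _).le]
      congr 1
      rw [← prod_succ_div_castSucc (fun h => Φ k h ω (s k h ω)) fun h => (hpos k hk _ _ _).ne',
        ← Finset.sum_neg_distrib, Real.exp_sum, ← Finset.prod_mul_distrib]
      exact Finset.prod_congr rfl fun h _ => by ring
    rw [Finset.prod_congr rfl h1, ← ENNReal.ofReal_prod_of_nonneg, Real.exp_sum]
    · refine ENNReal.ofReal_le_ofReal (Finset.prod_le_prod (fun k _ => (Real.exp_pos _).le)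
        fun k hk => ?_)
      have hk := Finset.mem_range.1 hk
      rw [sub_eq_add_neg, Real.exp_add]
      refine mul_le_mul_of_nonneg_right ?_ (Real.exp_pos _).le
      rw [le_div_iff₀ (hpos k hk _ _ _)]
      exact hg k hk ω
    · intro k hk
      have hk := Finset.mem_range.1 hk
      exact mul_nonneg (div_nonneg (hpos k hk _ _ _).le (hpos k hk _ _ _).le) (Real.exp_pos _).le

/-- Exponential sums over the visits of a fixed triple `(h, x, a)`. The exponential is compared with
a function `q` whose mean is exactly computable. -/
theorem measure_visit_sum_le (hI : IsInteraction M K μ 𝓕 s π r) (h : Fin H) (x : S) (a : A)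
    {u q : unitInterval → S → ℝ} (hum : ∀ y, Measurable fun ρ => u ρ y)
    (hu : ∀ ρ y, Real.exp (u ρ y) ≤ q ρ y)
    (hqi : ∀ y, Integrable (fun ρ => q ρ y) (M.R h x a : Measure unitInterval))
    (hle : M.outcomeMean h x a q ≤ 1) (L : ℝ) [DecidableEq S] [DecidableEq A] :
    μ {ω | L < ∑ k ∈ Finset.range K,
      if s k h.castSucc ω = x ∧ π k ω h (s k h.castSucc ω) = a
        then u (r k h ω) (s k h.succ ω) else 0} ≤ ENNReal.ofReal (Real.exp (-L)) := by
  refine hI.measure_lt_le (w := fun k h' ω ρ y => ENNReal.ofReal (Real.exp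
    (if h' = h ∧ s k h.castSucc ω = x ∧ π k ω h (s k h.castSucc ω) = a then u ρ y else 0)))
    (fun k hk h' y => ?_) (fun k hk h' ω => ?_) (fun ω => ?_) L
  · refine (Measurable.exp ?_).ennreal_ofReal
    by_cases hh : h' = h
    · subst hh
      simp only [true_and]
      have hE := hI.measurableSet_visit hk h' x a le_rfl
      let _ : MeasurableSpace Ω := 𝓕 (k * (H + 1) + h')
      exact Measurable.ite (measurable_fst hE) ((hum y).comp measurable_snd) measurable_const
    · simp [hh]
  · by_cases hv : h' = h ∧ s k h.castSucc ω = x ∧ π k ω h (s k h.castSucc ω) = a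
    · obtain ⟨rfl, h1, h2⟩ := hv
      rw [h1] at h2
      simp only [h1, h2, and_self, if_true]
      exact M.sum_ofReal_mul_lintegral_le h' x a hu
        (fun ρ y => (Real.exp_pos _).le.trans (hu ρ y)) hqi hle
    · simp only [if_neg hv]
      refine M.sum_ofReal_mul_lintegral_le h' _ _ (q := fun _ _ => 1) (fun ρ y => by simp)
        (fun _ _ => zero_le_one) (fun y => integrable_const _) ?_
      simp [MDP.outcomeMean]
  · have h1 : ∀ k, ∏ h', ENNReal.ofReal (Real.exp
        (if h' = h ∧ s k h.castSucc ω = x ∧ π k ω h (s k h.castSucc ω) = a then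
          u (r k h' ω) (s k h'.succ ω) else 0)) = ENNReal.ofReal (Real.exp
        (if s k h.castSucc ω = x ∧ π k ω h (s k h.castSucc ω) = a then
          u (r k h ω) (s k h.succ ω) else 0)) := by
      intro k
      rw [Finset.prod_eq_single h]
      · simp
      · intro h' _ hne; simp [hne]
      · simp
    simp only [h1]
    rw [Real.exp_sum, ENNReal.ofReal_prod_of_nonneg fun k _ => (Real.exp_pos _).le]

end IsInteraction

section VisitSums

variable {S A : Type*} {H : ℕ}

open Classical in
/-- The sum of `f (reward) (next state)` over the visits of `(x, a)` at step `h` during the first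
`n` episodes. -/
def visitSum (s : ℕ → Fin (H + 1) → S) (π : ℕ → Policy S A H) (r : ℕ → Fin H → unitInterval)
    (n : ℕ) (h : Fin H) (x : S) (a : A) (f : unitInterval → S → ℝ) : ℝ :=
  ∑ k ∈ Finset.range n, if s k h.castSucc = x ∧ π k h (s k h.castSucc) = a
    then f (r k h) (s k h.succ) else 0

/-- The number of visits of `(x, a)` at step `h` during the first `n` episodes. -/
def visits (s : ℕ → Fin (H + 1) → S) (π : ℕ → Policy S A H) (r : ℕ → Fin H → unitInterval)
    (n : ℕ) (h : Fin H) (x : S) (a : A) : ℝ :=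
  visitSum s π r n h x a fun _ _ => 1

variable {s : ℕ → Fin (H + 1) → S} {π : ℕ → Policy S A H} {r : ℕ → Fin H → unitInterval}
  {n : ℕ} {h : Fin H} {x : S} {a : A}

theorem visitSum_add (f g : unitInterval → S → ℝ) :
    visitSum s π r n h x a (fun ρ y => f ρ y + g ρ y) =
      visitSum s π r n h x a f + visitSum s π r n h x a g := by
  rw [visitSum, visitSum, visitSum, ← Finset.sum_add_distrib]
  refine Finset.sum_congr rfl fun k _ => ?_
  split_ifs <;> simp

theorem visitSum_const_mul (c : ℝ) (f : unitInterval → S → ℝ) :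
    visitSum s π r n h x a (fun ρ y => c * f ρ y) = c * visitSum s π r n h x a f := by
  rw [visitSum, visitSum, Finset.mul_sum]
  refine Finset.sum_congr rfl fun k _ => ?_
  split_ifs <;> simp

theorem visitSum_mono {f g : unitInterval → S → ℝ} (hfg : ∀ ρ y, f ρ y ≤ g ρ y) :
    visitSum s π r n h x a f ≤ visitSum s π r n h x a g := by
  refine Finset.sum_le_sum fun k _ => ?_
  split_ifs
  · exact hfg _ _
  · exact le_rfl

theorem visitSum_const (c : ℝ) :
    visitSum s π r n h x a (fun _ _ => c) = c * visits s π r n h x a := by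
  rw [visits, ← visitSum_const_mul]; simp

theorem visitSum_quadratic (α β γ : ℝ) (f : unitInterval → S → ℝ) :
    visitSum s π r n h x a (fun ρ y => α * f ρ y + β * f ρ y ^ 2 + γ) =
      α * visitSum s π r n h x a f + β * visitSum s π r n h x a (fun ρ y => f ρ y ^ 2) +
        γ * visits s π r n h x a := by
  rw [visitSum_add, visitSum_const, visitSum_add, visitSum_const_mul,
    visitSum_const_mul _ fun ρ y => f ρ y ^ 2]

theorem visits_nonneg : 0 ≤ visits s π r n h x a := by
  unfold visits visitSum
  refine Finset.sum_nonneg fun k _ => ?_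
  split_ifs <;> norm_num

theorem visits_le : visits s π r n h x a ≤ n := by
  have : visits s π r n h x a ≤ ∑ k ∈ Finset.range n, (1 : ℝ) := by
    unfold visits visitSum
    refine Finset.sum_le_sum fun k _ => ?_
    split_ifs <;> norm_num
  simpa using this

theorem visits_pos_one_le (hN : 0 < visits s π r n h x a) : 1 ≤ visits s π r n h x a := by
  classical
  rw [visits, visitSum, Finset.sum_boole] at hN ⊢
  exact_mod_cast hN

end VisitSums

namespace MDP

variable {S A : Type*} [Fintype S] {H : ℕ} (M : MDP S A H)

/-- The variance of `q r s'` for the outcome `(r, s')` of playing `a` in `x` at step `h`. -/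
def outcomeVar (h : Fin H) (x : S) (a : A) (q : unitInterval → S → ℝ) : ℝ :=
  M.outcomeMean h x a (fun ρ y => q ρ y ^ 2) - M.outcomeMean h x a q ^ 2

variable {f : unitInterval → S → ℝ} {h : Fin H} {x : S} {a : A}

theorem integrable_of_mem_unit {g : unitInterval → ℝ} (hg : Measurable g)
    (h0 : ∀ ρ, 0 ≤ g ρ) (h1 : ∀ ρ, g ρ ≤ 1) (ν : Measure unitInterval) [IsProbabilityMeasure ν] :
    Integrable g ν :=
  Integrable.of_bound (C := 1) hg.aestronglyMeasurable (Filter.Eventually.of_forall fun ρ => by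
    rw [Real.norm_eq_abs, abs_of_nonneg (h0 ρ)]; exact h1 ρ)

theorem outcomeMean_quadratic (hfm : ∀ y, Measurable fun ρ => f ρ y)
    (hf0 : ∀ ρ y, 0 ≤ f ρ y) (hf1 : ∀ ρ y, f ρ y ≤ 1) (α β γ : ℝ) :
    M.outcomeMean h x a (fun ρ y => α * f ρ y + β * f ρ y ^ 2 + γ) =
      α * M.outcomeMean h x a f + β * M.outcomeMean h x a (fun ρ y => f ρ y ^ 2) + γ := by
  have e : ∀ y, ∫ ρ, (α * f ρ y + β * f ρ y ^ 2 + γ) ∂(M.R h x a : Measure unitInterval) =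
      α * ∫ ρ, f ρ y ∂(M.R h x a : Measure unitInterval) +
        β * ∫ ρ, f ρ y ^ 2 ∂(M.R h x a : Measure unitInterval) + γ := by
    intro y
    have i1 := integrable_of_mem_unit (hfm y) (fun ρ => hf0 ρ y) (fun ρ => hf1 ρ y)
      (M.R h x a : Measure unitInterval)
    have i2 := integrable_of_mem_unit ((hfm y).pow_const 2) (fun ρ => sq_nonneg _)
      (fun ρ => pow_le_one₀ (hf0 ρ y) (hf1 ρ y)) (M.R h x a : Measure unitInterval)
    have i3 : Integrable (fun ρ => α * f ρ y + β * f ρ y ^ 2) (M.R h x a : Measure unitInterval) :=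
      (i1.const_mul α).add (i2.const_mul β)
    rw [integral_add i3 (integrable_const _),
      integral_add (i1.const_mul α) (i2.const_mul β), integral_const_mul, integral_const_mul]
    simp
  simp only [outcomeMean, e]
  have : ∀ y, M.P h x a y * (α * ∫ ρ, f ρ y ∂(M.R h x a : Measure unitInterval) +
        β * ∫ ρ, f ρ y ^ 2 ∂(M.R h x a : Measure unitInterval) + γ) =
      α * (M.P h x a y * ∫ ρ, f ρ y ∂(M.R h x a : Measure unitInterval)) +
        β * (M.P h x a y * ∫ ρ, f ρ y ^ 2 ∂(M.R h x a : Measure unitInterval)) +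
        γ * M.P h x a y := fun y => by ring
  simp only [this, Finset.sum_add_distrib, ← Finset.mul_sum, P_sum, mul_one]

theorem outcomeMean_mono {g : unitInterval → S → ℝ}
    (hfi : ∀ y, Integrable (fun ρ => f ρ y) (M.R h x a : Measure unitInterval))
    (hgi : ∀ y, Integrable (fun ρ => g ρ y) (M.R h x a : Measure unitInterval))
    (hfg : ∀ ρ y, f ρ y ≤ g ρ y) : M.outcomeMean h x a f ≤ M.outcomeMean h x a g :=
  Finset.sum_le_sum fun y _ => mul_le_mul_of_nonneg_left
    (integral_mono (hfi y) (hgi y) fun ρ => hfg ρ y) (M.P_nonneg _ _ _ _)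

theorem outcomeMean_mem (hfm : ∀ y, Measurable fun ρ => f ρ y)
    (hf0 : ∀ ρ y, 0 ≤ f ρ y) (hf1 : ∀ ρ y, f ρ y ≤ 1) :
    0 ≤ M.outcomeMean h x a f ∧ M.outcomeMean h x a f ≤ 1 := by
  constructor
  · exact Finset.sum_nonneg fun y _ => mul_nonneg (M.P_nonneg _ _ _ _)
      (integral_nonneg fun ρ => hf0 ρ y)
  · have := M.outcomeMean_mono (h := h) (x := x) (a := a) (f := f) (g := fun _ _ => 1)
      (fun y => integrable_of_mem_unit (hfm y) (fun ρ => hf0 ρ y) (fun ρ => hf1 ρ y) _)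
      (fun y => integrable_const _) hf1
    refine this.trans ?_
    simp [outcomeMean]

end MDP

theorem exp_sub_two_mul_sq_le {y : ℝ} (hy : |y| ≤ 1 / 5) : Real.exp (y - 2 * y ^ 2) ≤ 1 + y := by
  obtain ⟨h1, h2⟩ := abs_le.1 hy
  have h3 : |y - 2 * y ^ 2| ≤ 1 := by rw [abs_le]; constructor <;> nlinarith
  have h4 := (abs_le.1 (Real.abs_exp_sub_one_sub_id_le h3)).2
  have h5 : (y - 2 * y ^ 2) ^ 2 ≤ 2 * y ^ 2 := by
    have : (1 - 2 * y) ^ 2 ≤ 2 := by nlinarith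
    nlinarith [mul_le_mul_of_nonneg_left this (sq_nonneg y)]
  linarith

theorem exp_le_one_add_two_mul {y : ℝ} (h0 : 0 ≤ y) (h1 : y ≤ 1) :
    Real.exp y ≤ 1 + 2 * y := by
  have h4 := (abs_le.1 (Real.abs_exp_sub_one_sub_id_le (x := y)
    (by rw [abs_of_nonneg h0]; exact h1))).2
  nlinarith

/-- Optimising the exponential inequality with parameter `1 / (j + 5)` over `j ≤ K`; the choice is
`j ≈ √(v N / L)`. A grid of parameters is used since the empirical variance `v` is random. -/
theorem abs_le_of_exp_bounds {N v d L : ℝ} {K : ℕ} (hN : 1 ≤ N) (hNK : N ≤ K) (hv0 : 0 ≤ v)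
    (hv1 : v ≤ 1) (hd : |d| ≤ 1) (hL : 1 ≤ L)
    (hb : ∀ j ≤ K, 1 / ((j : ℝ) + 5) * (N * |d|) ≤
      2 * (1 / ((j : ℝ) + 5)) ^ 2 * (N * v + N * d ^ 2) + L) :
    |d| ≤ 7 * √(v * L / N) + 12 * (L / N) := by
  set t := √(v * N / L) with ht
  have hN0 : 0 < N := by linarith
  have hL0 : 0 < L := by linarith
  have htK : t ≤ K := by
    refine le_trans ?_ hNK
    rw [ht, Real.sqrt_le_left (by linarith), div_le_iff₀ hL0]
    nlinarith [mul_le_mul_of_nonneg_right hv1 hN0.le, mul_nonneg hN0.le (sub_nonneg.2 hN),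
      mul_nonneg (sq_nonneg N) (sub_nonneg.2 hL)]
  have hj := hb ⌈t⌉₊ (Nat.ceil_le.2 htK)
  have ht0 : 0 ≤ t := Real.sqrt_nonneg _
  have hc1 : t ≤ ⌈t⌉₊ := Nat.le_ceil t
  have hc2 : (⌈t⌉₊ : ℝ) < t + 1 := Nat.ceil_lt_add_one ht0
  set l := (⌈t⌉₊ : ℝ) + 5 with hl
  have hl5 : 5 ≤ l := by linarith
  have hl0 : 0 < l := by linarith
  -- clear denominators and absorb the term with `d ^ 2`
  have h1 : |d| * N * l ≤ 2 * (N * v) + 2 * (N * d ^ 2) + L * l ^ 2 := by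
    have := mul_le_mul_of_nonneg_left hj (sq_nonneg l)
    have e1 : l ^ 2 * (1 / l * (N * |d|)) = |d| * N * l := by field_simp
    have e2 : l ^ 2 * (2 * (1 / l) ^ 2 * (N * v + N * d ^ 2) + L) =
      2 * (N * v) + 2 * (N * d ^ 2) + L * l ^ 2 := by field_simp
    linarith
  have h2 : N * d ^ 2 ≤ |d| * N * l / 5 := by
    rw [← sq_abs d]
    have : |d| * N * 5 ≤ |d| * N * l := by gcongr
    nlinarith [mul_le_mul_of_nonneg_left hd (mul_nonneg (abs_nonneg d) hN0.le)]
  have h3 : |d| * N * l ≤ 5 * (N * v) + 2 * (L * l ^ 2) := by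
    nlinarith [mul_nonneg hN0.le hv0, mul_nonneg hL0.le (sq_nonneg l)]
  set q := √(v * L / N) with hq
  have hq0 : 0 ≤ q := Real.sqrt_nonneg _
  have htq : t * q = v := by
    rw [ht, hq, ← Real.sqrt_mul (by positivity)]
    have : v * N / L * (v * L / N) = v ^ 2 := by field_simp
    rw [this, Real.sqrt_sq hv0]
  have hNq : N * q = L * t := by
    have e1 : (N * q) ^ 2 = (L * t) ^ 2 := by
      rw [mul_pow, mul_pow, ht, hq, Real.sq_sqrt (by positivity), Real.sq_sqrt (by positivity)]
      field_simp
    exact (pow_left_inj₀ (by positivity) (by positivity) two_ne_zero).1 e1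
  have h4 : |d| * N ≤ 7 * (N * q) + 12 * L := by
    have e1 : N * v ≤ N * q * l := by
      rw [← htq]
      nlinarith [mul_nonneg (mul_nonneg hN0.le hq0) (by linarith : 0 ≤ l - t)]
    have e2 : L * l ^ 2 ≤ (N * q + 6 * L) * l := by
      rw [hNq]
      nlinarith [mul_nonneg (mul_nonneg hL0.le hl0.le) (by linarith : 0 ≤ t + 6 - l)]
    have e3 : |d| * N * l ≤ (7 * (N * q) + 12 * L) * l := by linarith
    exact le_of_mul_le_mul_right e3 hl0
  have h5 : |d| ≤ (7 * (N * q) + 12 * L) / N := (le_div_iff₀ hN0).2 h4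
  have h6 : (7 * (N * q) + 12 * L) / N = 7 * q + 12 * (L / N) := by field_simp
  linarith

/-- The empirical mean and the empirical variance of `f` over the visits of `(x, a)` at step `h`
during the first `n` episodes satisfy Bernstein bounds with confidence parameter `ι`. The mean `m`
and the variance `v` are variables, to be matched with whatever expression an estimate has. -/
def Concentrated {S A : Type*} [Fintype S] {H : ℕ} (M : MDP S A H) (ι : ℝ)
    (s : ℕ → Fin (H + 1) → S) (π : ℕ → Policy S A H) (r : ℕ → Fin H → unitInterval)
    (n : ℕ) (h : Fin H) (x : S) (a : A) (f : unitInterval → S → ℝ) : Prop :=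
  0 < visits s π r n h x a → ∀ m v : ℝ, m = visitSum s π r n h x a f / visits s π r n h x a →
    v = visitSum s π r n h x a (fun ρ y => f ρ y ^ 2) / visits s π r n h x a - m ^ 2 →
    |m - M.outcomeMean h x a f| ≤ √(v * (ι / visits s π r n h x a)) +
      ι / visits s π r n h x a ∧
    v ≤ 2 * M.outcomeVar h x a f + ι / visits s π r n h x a

/-- The summands of the exponents to be controlled for `Concentrated`: deviations of either sign
with parameter `1 / (j + 5)`, compensated by the empirical second moment, and (`none`) the growth of
the empirical variance. -/
def devExponent (f : unitInterval → S → ℝ) (m v : ℝ) :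
    Option (ℕ × Bool) → unitInterval → S → ℝ
  | some (j, b), ρ, y =>
    (1 / ((j : ℝ) + 5)) * ((if b then 1 else -1) * (f ρ y - m)) -
      2 * (1 / ((j : ℝ) + 5)) ^ 2 * (f ρ y - m) ^ 2
  | none, ρ, y => (f ρ y - m) ^ 2 - 2 * v

/-- The exponents of `devExponent` being at most `L` gives the Bernstein bounds with `ι = 99 L`. -/
theorem concentrated_of_devExponent {S A : Type*} [Fintype S] {H K : ℕ} {M : MDP S A H} {L : ℝ}
    {s : ℕ → Fin (H + 1) → S} {π : ℕ → Policy S A H} {r : ℕ → Fin H → unitInterval}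
    {n : ℕ} (hn : n ≤ K) {h : Fin H} {x : S} {a : A} {f : unitInterval → S → ℝ}
    (hfm : ∀ y, Measurable fun ρ => f ρ y) (hf0 : ∀ ρ y, 0 ≤ f ρ y) (hf1 : ∀ ρ y, f ρ y ≤ 1)
    (hL : 1 ≤ L)
    (hsome : ∀ j ≤ K, ∀ b, visitSum s π r n h x a (devExponent f (M.outcomeMean h x a f)
      (M.outcomeVar h x a f) (some (j, b))) ≤ L)
    (hnone : visitSum s π r n h x a (devExponent f (M.outcomeMean h x a f)
      (M.outcomeVar h x a f) none) ≤ L) :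
    Concentrated M (99 * L) s π r n h x a f := by
  intro hpos m v hm hv
  have hN1 := visits_pos_one_le hpos
  have hNn : visits s π r n h x a ≤ n := visits_le
  set N := visits s π r n h x a
  set mu := M.outcomeMean h x a f
  set F1 := visitSum s π r n h x a f with hF1
  set F2 := visitSum s π r n h x a fun ρ y => f ρ y ^ 2 with hF2
  have hmu := M.outcomeMean_mem (h := h) (x := x) (a := a) hfm hf0 hf1
  have hF1m : F1 = N * m := by rw [hm]; field_simp
  have hF2v : F2 = N * (v + m ^ 2) := by rw [hv]; field_simp; ring
  have hm0 : 0 ≤ F1 := by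
    have := visitSum_mono (s := s) (π := π) (r := r) (n := n) (h := h) (x := x) (a := a) hf0
    simpa [visitSum_const] using this
  have hm1 : F1 ≤ N := by
    have := visitSum_mono (s := s) (π := π) (r := r) (n := n) (h := h) (x := x) (a := a) hf1
    simpa [visitSum_const] using this
  have hm0' : 0 ≤ m := by rw [hm]; positivity
  have hm1' : m ≤ 1 := by rw [hm]; exact (div_le_one hpos).2 hm1
  -- the decomposition of the sum of `(f - c) ^ 2` into variance and squared bias
  have hsq : ∀ c, visitSum s π r n h x a (fun ρ y => (f ρ y - c) ^ 2) =
      N * v + N * (m - c) ^ 2 := by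
    intro c
    have : (fun (ρ : unitInterval) (y : S) => (f ρ y - c) ^ 2) =
        fun ρ y => (-2 * c) * f ρ y + 1 * f ρ y ^ 2 + c ^ 2 := by funext ρ y; ring
    rw [this, visitSum_quadratic, ← hF1, ← hF2, hF1m, hF2v]; ring
  have hv0 : 0 ≤ v := by
    have h1 := hsq m
    have h2 : 0 ≤ visitSum s π r n h x a (fun ρ y => (f ρ y - m) ^ 2) := by
      have := visitSum_mono (s := s) (π := π) (r := r) (n := n) (h := h) (x := x) (a := a)
        (f := fun _ _ => 0) (g := fun ρ y => (f ρ y - m) ^ 2) fun ρ y => sq_nonneg _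
      simpa [visitSum_const] using this
    have h3 : 0 ≤ N * v := by rw [h1] at h2; simpa using h2
    exact nonneg_of_mul_nonneg_right h3 hpos
  have hv1 : v ≤ 1 := by
    have h1 : F2 ≤ F1 := visitSum_mono fun ρ y => pow_le_of_le_one (hf0 _ _) (hf1 _ _) two_ne_zero
    rw [hF1m, hF2v] at h1
    have := le_of_mul_le_mul_left h1 hpos
    nlinarith [sq_nonneg m]
  have hdev : |m - mu| ≤ 7 * √(v * L / N) + 12 * (L / N) := by
    refine abs_le_of_exp_bounds hN1 (hNn.trans (Nat.cast_le.2 hn)) hv0 hv1 ?_ hL ?_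
    · rw [abs_le]; constructor <;> linarith [hmu.1, hmu.2]
    · intro j hj
      have key : ∀ b, 1 / ((j : ℝ) + 5) * (N * ((if b = true then 1 else -1) * (m - mu))) ≤
          2 * (1 / ((j : ℝ) + 5)) ^ 2 * (N * v + N * (m - mu) ^ 2) + L := by
        intro b
        have h1 := hsome j hj b
        rw [show devExponent f mu (M.outcomeVar h x a f) (some (j, b)) = fun ρ y =>
          (1 / ((j : ℝ) + 5)) * ((if b = true then 1 else -1) * (f ρ y - mu)) -
            2 * (1 / ((j : ℝ) + 5)) ^ 2 * (f ρ y - mu) ^ 2 from rfl] at h1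
        have e : (fun (ρ : unitInterval) (y : S) =>
            (1 / ((j : ℝ) + 5)) * ((if b = true then 1 else -1) * (f ρ y - mu)) -
            2 * (1 / ((j : ℝ) + 5)) ^ 2 * (f ρ y - mu) ^ 2) = fun ρ y =>
            ((1 / ((j : ℝ) + 5)) * (if b = true then 1 else -1) +
              2 * (1 / ((j : ℝ) + 5)) ^ 2 * (2 * mu)) * f ρ y +
            (-(2 * (1 / ((j : ℝ) + 5)) ^ 2)) * f ρ y ^ 2 +
            (-((1 / ((j : ℝ) + 5)) * (if b = true then 1 else -1) * mu) -
              2 * (1 / ((j : ℝ) + 5)) ^ 2 * mu ^ 2) := by funext ρ y; ring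
        rw [e, visitSum_quadratic, ← hF1, ← hF2, hF1m, hF2v] at h1
        linarith
      rcases abs_cases (m - mu) with h1 | h1
      · rw [h1.1]; simpa using key true
      · rw [h1.1]; simpa using key false
  have hL0 : 0 < L := by linarith
  refine ⟨hdev.trans ?_, ?_⟩
  · have e1 : √(v * (99 * L / N)) = √99 * √(v * L / N) := by
      rw [← Real.sqrt_mul (by norm_num)]; congr 1; ring
    have e2 : (7 : ℝ) ≤ √99 := by rw [Real.le_sqrt' (by norm_num)]; norm_num
    have e3 : 99 * L / N = 99 * (L / N) := by ring
    rw [e1, e3]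
    have e4 : 0 ≤ L / N := by positivity
    nlinarith [mul_le_mul_of_nonneg_right e2 (Real.sqrt_nonneg (v * L / N))]
  · rw [show devExponent f mu (M.outcomeVar h x a f) none = fun ρ y =>
      (f ρ y - mu) ^ 2 - 2 * M.outcomeVar h x a f from rfl] at hnone
    have e : (fun (ρ : unitInterval) (y : S) => (f ρ y - mu) ^ 2 - 2 * M.outcomeVar h x a f) =
        fun ρ y => (f ρ y - mu) ^ 2 + (-(2 * M.outcomeVar h x a f)) := by funext ρ y; ring
    rw [e, visitSum_add, hsq, visitSum_const] at hnone
    have h1 : N * v ≤ N * (2 * M.outcomeVar h x a f + 99 * L / N) := by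
      rw [mul_add, mul_div_cancel₀ _ hpos.ne']
      nlinarith [mul_nonneg hpos.le (sq_nonneg (m - mu))]
    exact le_of_mul_le_mul_left h1 hpos

namespace IsInteraction

variable {S A : Type*} [Fintype S] [MeasurableSpace S] [DiscreteMeasurableSpace S]
  [Fintype A] [MeasurableSpace A] [DiscreteMeasurableSpace A] {H K : ℕ} {M : MDP S A H}
  {Ω : Type*} {mΩ : MeasurableSpace Ω} {μ : Measure Ω} [IsProbabilityMeasure μ]
  {𝓕 : Filtration ℕ mΩ} {s : ℕ → Fin (H + 1) → Ω → S} {π : ℕ → Ω → Policy S A H}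
  {r : ℕ → Fin H → Ω → unitInterval}

theorem measure_devExponent_le (hI : IsInteraction M K μ 𝓕 s π r) {n : ℕ} (hn : n ≤ K)
    (h : Fin H) (x : S) (a : A) {f : unitInterval → S → ℝ}
    (hfm : ∀ y, Measurable fun ρ => f ρ y) (hf0 : ∀ ρ y, 0 ≤ f ρ y) (hf1 : ∀ ρ y, f ρ y ≤ 1)
    (o : Option (ℕ × Bool)) (L : ℝ) :
    μ {ω | L < visitSum (fun k h => s k h ω) (fun k => π k ω) (fun k h => r k h ω) n h x a
      (devExponent f (M.outcomeMean h x a f) (M.outcomeVar h x a f) o)} ≤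
      ENNReal.ofReal (Real.exp (-L)) := by
  classical
  have hmu := M.outcomeMean_mem (h := h) (x := x) (a := a) hfm hf0 hf1
  have hquad : ∀ α β γ : ℝ, ∀ y, Integrable (fun ρ => α * f ρ y + β * f ρ y ^ 2 + γ)
      (M.R h x a : Measure unitInterval) := fun α β γ y =>
    (((MDP.integrable_of_mem_unit (hfm y) (fun ρ => hf0 ρ y) (fun ρ => hf1 ρ y) _).const_mul α).add
      ((MDP.integrable_of_mem_unit ((hfm y).pow_const 2) (fun ρ => sq_nonneg _)
      (fun ρ => pow_le_one₀ (hf0 ρ y) (hf1 ρ y)) _).const_mul β)).add (integrable_const γ)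
  set mu := M.outcomeMean h x a f with hmudef
  set v := M.outcomeVar h x a f with hvdef
  have hdev : ∀ ρ y, |f ρ y - mu| ≤ 1 := fun ρ y => by
    rw [abs_le]; constructor <;> linarith [hf0 ρ y, hf1 ρ y, hmu.1, hmu.2]
  have hum : ∀ y, Measurable fun ρ => devExponent f mu v o ρ y := by
    intro y
    have := hfm y
    rcases o with _ | ⟨j, b⟩ <;> simp only [devExponent] <;> fun_prop
  suffices hq : ∃ q : unitInterval → S → ℝ,
      (∀ ρ y, Real.exp (devExponent f mu v o ρ y) ≤ q ρ y) ∧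
      (∀ y, Integrable (fun ρ => q ρ y) (M.R h x a : Measure unitInterval)) ∧
      M.outcomeMean h x a q ≤ 1 by
    obtain ⟨q, hq1, hq2, hq3⟩ := hq
    refine le_trans (le_of_eq ?_) ((hI.mono hn).measure_visit_sum_le h x a hum hq1 hq2 hq3 L)
    congr! 5
  rcases o with _ | ⟨j, b⟩
  -- the comparison function is `(1 + 2 (f - mu) ^ 2) exp (-2 v)`
  · refine ⟨fun ρ y => (-4 * mu * Real.exp (-(2 * v))) * f ρ y +
      (2 * Real.exp (-(2 * v))) * f ρ y ^ 2 +
      (Real.exp (-(2 * v)) * (1 + 2 * mu ^ 2)), fun ρ y => ?_, hquad _ _ _, ?_⟩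
    · have h1 := exp_le_one_add_two_mul (sq_nonneg (f ρ y - mu))
        ((sq_le_one_iff_abs_le_one _).2 (hdev ρ y))
      simp only [devExponent, sub_eq_add_neg _ (2 * v), Real.exp_add]
      refine (mul_le_mul_of_nonneg_right h1 (Real.exp_pos _).le).trans (le_of_eq ?_)
      ring
    · rw [M.outcomeMean_quadratic hfm hf0 hf1, ← hmudef]
      have h1 : M.outcomeMean h x a (fun ρ y => f ρ y ^ 2) = v + mu ^ 2 := by
        rw [hvdef, MDP.outcomeVar]; ring
      have h2 := Real.add_one_le_exp (2 * v)
      have h3 : (1 + 2 * v) * Real.exp (-(2 * v)) ≤ 1 := by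
        rw [Real.exp_neg, ← div_eq_mul_inv, div_le_one (Real.exp_pos _)]; linarith
      rw [h1]
      refine le_trans (le_of_eq ?_) h3
      ring
  · set l := 1 / ((j : ℝ) + 5) with hl
    have hl0 : 0 ≤ l := by positivity
    have hl1 : l ≤ 1 / 5 := by
      rw [hl]; gcongr; linarith [Nat.cast_nonneg (α := ℝ) j]
    set e : ℝ := if b = true then 1 else -1 with he
    have he1 : |e| = 1 := by rw [he]; split_ifs <;> simp
    refine ⟨fun ρ y => (l * e) * f ρ y + 0 * f ρ y ^ 2 + (1 - l * e * mu), fun ρ y => ?_,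
      hquad _ _ _, ?_⟩
    · have h1 : |l * (e * (f ρ y - mu))| ≤ 1 / 5 := by
        rw [abs_mul, abs_mul, he1, abs_of_nonneg hl0, one_mul]
        nlinarith [hdev ρ y, abs_nonneg (f ρ y - mu)]
      have h2 := exp_sub_two_mul_sq_le h1
      have h3 : e ^ 2 = 1 := by rw [← sq_abs, he1, one_pow]
      have h4 : devExponent f mu v (some (j, b)) ρ y =
          l * (e * (f ρ y - mu)) - 2 * (l * (e * (f ρ y - mu))) ^ 2 := by
        simp only [devExponent, mul_pow, h3]; ring
      rw [h4]
      refine h2.trans (le_of_eq ?_)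
      ring
    · rw [M.outcomeMean_quadratic hfm hf0 hf1, ← hmudef]
      refine le_of_eq ?_
      ring

/-- Bernstein bounds fail with probability at most `(2 K + 3) e ^ (-L)`. -/
theorem measure_not_concentrated_le (hI : IsInteraction M K μ 𝓕 s π r) {n : ℕ} (hn : n ≤ K)
    (h : Fin H) (x : S) (a : A) {f : unitInterval → S → ℝ}
    (hfm : ∀ y, Measurable fun ρ => f ρ y) (hf0 : ∀ ρ y, 0 ≤ f ρ y) (hf1 : ∀ ρ y, f ρ y ≤ 1)
    {L : ℝ} (hL : 1 ≤ L) :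
    μ {ω | ¬ Concentrated M (99 * L) (fun k h => s k h ω) (fun k => π k ω)
      (fun k h => r k h ω) n h x a f} ≤ (2 * K + 3 : ℕ) * ENNReal.ofReal (Real.exp (-L)) := by
  set B : Option (ℕ × Bool) → Set Ω := fun o => {ω | L < visitSum (fun k h => s k h ω)
    (fun k => π k ω) (fun k h => r k h ω) n h x a
      (devExponent f (M.outcomeMean h x a f) (M.outcomeVar h x a f) o)} with hB
  set J : Finset (Option (ℕ × Bool)) :=
    Finset.insertNone (Finset.range (K + 1) ×ˢ Finset.univ) with hJ
  have h1 : {ω | ¬ Concentrated M (99 * L) (fun k h => s k h ω) (fun k => π k ω)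
      (fun k h => r k h ω) n h x a f} ⊆ ⋃ o ∈ J, B o := by
    intro ω hω
    by_contra hno
    simp only [Set.mem_iUnion, not_exists] at hno
    refine hω (concentrated_of_devExponent hn hfm hf0 hf1 hL (fun j hj b => ?_) ?_)
    · exact not_lt.1 (hno (some (j, b)) (by simp [hJ]; omega))
    · exact not_lt.1 (hno none (by simp [hJ]))
  have hcard : J.card = 2 * K + 3 := by
    rw [hJ, Finset.card_insertNone, Finset.card_product]; simp; ring
  refine (measure_mono h1).trans ((measure_biUnion_finset_le _ _).trans ?_)
  refine (Finset.sum_le_card_nsmul _ _ _ fun o _ =>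
    hI.measure_devExponent_le hn h x a hfm hf0 hf1 o L).trans ?_
  rw [hcard, nsmul_eq_mul]

/-- Almost surely no transition of probability zero is observed. -/
theorem ae_pos_of_visit (hI : IsInteraction M K μ 𝓕 s π r) :
    ∀ᵐ ω ∂μ, ∀ k < K, ∀ h : Fin H,
      0 < M.P h (s k h.castSucc ω) (π k ω h (s k h.castSucc ω)) (s k h.succ ω) := by
  have h1 : ∀ k < K, ∀ (h : Fin H) (x : S) (a : A) (y : S), M.P h x a y = 0 →
      ∀ᵐ ω ∂μ, ¬ ((s k h.castSucc ω = x ∧ π k ω h (s k h.castSucc ω) = a) ∧ s k h.succ ω = y) := by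
    intro k hk h x a y hP
    have := hI.measure_visit hk h x a y (C := Set.univ) (B := Set.univ)
      MeasurableSet.univ MeasurableSet.univ
    rw [hP] at this
    rw [ae_iff]
    simp only [not_not]
    refine le_antisymm ((measure_mono fun ω hω => ?_).trans_eq (this.trans (by simp))) zero_le
    exact ⟨⟨trivial, trivial⟩, hω.1, hω.2⟩
  have h2 : ∀ᵐ ω ∂μ, ∀ k < K, ∀ (h : Fin H) (x : S) (a : A) (y : S), M.P h x a y = 0 →
      ¬ ((s k h.castSucc ω = x ∧ π k ω h (s k h.castSucc ω) = a) ∧ s k h.succ ω = y) := by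
    simp only [ae_all_iff]
    exact h1
  filter_upwards [h2] with ω hω k hk h
  refine lt_of_le_of_ne (M.P_nonneg _ _ _ _) fun h0 => ?_
  exact hω k hk h _ _ _ h0.symm ⟨⟨rfl, rfl⟩, rfl⟩

end IsInteraction

/-! ### The memory of the algorithm -/

/-- The part of the memory of the algorithm that concerns one state-action pair. -/
structure Cell (X : Type*) where
  N : ℕ
  n : ℕ
  θ : ℝ
  φ : ℝ
  NT : X → ℕ
  rHat : ℝ
  varR : ℝ
  pHat : X → ℝ

open Classical in
/-- The update of the cell of a pair when that pair is observed. -/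
def Cell.step {X : Type*} (K H : ℕ) (c : Cell X) (r : ℝ) (x' : X) : Cell X where
  N := c.N + 1
  n := if c.N + 1 ∈ MVPState.triggerSet K H then c.N + 1 else c.n
  θ := c.θ + r
  φ := c.φ + r ^ 2
  NT z := c.NT z + if z = x' then 1 else 0
  rHat := if c.N + 1 ∈ MVPState.triggerSet K H then (c.θ + r) / (c.N + 1 : ℕ) else c.rHat
  varR := if c.N + 1 ∈ MVPState.triggerSet K H then
    (c.φ + r ^ 2) / (c.N + 1 : ℕ) - ((c.θ + r) / (c.N + 1 : ℕ)) ^ 2 else c.varR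
  pHat z := if c.N + 1 ∈ MVPState.triggerSet K H then
    ((c.NT z + if z = x' then 1 else 0 : ℕ) : ℝ) / (c.N + 1 : ℕ) else c.pHat z

namespace MVPState

variable {X A : Type*} {H : ℕ}

/-- The cell of the pair `(x, a)`. -/
def cell (σ : MVPState X A H) (x : X) (a : A) : Cell X where
  N := σ.N x a
  n := σ.n x a
  θ := σ.θ x a
  φ := σ.φ x a
  NT := σ.NT x a
  rHat := σ.rHat x a
  varR := σ.varR x a
  pHat := σ.pHat x a

theorem cell_observe_of_ne (K : ℕ) (σ : MVPState X A H) (x : X) (a : A) (r : ℝ) (x' y : X) (b : A)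
    (hne : ¬ (y = x ∧ b = a)) : (σ.observe K x a r x').cell y b = σ.cell y b := by
  classical
  have h3 : ∀ z, ¬ (y = x ∧ b = a ∧ z = x') := fun z hz => hne ⟨hz.1, hz.2.1⟩
  unfold observe
  split_ifs <;> simp only [cell, refresh, count, if_neg hne, if_neg (h3 _), add_zero]

theorem cell_observe_self (K : ℕ) (σ : MVPState X A H) (x : X) (a : A) (r : ℝ) (x' : X) :
    (σ.observe K x a r x').cell x a = (σ.cell x a).step K H r x' := by
  classical
  have hN : (σ.count x a r x').N x a = σ.N x a + 1 := by simp [count]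
  unfold observe
  split_ifs with h1
  · rw [hN] at h1
    simp [cell, refresh, count, Cell.step, h1]
  · rw [hN] at h1
    simp [cell, count, Cell.step, h1]

theorem backup_congr [Fintype X] {σ σ' : MVPState X A H} (hn : σ.n = σ'.n)
    (hr : σ.rHat = σ'.rHat) (hv : σ.varR = σ'.varR) (hp : σ.pHat = σ'.pHat) (ι : ℝ) :
    σ.backup ι = σ'.backup ι := by
  funext W x a
  simp only [backup, bonus, hn, hr, hv, hp]

theorem planV_congr [Fintype X] {σ σ' : MVPState X A H} (hn : σ.n = σ'.n)
    (hr : σ.rHat = σ'.rHat) (hv : σ.varR = σ'.varR) (hp : σ.pHat = σ'.pHat) (ι : ℝ) (j : ℕ) :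
    σ.planV ι j = σ'.planV ι j := by
  induction j with
  | zero => rfl
  | succ j ih => funext x; simp only [planV, ih, backup_congr hn hr hv hp]

/-- The table `Q` is the one planned from the current estimates. This holds at the beginning of each
episode, whether or not a recomputation took place. -/
def Planned [Fintype X] (ι : ℝ) (σ : MVPState X A H) : Prop :=
  ∀ (h : Fin H) x a, σ.Q h x a = σ.backup ι (σ.planV ι (H - 1 - h)) x a

theorem planned_observe [Fintype X] {ι : ℝ} {K : ℕ} {σ : MVPState X A H}
    (hσ : σ.triggered = true ∨ σ.Planned ι) (x : X) (a : A) (r : ℝ) (x' : X) :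
    (σ.observe K x a r x').triggered = true ∨ (σ.observe K x a r x').Planned ι := by
  classical
  unfold observe
  split_ifs
  · exact Or.inl rfl
  · refine hσ.imp id fun h h' y b => ?_
    have e1 := backup_congr (σ := σ.count x a r x') (σ' := σ) rfl rfl rfl rfl ι
    have e2 := planV_congr (σ := σ.count x a r x') (σ' := σ) rfl rfl rfl rfl ι
    rw [e1, e2]
    exact h h' y b

theorem planned_replan [Fintype X] {ι : ℝ} {σ : MVPState X A H}
    (hσ : σ.triggered = true ∨ σ.Planned ι) : (σ.replan ι).Planned ι := by
  classical
  unfold replan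
  split_ifs with h
  · have key : ∀ σ' : MVPState X A H, σ.n = σ'.n → σ.rHat = σ'.rHat → σ.varR = σ'.varR →
        σ.pHat = σ'.pHat → (σ'.Q = fun (h : Fin H) x a => σ.backup ι (σ.planV ι (H - 1 - h)) x a) →
        σ'.Planned ι := by
      intro σ' hn hr hv hp hQ h' y b
      rw [hQ]
      dsimp only
      rw [backup_congr hn hr hv hp, planV_congr hn hr hv hp]
    exact key _ rfl rfl rfl rfl rfl
  · exact hσ.resolve_left h

/-- Without data the bonus is at least `21 ι`, so that the initial table, constantly `1`, is the
planned one. -/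
theorem planned_init [Fintype X] {ι : ℝ} (hι : 1 ≤ ι) : (init X A H).Planned ι := by
  intro h x a
  have : (1 : ℝ) ≤ 21 * ι := by linarith
  simp [backup, bonus, init, wvar, this]

theorem cell_replan [Fintype X] (ι : ℝ) (σ : MVPState X A H) (x : X) (a : A) :
    (σ.replan ι).cell x a = σ.cell x a := by
  classical
  unfold replan
  split_ifs <;> rfl

end MVPState

section Run

variable {S A : Type*} [Fintype S] {H : ℕ}

theorem planned_memory {ι : ℝ} (hι : 1 ≤ ι) (K : ℕ) (s : ℕ → Fin (H + 1) → S)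
    (a : ℕ → Fin H → A) (r : ℕ → Fin H → unitInterval) (k : ℕ) :
    (memory K ι s a r k).Planned ι := by
  induction k with
  | zero => exact MVPState.planned_init hι
  | succ k ih =>
    refine MVPState.planned_replan ?_
    have : ∀ (l : List (Fin H)) (σ : MVPState (Fin H × S) A H),
        (σ.triggered = true ∨ σ.Planned ι) →
        (l.foldl (fun σ h => σ.observe K (h, s k h.castSucc) (a k h) ((r k h : ℝ) / H)
          (finRotate H h, s k h.succ)) σ).triggered = true ∨
        (l.foldl (fun σ h => σ.observe K (h, s k h.castSucc) (a k h) ((r k h : ℝ) / H)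
          (finRotate H h, s k h.succ)) σ).Planned ι := by
      intro l
      induction l with
      | nil => exact fun σ hσ => hσ
      | cons h l ihl => exact fun σ hσ => ihl _ (MVPState.planned_observe hσ _ _ _ _)
    exact this _ _ (Or.inr ih)

/-- The indicator that the next state is `z`. -/
def nextInd (z : S) : unitInterval → S → ℝ := fun _ y => ({z} : Set S).indicator 1 y

open Classical in
/-- The cells of layer `h` change in an episode only at step `h`. -/
theorem cell_memory_succ (ι : ℝ) (K : ℕ) (s : ℕ → Fin (H + 1) → S)
    (a : ℕ → Fin H → A) (r : ℕ → Fin H → unitInterval) (k : ℕ) (h : Fin H) (x : S) (b : A) :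
    (memory K ι s a r (k + 1)).cell (h, x) b =
      if s k h.castSucc = x ∧ a k h = b then
        ((memory K ι s a r k).cell (h, x) b).step K H ((r k h : ℝ) / H) (finRotate H h, s k h.succ)
      else (memory K ι s a r k).cell (h, x) b := by
  have key : ∀ (l : List (Fin H)), l.Nodup → ∀ (σ : MVPState (Fin H × S) A H),
      (l.foldl (fun σ h => σ.observe K (h, s k h.castSucc) (a k h) ((r k h : ℝ) / H)
          (finRotate H h, s k h.succ)) σ).cell (h, x) b =
      if h ∈ l ∧ s k h.castSucc = x ∧ a k h = b then
        (σ.cell (h, x) b).step K H ((r k h : ℝ) / H) (finRotate H h, s k h.succ)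
      else σ.cell (h, x) b := by
    intro l
    induction l with
    | nil => intro _ σ; simp
    | cons h' l ihl =>
      intro hl σ
      rw [List.nodup_cons] at hl
      rw [List.foldl_cons, ihl hl.2]
      by_cases hh : h = h'
      · subst hh
        rw [if_neg (fun h1 => hl.1 h1.1)]
        by_cases hv : s k h.castSucc = x ∧ a k h = b
        · obtain ⟨rfl, rfl⟩ := hv
          rw [if_pos (by simp), MVPState.cell_observe_self]
        · rw [if_neg (fun h1 => hv h1.2), MVPState.cell_observe_of_ne]
          rintro ⟨h1, h2⟩
          exact hv ⟨(Prod.mk.inj h1).2.symm, h2.symm⟩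
      · have e : (σ.observe K (h', s k h'.castSucc) (a k h') ((r k h' : ℝ) / H)
            (finRotate H h', s k h'.succ)).cell (h, x) b = σ.cell (h, x) b :=
          MVPState.cell_observe_of_ne _ _ _ _ _ _ _ _ fun h1 => hh (Prod.mk.inj h1.1).1
        rw [e]
        simp [hh]
  change (MVPState.replan ι _).cell (h, x) b = _
  rw [MVPState.cell_replan, key _ (List.nodup_finRange H)]
  simp

/-- What the algorithm knows about `(h, x, b)` before episode `k`: the counters are sums over all
visits, and the estimates are the empirical means over the visits before some earlier episode. Only
transitions into the layer `finRotate H h` occur. -/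
structure CellInv (K : ℕ) (s : ℕ → Fin (H + 1) → S) (π : ℕ → Policy S A H)
    (r : ℕ → Fin H → unitInterval) (k : ℕ) (h : Fin H) (x : S) (b : A) (c : Cell (Fin H × S)) :
    Prop where
  N_eq : (c.N : ℝ) = visits s π r k h x b
  θ_eq : c.θ = visitSum s π r k h x b fun ρ _ => (ρ : ℝ) / H
  φ_eq : c.φ = visitSum s π r k h x b fun ρ _ => ((ρ : ℝ) / H) ^ 2
  NT_eq : ∀ z, (c.NT (finRotate H h, z) : ℝ) = visitSum s π r k h x b (nextInd z)
  NT_ne : ∀ q, q.1 ≠ finRotate H h → c.NT q = 0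
  trigger : ∀ i, 2 ^ (i + 1) ≤ K * H → 2 ^ i ≤ c.N → 2 ^ i ≤ c.n
  pHat_ne : ∀ q, q.1 ≠ finRotate H h → c.pHat q = 0
  est : (c.n = 0 ∧ c.rHat = 0 ∧ ∀ q, c.pHat q = 0) ∨ ∃ k' ≤ k, 0 < c.n ∧
    (c.n : ℝ) = visits s π r k' h x b ∧
    c.rHat = (visitSum s π r k' h x b fun ρ _ => (ρ : ℝ) / H) / c.n ∧
    c.varR = (visitSum s π r k' h x b fun ρ _ => ((ρ : ℝ) / H) ^ 2) / c.n - c.rHat ^ 2 ∧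
    ∀ z, c.pHat (finRotate H h, z) =
      (visitSum s π r k' h x b (nextInd z)) / c.n

theorem cellInv_memory (ι : ℝ) (K : ℕ) (s : ℕ → Fin (H + 1) → S) (π : ℕ → Policy S A H)
    (r : ℕ → Fin H → unitInterval) (k : ℕ) (h : Fin H) (x : S) (b : A) :
    CellInv K s π r k h x b ((memory K ι s (actions s π) r k).cell (h, x) b) := by
  classical
  induction k with
  | zero =>
    constructor <;> simp [memory, MVPState.cell, MVPState.init, visits, visitSum]
  | succ k ih =>
    rw [cell_memory_succ]
    have hsum : ∀ f, visitSum s π r (k + 1) h x b f = visitSum s π r k h x b f +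
        if s k h.castSucc = x ∧ actions s π k h = b then f (r k h) (s k h.succ) else 0 := by
      intro f; rw [visitSum, Finset.sum_range_succ, visitSum, actions]
    generalize (memory K ι s (actions s π) r k).cell (h, x) b = c at ih
    by_cases hv : s k h.castSucc = x ∧ actions s π k h = b
    · simp only [if_pos hv] at hsum ⊢
      have hN : ((c.N + 1 : ℕ) : ℝ) = visits s π r (k + 1) h x b := by
        rw [visits, hsum, ← visits, ← ih.N_eq]; push_cast; ring
      have hNT : ∀ z, ((c.step K H ((r k h : ℝ) / H) (finRotate H h, s k h.succ)).NT
          (finRotate H h, z) : ℝ) = visitSum s π r (k + 1) h x b (nextInd z) := by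
        intro z
        rw [hsum, ← ih.NT_eq]
        simp only [Cell.step]
        by_cases hz : z = s k h.succ
        · rw [if_pos (by rw [hz])]
          simp [nextInd, hz]
        · rw [if_neg fun h1 => hz (Prod.mk.inj h1).2]
          simp [nextInd, Ne.symm hz]
      constructor
      · exact hN
      · rw [hsum, ← ih.θ_eq]; rfl
      · rw [hsum, ← ih.φ_eq]; rfl
      · exact hNT
      · intro q hq
        simp only [Cell.step, ih.NT_ne q hq, zero_add, ite_eq_right_iff]
        rintro rfl; exact absurd rfl hq
      · intro i hi hiN
        simp only [Cell.step] at hiN ⊢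
        split_ifs with ht
        · exact hiN
        · refine ih.trigger i hi ?_
          rcases hiN.lt_or_eq with h1 | h1
          · omega
          · exact absurd ⟨i + 1, by omega, hi, by simpa using h1.symm⟩ ht
      · intro q hq
        simp only [Cell.step]
        split_ifs with ht h1
        · subst h1; exact absurd rfl hq
        · simp [ih.NT_ne q hq]
        · exact ih.pHat_ne q hq
      · by_cases ht : c.N + 1 ∈ MVPState.triggerSet K H
        · refine Or.inr ⟨k + 1, le_rfl, ?_⟩
          simp only [Cell.step, if_pos ht]
          refine ⟨Nat.succ_pos _, hN, ?_, ?_, fun z => ?_⟩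
          · rw [hsum, ← ih.θ_eq]
          · rw [hsum, ← ih.φ_eq]
          · rw [← hNT]; rfl
        · simp only [Cell.step, if_neg ht]
          refine ih.est.imp id ?_
          rintro ⟨k', hk', h1⟩
          exact ⟨k', Nat.le_succ_of_le hk', h1⟩
    · simp only [if_neg hv, add_zero] at hsum ⊢
      refine ⟨by rw [visits, hsum, ← visits, ih.N_eq], by rw [hsum, ih.θ_eq],
        by rw [hsum, ih.φ_eq], fun z => by rw [hsum, ih.NT_eq], ih.NT_ne, ih.trigger,
        ih.pHat_ne, ih.est.imp id ?_⟩
      rintro ⟨k', hk', h1⟩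
      exact ⟨k', Nat.le_succ_of_le hk', h1⟩

/-- The estimates of a pair are based on at least a quarter of its visits. Doubling alone would give
one half; the last power of two up to `K H` does not trigger, which costs another factor of two. -/
theorem CellInv.visits_le_four_mul {K : ℕ} {s : ℕ → Fin (H + 1) → S} {π : ℕ → Policy S A H}
    {r : ℕ → Fin H → unitInterval} {k : ℕ} {h : Fin H} {x : S} {b : A} {c : Cell (Fin H × S)}
    (hc : CellInv K s π r k h x b c) (hk : k < K) :
    visits s π r k h x b ≤ 4 * c.n := by
  have hNk : c.N ≤ k := by
    have := visits_le (s := s) (π := π) (r := r) (n := k) (h := h) (x := x) (a := b)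
    rw [← hc.N_eq] at this
    exact_mod_cast this
  rw [← hc.N_eq]
  have hH : 0 < H := h.pos
  suffices c.N ≤ 4 * c.n by exact_mod_cast this
  rcases Nat.eq_zero_or_pos c.N with h0 | h0
  · omega
  set i := Nat.log 2 c.N with hi
  have h1 : 2 ^ i ≤ c.N := Nat.pow_log_le_self 2 h0.ne'
  have h2 : c.N < 2 ^ (i + 1) := Nat.lt_pow_succ_log_self (by norm_num) _
  have hKH : K ≤ K * H := Nat.le_mul_of_pos_right _ hH
  by_cases h3 : 2 ^ (i + 1) ≤ K * H
  · have := hc.trigger i h3 h1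
    rw [pow_succ] at h2
    omega
  · rcases Nat.eq_zero_or_pos i with h4 | h4
    · rw [h4] at h3; norm_num at h3; omega
    · obtain ⟨j, hj⟩ := Nat.exists_eq_succ_of_ne_zero h4.ne'
      rw [hj] at h1 h2
      have h5 : 2 ^ j ≤ c.N := le_trans (Nat.pow_le_pow_right (by norm_num) (Nat.le_succ j)) h1
      have := hc.trigger j (by rw [Nat.succ_eq_add_one] at h1; omega) h5
      rw [Nat.succ_eq_add_one, pow_succ, pow_succ] at h2
      omega

end Run

section

/-! ### The optimistic value functions -/

variable {S A : Type*} [Fintype S] {H : ℕ}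

/-- The value function planned from the memory `σ`, on the original state space. -/
def optV (ι : ℝ) (σ : MVPState (Fin H × S) A H) (h : Fin (H + 1)) (x : S) : ℝ :=
  Fin.lastCases (motive := fun _ => ℝ) 0 (fun h => σ.planV ι (H - h) (h, x)) h

/-- The estimated transition probabilities at step `h`, on the original state space. -/
def estP (σ : MVPState (Fin H × S) A H) (h : Fin H) (x : S) (a : A) (y : S) : ℝ :=
  σ.pHat (h, x) a (finRotate H h, y)

/-- The bonus at step `h`, in terms of the original state space. -/
def optBonus (ι : ℝ) (σ : MVPState (Fin H × S) A H) (h : Fin H) (x : S) (a : A) : ℝ :=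
  4 * √(wvar (estP σ h x a) (optV ι σ h.succ) * ι / (max (σ.n (h, x) a) 1 : ℕ)) +
    2 * √(σ.varR (h, x) a * ι / (max (σ.n (h, x) a) 1 : ℕ)) +
    21 * ι / (max (σ.n (h, x) a) 1 : ℕ)

/-- The untruncated optimistic backup at step `h`. -/
def optQ (ι : ℝ) (σ : MVPState (Fin H × S) A H) (h : Fin H) (x : S) (a : A) : ℝ :=
  σ.rHat (h, x) a + ∑ y, estP σ h x a y * optV ι σ h.succ y + optBonus ι σ h x a

theorem optV_last (ι : ℝ) (σ : MVPState (Fin H × S) A H) (x : S) :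
    optV ι σ (Fin.last H) x = 0 := by simp [optV]

theorem optV_castSucc (ι : ℝ) (σ : MVPState (Fin H × S) A H) (h : Fin H) (x : S) :
    optV ι σ h.castSucc x = σ.planV ι (H - h) (h, x) := by simp [optV]

/-- The planned value of the next state in its layer `finRotate H h`. After the last step that layer
is the first one, but no steps are left to go and the value is `0`. -/
theorem planV_finRotate (ι : ℝ) (σ : MVPState (Fin H × S) A H) (h : Fin H) (y : S) :
    σ.planV ι (H - 1 - h) (finRotate H h, y) = optV ι σ h.succ y := by
  obtain ⟨H, rfl⟩ : ∃ n, H = n + 1 := Nat.exists_eq_succ_of_ne_zero h.pos.ne'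
  induction h using Fin.lastCases with
  | last => rw [Fin.succ_last, optV_last]; simp [MVPState.planV]
  | cast h =>
    have h1 : finRotate (H + 1) h.castSucc = h.succ := by
      rw [finRotate_apply]; simp
    have h2 : H + 1 - 1 - (h.castSucc : ℕ) = H + 1 - (h.succ : ℕ) := by
      rw [Fin.val_castSucc, Fin.val_succ]; omega
    rw [h1, Fin.succ_castSucc, optV_castSucc, h2]

theorem sum_pHat_mul {σ : MVPState (Fin H × S) A H} {h : Fin H} {x : S} {a : A}
    (h0 : ∀ q : Fin H × S, q.1 ≠ finRotate H h → σ.pHat (h, x) a q = 0) (f : Fin H × S → ℝ) :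
    ∑ q, σ.pHat (h, x) a q * f q = ∑ y, estP σ h x a y * f (finRotate H h, y) := by
  rw [Fintype.sum_prod_type, Finset.sum_eq_single (finRotate H h)]
  · rfl
  · intro g _ hg
    exact Finset.sum_eq_zero fun y _ => by rw [h0 (g, y) hg, zero_mul]
  · simp

/-- The backup on the layered space is that of the original space. -/
theorem backup_eq {ι : ℝ} {σ : MVPState (Fin H × S) A H} {h : Fin H} {x : S} {a : A}
    (h0 : ∀ q : Fin H × S, q.1 ≠ finRotate H h → σ.pHat (h, x) a q = 0) :
    σ.backup ι (σ.planV ι (H - 1 - h)) (h, x) a = min 1 (optQ ι σ h x a) := by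
  have e1 : ∑ q, σ.pHat (h, x) a q * σ.planV ι (H - 1 - h) q =
      ∑ y, estP σ h x a y * optV ι σ h.succ y := by
    rw [sum_pHat_mul h0]; simp only [planV_finRotate]
  have e2 : wvar (σ.pHat (h, x) a) (σ.planV ι (H - 1 - h)) =
      wvar (estP σ h x a) (optV ι σ h.succ) := by
    rw [wvar, e1, sum_pHat_mul h0 fun q => (σ.planV ι (H - 1 - h) q - _) ^ 2]
    simp only [planV_finRotate]; rfl
  rw [MVPState.backup, MVPState.bonus, e1, e2, optQ, optBonus]

section Greedy

variable [Finite A] {K : ℕ} {ι : ℝ} {s : ℕ → Fin (H + 1) → S} {π : ℕ → Policy S A H}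
  {r : ℕ → Fin H → unitInterval}

theorem optQ_le_optV (k : ℕ) (h : Fin H) (x : S) (a : A) :
    min 1 (optQ ι (memory K ι s (actions s π) r k) h x a) ≤
      optV ι (memory K ι s (actions s π) r k) h.castSucc x := by
  rw [optV_castSucc, ← backup_eq (cellInv_memory ι K s π r k h x a).pHat_ne]
  obtain ⟨j, hj⟩ : ∃ j, H - h = j + 1 := ⟨H - h - 1, by omega⟩
  rw [hj, MVPState.planV, show H - 1 - h = j by omega]
  exact le_ciSup (f := fun a => (memory K ι s (actions s π) r k).backup ι
    ((memory K ι s (actions s π) r k).planV ι j) (h, x) a) (Set.finite_range _).bddAbove a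

/-- The planned value is the backup at the greedy action. -/
theorem optV_eq_optQ (hι : 1 ≤ ι) (hF : FollowsMVPV K ι s π r) {k : ℕ} (hk : k < K)
    (h : Fin H) (x : S) :
    optV ι (memory K ι s (actions s π) r k) h.castSucc x =
      min 1 (optQ ι (memory K ι s (actions s π) r k) h x (π k h x)) := by
  refine le_antisymm ?_ (optQ_le_optV k h x _)
  rw [optV_castSucc, ← backup_eq (cellInv_memory ι K s π r k h x _).pHat_ne]
  have hP := planned_memory hι K s (actions s π) r k
  obtain ⟨j, hj⟩ : ∃ j, H - h = j + 1 := ⟨H - h - 1, by omega⟩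
  rw [hj, MVPState.planV, show H - 1 - h = j by omega]
  have : Nonempty A := ⟨π k h x⟩
  refine ciSup_le fun b => ?_
  have := hF k hk h x b
  rw [hP, hP, show H - 1 - h = j by omega] at this
  exact this

end Greedy

/-! ### Measurability of the memory -/

/-- Measurability of all fields of a random cell; the table `Q` is left out, since it is a function of
the cells. -/
structure CellMeasurable {Ω X : Type*} (m : MeasurableSpace Ω) (c : Ω → Cell X) : Prop where
  N : Measurable[m] fun ω => (c ω).N
  n : Measurable[m] fun ω => (c ω).n
  θ : Measurable[m] fun ω => (c ω).θ
  φ : Measurable[m] fun ω => (c ω).φ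
  NT : ∀ z, Measurable[m] fun ω => (c ω).NT z
  rHat : Measurable[m] fun ω => (c ω).rHat
  varR : Measurable[m] fun ω => (c ω).varR
  pHat : ∀ z, Measurable[m] fun ω => (c ω).pHat z

namespace CellMeasurable

variable {Ω X : Type*} {m : MeasurableSpace Ω} {c c' : Ω → Cell X}

theorem mono {m' : MeasurableSpace Ω} (hc : CellMeasurable m c) (hm : m ≤ m') :
    CellMeasurable m' c :=
  ⟨hc.N.mono hm le_rfl, hc.n.mono hm le_rfl, hc.θ.mono hm le_rfl, hc.φ.mono hm le_rfl,
    fun z => (hc.NT z).mono hm le_rfl, hc.rHat.mono hm le_rfl, hc.varR.mono hm le_rfl,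
    fun z => (hc.pHat z).mono hm le_rfl⟩

theorem ite {p : Ω → Prop} {_ : DecidablePred p} (hp : MeasurableSet {ω | p ω})
    (hc : CellMeasurable m c) (hc' : CellMeasurable m c') :
    CellMeasurable m fun ω => if p ω then c ω else c' ω := by
  refine ⟨?_, ?_, ?_, ?_, fun z => ?_, ?_, ?_, fun z => ?_⟩
  · simp only [apply_ite Cell.N]; exact Measurable.ite hp hc.N hc'.N
  · simp only [apply_ite Cell.n]; exact Measurable.ite hp hc.n hc'.n
  · simp only [apply_ite Cell.θ]; exact Measurable.ite hp hc.θ hc'.θ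
  · simp only [apply_ite Cell.φ]; exact Measurable.ite hp hc.φ hc'.φ
  · simp only [apply_ite Cell.NT, ite_apply]; exact Measurable.ite hp (hc.NT z) (hc'.NT z)
  · simp only [apply_ite Cell.rHat]; exact Measurable.ite hp hc.rHat hc'.rHat
  · simp only [apply_ite Cell.varR]; exact Measurable.ite hp hc.varR hc'.varR
  · simp only [apply_ite Cell.pHat, ite_apply]; exact Measurable.ite hp (hc.pHat z) (hc'.pHat z)

theorem step (hc : CellMeasurable m c) (K H : ℕ) {r : Ω → ℝ} (hr : Measurable r) {y : Ω → X}
    (hy : ∀ z, MeasurableSet {ω | z = y ω}) :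
    CellMeasurable m fun ω => (c ω).step K H (r ω) (y ω) := by
  classical
  have hN : Measurable fun ω => (c ω).N + 1 := hc.N.add_const 1
  have hNr : Measurable fun ω => (((c ω).N + 1 : ℕ) : ℝ) := measurable_from_nat.comp hN
  have hT : MeasurableSet {ω | (c ω).N + 1 ∈ MVPState.triggerSet K H} :=
    hN (MeasurableSet.of_discrete (s := MVPState.triggerSet K H))
  have hNT : ∀ z, Measurable fun ω => (c ω).NT z + if z = y ω then 1 else 0 := fun z =>
    (hc.NT z).add (Measurable.ite (hy z) measurable_const measurable_const)
  have hθ := hc.θ.add hr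
  have hφ := hc.φ.add (hr.pow_const 2)
  constructor
  · exact hN
  · exact Measurable.ite hT hN hc.n
  · exact hθ
  · exact hφ
  · exact hNT
  · exact Measurable.ite hT (hθ.div hNr) hc.rHat
  · exact Measurable.ite hT ((hφ.div hNr).sub ((hθ.div hNr).pow_const 2)) hc.varR
  · exact fun z => Measurable.ite hT ((measurable_from_nat.comp (hNT z)).div hNr) (hc.pHat z)

end CellMeasurable

theorem measurable_wvar {Ω X : Type*} [MeasurableSpace Ω] [Fintype X] {p f : Ω → X → ℝ}
    (hp : ∀ x, Measurable fun ω => p ω x) (hf : ∀ x, Measurable fun ω => f ω x) :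
    Measurable fun ω => wvar (p ω) (f ω) :=
  Finset.measurable_sum _ fun x _ => (hp x).mul (((hf x).sub
    (Finset.measurable_sum _ fun z _ => (hp z).mul (hf z))).pow_const 2)

theorem measurable_backup {Ω X A : Type*} [m : MeasurableSpace Ω] [Fintype X] {H : ℕ} (ι : ℝ)
    {σ : Ω → MVPState X A H} (hσ : ∀ x a, CellMeasurable m fun ω => (σ ω).cell x a)
    {W : Ω → X → ℝ} (hW : ∀ x, Measurable fun ω => W ω x) (x : X) (a : A) :
    Measurable fun ω => (σ ω).backup ι (W ω) x a := by
  have hn : Measurable fun ω => ((max ((σ ω).n x a) 1 : ℕ) : ℝ) :=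
    measurable_from_nat.comp ((hσ x a).n.max measurable_const)
  have hp : ∀ y, Measurable fun ω => (σ ω).pHat x a y := (hσ x a).pHat
  have h1 : Measurable fun ω => ∑ y, (σ ω).pHat x a y * W ω y :=
    Finset.measurable_sum _ fun y _ => (hp y).mul (hW y)
  have h2 := measurable_wvar hp hW
  have h3 : Measurable fun ω => (σ ω).rHat x a := (hσ x a).rHat
  have h4 : Measurable fun ω => (σ ω).varR x a := (hσ x a).varR
  refine measurable_const.min ((h3.add h1).add ((Measurable.add ?_ ?_).add ?_))
  · exact (((h2.mul_const ι).div hn).sqrt).const_mul 4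
  · exact (((h4.mul_const ι).div hn).sqrt).const_mul 2
  · exact measurable_const.div hn

theorem measurable_planV {Ω X A : Type*} [m : MeasurableSpace Ω] [Fintype X] [Finite A] {H : ℕ}
    (ι : ℝ) {σ : Ω → MVPState X A H} (hσ : ∀ x a, CellMeasurable m fun ω => (σ ω).cell x a)
    (j : ℕ) (x : X) : Measurable fun ω => (σ ω).planV ι j x := by
  induction j generalizing x with
  | zero => exact measurable_const
  | succ j ih => exact Measurable.iSup fun a => measurable_backup ι hσ ih x a

theorem measurable_optV {Ω : Type*} [m : MeasurableSpace Ω] [Finite A]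
    (ι : ℝ) {σ : Ω → MVPState (Fin H × S) A H}
    (hσ : ∀ x a, CellMeasurable m fun ω => (σ ω).cell x a)
    (h : Fin (H + 1)) (x : S) : Measurable fun ω => optV ι (σ ω) h x := by
  induction h using Fin.lastCases with
  | last => simp only [optV_last]; exact measurable_const
  | cast h => simp only [optV_castSucc]; exact measurable_planV ι hσ _ _

theorem measurable_optQ {Ω : Type*} [m : MeasurableSpace Ω] [Finite A]
    (ι : ℝ) {σ : Ω → MVPState (Fin H × S) A H}
    (hσ : ∀ x a, CellMeasurable m fun ω => (σ ω).cell x a)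
    (h : Fin H) (x : S) (a : A) : Measurable fun ω => optQ ι (σ ω) h x a := by
  have hn : Measurable fun ω => ((max ((σ ω).n (h, x) a) 1 : ℕ) : ℝ) :=
    measurable_from_nat.comp ((hσ (h, x) a).n.max measurable_const)
  have hp : ∀ y, Measurable fun ω => estP (σ ω) h x a y := fun y => (hσ (h, x) a).pHat _
  have hW := measurable_optV ι hσ h.succ
  have h1 : Measurable fun ω => ∑ y, estP (σ ω) h x a y * optV ι (σ ω) h.succ y :=
    Finset.measurable_sum _ fun y _ => (hp y).mul (hW y)
  have h2 := measurable_wvar hp hW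
  have h3 : Measurable fun ω => (σ ω).rHat (h, x) a := (hσ _ a).rHat
  have h4 : Measurable fun ω => (σ ω).varR (h, x) a := (hσ _ a).varR
  refine (h3.add h1).add ((Measurable.add ?_ ?_).add ?_)
  · exact (((h2.mul_const ι).div hn).sqrt).const_mul 4
  · exact (((h4.mul_const ι).div hn).sqrt).const_mul 2
  · exact measurable_const.div hn

theorem IsInteraction.cellMeasurable_memory [MeasurableSpace S] [DiscreteMeasurableSpace S]
    [Fintype A] [MeasurableSpace A] [DiscreteMeasurableSpace A] {K : ℕ} {M : MDP S A H}
    {Ω : Type*} {mΩ : MeasurableSpace Ω} {μ : Measure Ω} [IsProbabilityMeasure μ]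
    {𝓕 : Filtration ℕ mΩ} {s : ℕ → Fin (H + 1) → Ω → S} {π : ℕ → Ω → Policy S A H}
    {r : ℕ → Fin H → Ω → unitInterval} (hI : IsInteraction M K μ 𝓕 s π r) (ι : ℝ)
    {k : ℕ} (hk : k ≤ K) (x : Fin H × S) (a : A) :
    CellMeasurable (𝓕 (k * (H + 1))) fun ω => (memory K ι (fun k h => s k h ω)
      (actions (fun k h => s k h ω) fun k => π k ω) (fun k h => r k h ω) k).cell x a := by
  classical
  obtain ⟨h, x⟩ := x
  induction k with
  | zero =>
    constructor <;> intros <;> exact measurable_const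
  | succ k ih =>
    have hk' : k < K := hk
    have hle : 𝓕 (k * (H + 1)) ≤ 𝓕 ((k + 1) * (H + 1)) := 𝓕.mono (by gcongr; omega)
    have ht : k * (H + 1) + h + 1 ≤ (k + 1) * (H + 1) := by
      rw [Nat.succ_mul]; omega
    simp only [cell_memory_succ]
    have ih := (ih hk'.le).mono hle
    refine CellMeasurable.ite (p := fun ω => s k h.castSucc ω = x ∧
      π k ω h (s k h.castSucc ω) = a) (hI.measurableSet_visit hk' h x a (by omega))
      (ih.step K H ?_ fun z => ?_) ih
    · exact (measurable_subtype_coe.comp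
        ((hI.reward_meas k hk' h).mono (𝓕.mono ht) le_rfl)).div_const _
    · by_cases hz : z.1 = finRotate H h
      · have : {ω | z = (finRotate H h, s k h.succ ω)} = s k h.succ ⁻¹' {z.2} := by
          ext ω
          simp [Prod.ext_iff, hz, eq_comm, -finRotate_apply]
        rw [this]
        exact (hI.measurable_state hk' h.succ (by rw [Fin.val_succ]; omega))
          (measurableSet_singleton _)
      · have : {ω | z = (finRotate H h, s k h.succ ω)} = ∅ := by
          ext ω
          simp only [Set.mem_ofPred_eq, Set.mem_empty_iff_false, iff_false]
          intro h1; exact hz (by rw [h1])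
        rw [this]
        exact @MeasurableSet.empty _ (_)

end

section

/-! ### Quality of the estimates -/

variable {S A : Type*} [Fintype S] {H : ℕ}

/-- Bernstein-type accuracy, with `e = ι / n`, of the estimates at `(h, x, a)`: of the mean reward
`rHat`, of its variance `varR`, of the transition probabilities `p`, and of their action on the
reference value function `v`.  Rewards are scaled by `1 / H`. -/
structure GoodEst (M : MDP S A H) (e : ℝ) (h : Fin H) (x : S) (a : A) (v : S → ℝ)
    (rHat varR : ℝ) (p : S → ℝ) : Prop where
  nonneg : ∀ y, 0 ≤ p y
  sum_eq : ∑ y, p y = 1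
  support : ∀ y, M.P h x a y = 0 → p y = 0
  reward : |rHat - M.meanR h x a / H| ≤ √(varR * e) + e
  reward_var : varR ≤ 2 * (M.rewardVar h x a / H ^ 2) + e
  value : |∑ y, p y * v y - M.PV h x a v| ≤ √(wvar p v * e) + e
  value_var : wvar p v ≤ 2 * wvar (M.P h x a) v + e
  prob : ∀ y, |p y - M.P h x a y| ≤ √((2 * M.P h x a y + e) * e) + e

theorem sqrt_two_mul_add_le {a e : ℝ} (ha : 0 ≤ a) (he : 0 ≤ e) :
    √((2 * a + e) * e) ≤ 2 * √(a * e) + e := by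
  rw [Real.sqrt_le_left (by positivity)]
  have h1 := Real.sq_sqrt (mul_nonneg ha he)
  have h2 : 0 ≤ √(a * e) * e := by positivity
  nlinarith [mul_nonneg ha he]

/-- Pointwise domination of the reference value function carries over to the optimistic backup:
the change of the variance is compensated by the change of the mean. -/
theorem GoodEst.optimism {M : MDP S A H} {e : ℝ} {h : Fin H} {x : S} {a : A} {v : S → ℝ}
    {rHat varR : ℝ} {p : S → ℝ} (hg : GoodEst M e h x a v rHat varR p) (he : 0 ≤ e)
    {W : S → ℝ} (hv0 : ∀ y, 0 ≤ v y) (hvW : ∀ y, v y ≤ W y) (hW1 : ∀ y, W y ≤ 1) :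
    M.meanR h x a / H + M.PV h x a v ≤
      rHat + ∑ y, p y * W y + (4 * √(wvar p W * e) + 2 * √(varR * e) + 21 * e) := by
  have h1 := (abs_le.1 hg.reward).1
  have h2 := (abs_le.1 hg.value).1
  have hw := wvar_nonneg hg.nonneg W
  set D := ∑ y, p y * W y - ∑ y, p y * v y with hD
  have hD0 : 0 ≤ D := by
    rw [hD, ← Finset.sum_sub_distrib]
    refine Finset.sum_nonneg fun y _ => ?_
    rw [← mul_sub]
    exact mul_nonneg (hg.nonneg y) (sub_nonneg.2 (hvW y))
  have h3 : wvar p v ≤ 2 * wvar p W + 2 * D := by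
    refine (wvar_le_two_mul hg.nonneg v W).trans ?_
    gcongr
    refine (wvar_le_sum_sq_sub hg.sum_eq _ 0).trans ?_
    rw [hD, ← Finset.sum_sub_distrib]
    refine Finset.sum_le_sum fun y _ => ?_
    rw [← mul_sub]
    refine mul_le_mul_of_nonneg_left ?_ (hg.nonneg y)
    nlinarith [hvW y, hv0 y, hW1 y]
  have h4 : √(wvar p v * e) ≤ 4 * √(wvar p W * e) + D + e := by
    rw [Real.sqrt_le_left (by positivity)]
    have h5 := Real.sq_sqrt (mul_nonneg hw he)
    have h6 : 0 ≤ √(wvar p W * e) * (D + e) := by positivity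
    have h7 := mul_le_mul_of_nonneg_right h3 he
    nlinarith [sq_nonneg (D - e), mul_nonneg hw he]
  have h8 : 0 ≤ √(varR * e) := Real.sqrt_nonneg _
  linarith

open Classical in
/-- A sum over the possible successors has at most `Γ` nonzero terms. -/
theorem sum_le_of_support {M : MDP S A H} [Fintype A] {h : Fin H} {x : S} {a : A} {f : S → ℝ}
    {c : ℝ} (hc : 0 ≤ c) (hf : ∀ y, f y ≤ c) (hf0 : ∀ y, M.P h x a y = 0 → f y = 0) :
    ∑ y, f y ≤ M.Gam * c := by
  have h1 : ∑ y, f y = ∑ y ∈ Finset.univ.filter (fun y : S => 0 < M.P h x a y), f y := by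
    refine (Finset.sum_filter_of_ne fun y _ hy => ?_).symm
    exact lt_of_le_of_ne (M.P_nonneg _ _ _ _) fun h0 => hy (hf0 y h0.symm)
  rw [h1]
  refine (Finset.sum_le_card_nsmul _ _ c fun y _ => hf y).trans ?_
  rw [nsmul_eq_mul]
  refine mul_le_mul_of_nonneg_right (Nat.cast_le.2 ?_) hc
  exact Finset.le_sup (f := fun q : Fin H × S × A =>
    (Finset.univ.filter fun y : S => 0 < M.P q.1 q.2.1 q.2.2 y).card) (Finset.mem_univ (h, x, a))

theorem one_le_Gam [Fintype A] (M : MDP S A H) (h : Fin H) (x : S) (a : A) :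
    (1 : ℝ) ≤ M.Gam := by
  have := sum_le_of_support (M := M) (h := h) (x := x) (a := a) (f := fun y => M.P h x a y)
    zero_le_one (fun y => ?_) fun y hy => hy
  · rw [M.P_sum] at this; linarith
  · rw [← M.P_sum h x a]
    exact Finset.single_le_sum (fun y _ => M.P_nonneg h x a y) (Finset.mem_univ y)

/-- Under accurate estimates the overestimation of the optimistic backup is controlled by the
variance of the reference value function and, at the price of the number of successors, by the
variance of the distance of `W` to it. -/
theorem GoodEst.surplus_le {M : MDP S A H} [Fintype A] {e : ℝ} {h : Fin H} {x : S} {a : A}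
    {v : S → ℝ} {rHat varR : ℝ} {p : S → ℝ} (hg : GoodEst M e h x a v rHat varR p) (he : 0 ≤ e)
    {W : S → ℝ} (hv0 : ∀ y, 0 ≤ v y) (hvW : ∀ y, v y ≤ W y) (hW1 : ∀ y, W y ≤ 1) :
    rHat + ∑ y, p y * W y + (4 * √(wvar p W * e) + 2 * √(varR * e) + 21 * e) -
      M.meanR h x a / H - M.PV h x a W ≤
      16 * √((M.rewardVar h x a / H ^ 2 + wvar (M.P h x a) v) * e) +
      10 * √(M.Gam * wvar (M.P h x a) (fun y => W y - v y) * e) + 41 * (M.Gam * e) := by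
  have hP0 := M.P_nonneg h x a
  have hG := one_le_Gam M h x a
  set P : S → ℝ := fun y => M.P h x a y with hP
  have hP1 : ∑ y, P y = 1 := M.P_sum h x a
  set G : ℝ := ((M.Gam : ℕ) : ℝ)
  set σr := M.rewardVar h x a / (H : ℝ) ^ 2 with hσr
  have hσ0 : 0 ≤ σr := div_nonneg (M.rewardVar_nonneg _ _ _) (sq_nonneg _)
  set V := wvar P v with hV
  have hV0 : 0 ≤ V := wvar_nonneg hP0 v
  set D := wvar P (fun y => W y - v y) with hD
  have hD0 : 0 ≤ D := wvar_nonneg hP0 _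
  set m := ∑ z, P z * (W z - v z) with hm
  set δ : S → ℝ := fun y => (W y - v y) - m with hδ
  have hDδ : D = ∑ y, P y * δ y ^ 2 := rfl
  have hm0 : 0 ≤ m := Finset.sum_nonneg fun y _ => mul_nonneg (hP0 y) (sub_nonneg.2 (hvW y))
  have hm1 : m ≤ 1 := by
    rw [← hP1]
    exact Finset.sum_le_sum fun y _ => mul_le_of_le_one_right (hP0 y) (by linarith [hv0 y, hW1 y])
  have hδ1 : ∀ y, |δ y| ≤ 1 := fun y => by
    rw [abs_le]; constructor <;> simp only [hδ] <;> linarith [hv0 y, hW1 y, hvW y]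
  have hδ2 : ∀ y, δ y ^ 2 ≤ 1 := fun y => (sq_le_one_iff_abs_le_one _).2 (hδ1 y)
  have hGe : e ≤ G * e := le_mul_of_one_le_left he hG
  -- accuracy of the single probabilities
  have hp : ∀ y, |p y - P y| ≤ 2 * √(P y * e) + 2 * e := fun y => by
    have := sqrt_two_mul_add_le (hP0 y) he
    linarith [hg.prob y]
  -- the rewards
  have r0 : √(varR * e) ≤ 2 * √(σr * e) + e :=
    (Real.sqrt_le_sqrt (mul_le_mul_of_nonneg_right hg.reward_var he)).trans
      (sqrt_two_mul_add_le hσ0 he)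
  have r1 := (abs_le.1 hg.reward).2
  -- the reference value function
  have v0 : √(wvar p v * e) ≤ 2 * √(V * e) + e :=
    (Real.sqrt_le_sqrt (mul_le_mul_of_nonneg_right hg.value_var he)).trans
      (sqrt_two_mul_add_le hV0 he)
  have v1 := (abs_le.1 hg.value).2
  -- the mean of the distance to the reference, by Cauchy-Schwarz over the possible successors
  have d1 : ∑ y, p y * W y - ∑ y, p y * v y - (M.PV h x a W - M.PV h x a v) =
      ∑ y, (p y - P y) * δ y := by
    have : ∀ y, (p y - P y) * δ y = p y * W y - p y * v y - (P y * W y - P y * v y) -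
        (p y * m - P y * m) := fun y => by simp only [hδ]; ring
    simp only [this, Finset.sum_sub_distrib, ← Finset.sum_mul, hg.sum_eq, hP1, MDP.PV]
    simp only [hP]; ring
  have hcs : ∑ y, √(P y) * |δ y| ≤ √(G * D) := by
    refine Real.le_sqrt_of_sq_le ?_
    have h1 : ∑ y, √(P y) * |δ y| = ∑ y, (if P y = 0 then 0 else 1) * (√(P y) * |δ y|) := by
      refine Finset.sum_congr rfl fun y _ => ?_
      split_ifs with h0 <;> simp [h0]
    rw [h1]
    refine (Finset.sum_mul_sq_le_sq_mul_sq _ _ _).trans ?_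
    refine mul_le_mul ?_ (le_of_eq ?_) (Finset.sum_nonneg fun y _ => sq_nonneg _) (by linarith)
    · have := sum_le_of_support (M := M) (h := h) (x := x) (a := a)
        (f := fun y => (if P y = 0 then 0 else 1 : ℝ) ^ 2) zero_le_one (fun y => ?_)
        fun y hy => by simp [hP, hy]
      · simpa using this
      · split_ifs <;> norm_num
    · rw [hDδ]
      refine Finset.sum_congr rfl fun y _ => ?_
      rw [mul_pow, Real.sq_sqrt (hP0 y), sq_abs]
  have d2 : ∑ y, (p y - P y) * δ y ≤ 2 * √(G * D * e) + 2 * (G * e) := by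
    have h1 : ∀ y, (p y - P y) * δ y ≤ 2 * √e * (√(P y) * |δ y|) +
        (if P y = 0 then 0 else 2 * e) := by
      intro y
      split_ifs with h0
      · rw [hg.support y h0, h0]; simp
      · have h2 := hp y
        rw [Real.sqrt_mul (hP0 y)] at h2
        calc (p y - P y) * δ y ≤ |p y - P y| * |δ y| := by
              rw [← abs_mul]; exact le_abs_self _
          _ ≤ (2 * (√(P y) * √e) + 2 * e) * |δ y| := by gcongr
          _ ≤ _ := by nlinarith [hδ1 y, abs_nonneg (δ y)]
    refine (Finset.sum_le_sum fun y _ => h1 y).trans ?_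
    rw [Finset.sum_add_distrib, ← Finset.mul_sum]
    have h3 := sum_le_of_support (M := M) (h := h) (x := x) (a := a)
      (f := fun y => if P y = 0 then 0 else 2 * e) (c := 2 * e) (by linarith)
      (fun y => by split_ifs <;> linarith) (fun y hy => by simp [hP, hy])
    have h4 : √(G * D * e) = √e * √(G * D) := by rw [mul_comm, Real.sqrt_mul he]
    rw [h4]
    have h5 := mul_le_mul_of_nonneg_left hcs (Real.sqrt_nonneg e)
    linarith
  -- the variance of `W` under the estimated probabilities
  have w1 : ∑ y, p y * δ y ^ 2 ≤ 2 * D + 3 * (G * e) := by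
    have h1 : ∀ y, p y * δ y ^ 2 ≤ 2 * (P y * δ y ^ 2) + (if P y = 0 then 0 else 3 * e) := by
      intro y
      split_ifs with h0
      · rw [hg.support y h0, h0]; simp
      · have h2 := (abs_le.1 (hp y)).2
        have h3 : 2 * √(P y * e) ≤ P y + e := by
          have h4 := Real.sq_sqrt (mul_nonneg (hP0 y) he)
          have h5 : (2 * √(P y * e)) ^ 2 ≤ (P y + e) ^ 2 := by
            nlinarith [sq_nonneg (P y - e)]
          exact le_of_sq_le_sq h5 (add_nonneg (hP0 y) he)
        nlinarith [hδ2 y, sq_nonneg (δ y), mul_le_mul_of_nonneg_left (hδ2 y) he]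
    refine (Finset.sum_le_sum fun y _ => h1 y).trans ?_
    rw [Finset.sum_add_distrib, ← Finset.mul_sum, ← hDδ]
    have h3 := sum_le_of_support (M := M) (h := h) (x := x) (a := a)
      (f := fun y => if P y = 0 then 0 else 3 * e) (c := 3 * e) (by linarith)
      (fun y => by split_ifs <;> linarith) (fun y hy => by simp [hP, hy])
    linarith
  have w2 : wvar p W ≤ 4 * V + 4 * D + 8 * (G * e) := by
    have h1 := wvar_le_two_mul hg.nonneg W v
    have h2 := wvar_le_sum_sq_sub hg.sum_eq (fun y => W y - v y) m
    have h3 := hg.value_var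
    change _ ≤ ∑ y, p y * δ y ^ 2 at h2
    linarith
  have w3 : √(wvar p W * e) ≤ 2 * √(V * e) + 2 * √(G * D * e) + 3 * (G * e) := by
    rw [Real.sqrt_le_left (by positivity)]
    have h1 := Real.sq_sqrt (mul_nonneg hV0 he)
    have h2 := Real.sq_sqrt (mul_nonneg (mul_nonneg (by linarith : 0 ≤ G) hD0) he)
    have h3 := mul_le_mul_of_nonneg_right w2 he
    have h4 : D * e ≤ G * D * e := by
      rw [mul_assoc]; exact le_mul_of_one_le_left (mul_nonneg hD0 he) hG
    have h5 : G * e * e ≤ (G * e) ^ 2 := by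
      rw [sq]; exact mul_le_mul_of_nonneg_left hGe (by positivity)
    have h6 : 0 ≤ √(V * e) * √(G * D * e) := by positivity
    have h7 : 0 ≤ √(V * e) * (G * e) := by positivity
    have h8 : 0 ≤ √(G * D * e) * (G * e) := by positivity
    nlinarith
  have s1 : √(σr * e) ≤ √((σr + V) * e) := Real.sqrt_le_sqrt (by gcongr; linarith)
  have s2 : √(V * e) ≤ √((σr + V) * e) := Real.sqrt_le_sqrt (by gcongr; linarith)
  linarith

end

section

/-! ### Optimism and the surplus on the good event -/

variable {S A : Type*} [Fintype S] [Fintype A] {H K : ℕ} {M : MDP S A H} {ι : ℝ}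
  {s : ℕ → Fin (H + 1) → S} {π : ℕ → Policy S A H} {r : ℕ → Fin H → unitInterval}

/-- The event on which all estimates are accurate: Bernstein bounds for the rewards, the optimal
values and the frequencies of the next states, and no transition of probability zero. -/
structure GoodEvent (M : MDP S A H) (K : ℕ) (ι : ℝ) (s : ℕ → Fin (H + 1) → S)
    (π : ℕ → Policy S A H) (r : ℕ → Fin H → unitInterval) : Prop where
  reward : ∀ n < K, ∀ h x a, Concentrated M ι s π r n h x a fun ρ _ => (ρ : ℝ) / H
  value : ∀ n < K, ∀ h x a, Concentrated M ι s π r n h x a fun _ y => M.Vstar h.succ y / H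
  next : ∀ n < K, ∀ h x a z, Concentrated M ι s π r n h x a (nextInd z)
  pos : ∀ k < K, ∀ h : Fin H,
    0 < M.P h (s k h.castSucc) (π k h (s k h.castSucc)) (s k h.succ)

theorem visitSum_eq_sum_nextInd (n : ℕ) (h : Fin H) (x : S) (a : A) (g : S → ℝ) :
    visitSum s π r n h x a (fun _ y => g y) =
      ∑ z, visitSum s π r n h x a (nextInd z) * g z := by
  classical
  simp only [visitSum, Finset.sum_mul]
  rw [Finset.sum_comm]
  refine Finset.sum_congr rfl fun k _ => ?_
  split_ifs
  · simp [nextInd, Set.indicator_apply]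
  · simp

theorem outcomeMean_next (h : Fin H) (x : S) (a : A) (g : S → ℝ) :
    M.outcomeMean h x a (fun _ y => g y) = M.PV h x a g := by
  simp [MDP.outcomeMean, MDP.PV]

theorem outcomeVar_next (h : Fin H) (x : S) (a : A) (g : S → ℝ) :
    M.outcomeVar h x a (fun _ y => g y) = wvar (M.P h x a) g := by
  rw [MDP.outcomeVar, outcomeMean_next h x a fun y => g y ^ 2, outcomeMean_next h x a g,
    wvar_eq (M.P_sum h x a)]
  rfl

theorem outcomeMean_reward (h : Fin H) (x : S) (a : A) :
    M.outcomeMean h x a (fun ρ _ => (ρ : ℝ) / H) = M.meanR h x a / H := by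
  rw [MDP.outcomeMean, ← Finset.sum_mul, M.P_sum, one_mul, integral_div, MDP.meanR]

theorem outcomeVar_reward (h : Fin H) (x : S) (a : A) :
    M.outcomeVar h x a (fun ρ _ => (ρ : ℝ) / H) = M.rewardVar h x a / H ^ 2 := by
  rw [MDP.outcomeVar, outcomeMean_reward, MDP.outcomeMean, ← Finset.sum_mul, M.P_sum, one_mul,
    M.rewardVar_eq]
  simp only [div_pow, integral_div]
  ring

/-- On the good event the estimates in memory are accurate. -/
theorem GoodEvent.goodEst (hG : GoodEvent M K ι s π r) (hι : 0 ≤ ι) {k : ℕ} (hk : k < K)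
    (h : Fin H) (x : S) (a : A)
    (hn : 0 < (memory K ι s (actions s π) r k).n (h, x) a) :
    GoodEst M (ι / (memory K ι s (actions s π) r k).n (h, x) a) h x a
      (fun y => M.Vstar h.succ y / H) ((memory K ι s (actions s π) r k).rHat (h, x) a)
      ((memory K ι s (actions s π) r k).varR (h, x) a)
      (estP (memory K ι s (actions s π) r k) h x a) := by
  classical
  have hc := (cellInv_memory ι K s π r k h x a).est
  generalize memory K ι s (actions s π) r k = σ at hn hc
  simp only [MVPState.cell] at hc
  rcases hc with ⟨h0, _⟩ | ⟨k', hk', _, hN, hr, hv, hp⟩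
  · omega
  have hk'' : k' < K := hk'.trans_lt hk
  rw [hN] at hr hv
  simp only [hN] at hp
  have hpos : 0 < visits s π r k' h x a := by rw [← hN]; exact_mod_cast hn
  have hp : ∀ z, estP σ h x a z = visitSum s π r k' h x a (nextInd z) / visits s π r k' h x a := hp
  have hpv : ∀ g : S → ℝ, ∑ y, estP σ h x a y * g y =
      visitSum s π r k' h x a (fun _ y => g y) / visits s π r k' h x a := by
    intro g
    rw [visitSum_eq_sum_nextInd, Finset.sum_div]
    exact Finset.sum_congr rfl fun y _ => by rw [hp]; ring
  have hsum : ∑ y, estP σ h x a y = 1 := by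
    have := hpv fun _ => 1
    simp only [mul_one] at this
    rw [this]; exact div_self hpos.ne'
  have hnn : ∀ y, 0 ≤ estP σ h x a y := fun y => by
    rw [hp]
    refine div_nonneg ?_ hpos.le
    have := visitSum_mono (s := s) (π := π) (r := r) (n := k') (h := h) (x := x) (a := a)
      (f := fun _ _ => 0) (g := nextInd y)
      fun ρ z => Set.indicator_nonneg (fun _ _ => zero_le_one) z
    simpa [visitSum_const] using this
  have c1 := hG.reward k' hk'' h x a hpos _ _ hr hv
  have c2 := hG.value k' hk'' h x a hpos (∑ y, estP σ h x a y * (M.Vstar h.succ y / H))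
    (wvar (estP σ h x a) fun y => M.Vstar h.succ y / H) (hpv _)
    (by rw [wvar_eq hsum, hpv fun y => (M.Vstar h.succ y / H) ^ 2])
  rw [outcomeMean_reward, outcomeVar_reward] at c1
  rw [outcomeMean_next h x a fun y => M.Vstar h.succ y / H,
    outcomeVar_next h x a fun y => M.Vstar h.succ y / H] at c2
  rw [hN]
  refine ⟨hnn, hsum, fun y hy => ?_, c1.1, c1.2, c2.1, c2.2, fun y => ?_⟩
  · rw [hp, visitSum, Finset.sum_eq_zero, zero_div]
    intro i hi
    split_ifs with hvis
    · have hi' := hG.pos i ((Finset.mem_range.1 hi).trans hk'') h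
      rw [hvis.2, hvis.1] at hi'
      have hne : s i h.succ ≠ y := by
        rintro h1; rw [h1, hy] at hi'; exact lt_irrefl _ hi'
      simp [nextInd, hne]
    · rfl
  · have hsq : (fun (ρ : unitInterval) (z : S) => nextInd y ρ z ^ 2) = nextInd y := by
      funext ρ z
      simp only [nextInd, Set.indicator_apply]
      split_ifs <;> simp
    have c3 := hG.next k' hk'' h x a y hpos (estP σ h x a y)
      (estP σ h x a y - estP σ h x a y ^ 2) (hp y) (by rw [hsq, ← hp])
    have e1 : M.outcomeMean h x a (nextInd y) = M.P h x a y := by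
      refine (outcomeMean_next h x a fun z => ({y} : Set S).indicator 1 z).trans ?_
      simp [MDP.PV, Set.indicator_apply]
    rw [MDP.outcomeVar, hsq, e1] at c3
    refine c3.1.trans (add_le_add_left (Real.sqrt_le_sqrt ?_) _)
    refine mul_le_mul_of_nonneg_right ?_ (div_nonneg hι hpos.le)
    nlinarith [c3.2, sq_nonneg (M.P h x a y)]

theorem rHat_nonneg (k : ℕ) (h : Fin H) (x : S) (a : A) :
    0 ≤ (memory K ι s (actions s π) r k).rHat (h, x) a := by
  have hc := (cellInv_memory ι K s π r k h x a).est
  simp only [MVPState.cell] at hc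
  rcases hc with ⟨_, h1, _⟩ | ⟨k', _, _, _, hr, _, _⟩
  · exact h1.ge
  · rw [hr]
    refine div_nonneg ?_ (Nat.cast_nonneg _)
    have := visitSum_mono (s := s) (π := π) (r := r) (n := k') (h := h) (x := x) (a := a)
      (f := fun _ _ => 0) (g := fun ρ _ => (ρ : ℝ) / H)
      fun ρ z => div_nonneg ρ.2.1 (Nat.cast_nonneg _)
    simpa [visitSum_const] using this

theorem estP_nonneg (k : ℕ) (h : Fin H) (x : S) (a : A) (y : S) :
    0 ≤ estP (memory K ι s (actions s π) r k) h x a y := by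
  have hc := (cellInv_memory ι K s π r k h x a).est
  simp only [MVPState.cell] at hc
  rcases hc with ⟨_, _, h1⟩ | ⟨k', _, _, _, _, _, hp⟩
  · exact (h1 _).ge
  · rw [estP, hp]
    refine div_nonneg ?_ (Nat.cast_nonneg _)
    have := visitSum_mono (s := s) (π := π) (r := r) (n := k') (h := h) (x := x) (a := a)
      (f := fun _ _ => 0) (g := nextInd y)
      fun ρ z => Set.indicator_nonneg (fun _ _ => zero_le_one) z
    simpa [visitSum_const] using this

theorem optV_le_one (hι : 1 ≤ ι) (hF : FollowsMVPV K ι s π r) {k : ℕ} (hk : k < K)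
    (h : Fin (H + 1)) (x : S) : optV ι (memory K ι s (actions s π) r k) h x ≤ 1 := by
  induction h using Fin.lastCases with
  | last => rw [optV_last]; exact zero_le_one
  | cast h => rw [optV_eq_optQ hι hF hk]; exact min_le_left _ _

theorem optV_nonneg (hι : 1 ≤ ι) (hF : FollowsMVPV K ι s π r) {k : ℕ} (hk : k < K)
    (h : Fin (H + 1)) (x : S) : 0 ≤ optV ι (memory K ι s (actions s π) r k) h x := by
  induction h using Fin.reverseInduction generalizing x with
  | last => rw [optV_last]
  | cast h ih =>
    rw [optV_eq_optQ hι hF hk]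
    have h1 := rHat_nonneg (K := K) (ι := ι) (s := s) (π := π) (r := r) k h x (π k h x)
    refine le_min zero_le_one (add_nonneg (add_nonneg h1 ?_) ?_)
    · exact Finset.sum_nonneg fun y _ => mul_nonneg (estP_nonneg k h x _ y) (ih y)
    · unfold optBonus; positivity

/-- The positive part, truncated at `1`, by which the optimistic backup exceeds the true one. -/
def surplus (M : MDP S A H) (ι : ℝ) (σ : MVPState (Fin H × S) A H) (h : Fin H) (x : S) (a : A) :
    ℝ :=
  max 0 (min 1 (optQ ι σ h x a - M.meanR h x a / H - M.PV h x a (optV ι σ h.succ)))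

theorem surplus_nonneg (σ : MVPState (Fin H × S) A H) (h : Fin H) (x : S) (a : A) :
    0 ≤ surplus M ι σ h x a := le_max_left _ _

theorem surplus_le_one (σ : MVPState (Fin H × S) A H) (h : Fin H) (x : S) (a : A) :
    surplus M ι σ h x a ≤ 1 := max_le zero_le_one (min_le_left _ _)

/-- The nonnegative part of the optimistic values minus `u`. -/
def excess (ι : ℝ) (σ : MVPState (Fin H × S) A H) (u : Fin (H + 1) → S → ℝ) (h : Fin (H + 1))
    (x : S) : ℝ :=
  max 0 (optV ι σ h x - u h x)

/-- Along a greedy policy the excess over a supersolution `u` of the Bellman equation grows in each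
step by at most the surplus. -/
theorem excess_le (hι : 1 ≤ ι) (hF : FollowsMVPV K ι s π r) {k : ℕ} (hk : k < K)
    {u : Fin (H + 1) → S → ℝ}
    (hu : ∀ (h : Fin H) x, M.meanR h x (π k h x) / H + M.PV h x (π k h x) (u h.succ) ≤
      u h.castSucc x) (h : Fin H) (x : S) :
    excess ι (memory K ι s (actions s π) r k) u h.castSucc x ≤
      surplus M ι (memory K ι s (actions s π) r k) h x (π k h x) +
        M.PV h x (π k h x) (excess ι (memory K ι s (actions s π) r k) u h.succ) := by
  have h0 : ∀ y, 0 ≤ excess ι (memory K ι s (actions s π) r k) u h.succ y :=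
    fun y => le_max_left _ _
  have h1 := optV_eq_optQ hι hF hk h x
  have h2 : 0 ≤ M.PV h x (π k h x) (optV ι (memory K ι s (actions s π) r k) h.succ) :=
    MDP.PV_nonneg fun y => optV_nonneg hι hF hk _ y
  have h3 : 0 ≤ M.meanR h x (π k h x) / H := div_nonneg (M.meanR_nonneg _ _ _) (Nat.cast_nonneg _)
  refine max_le (add_nonneg (surplus_nonneg _ _ _ _) (MDP.PV_nonneg h0)) ?_
  have h4 : M.PV h x (π k h x) (optV ι (memory K ι s (actions s π) r k) h.succ) -
      M.PV h x (π k h x) (u h.succ) ≤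
      M.PV h x (π k h x) (excess ι (memory K ι s (actions s π) r k) u h.succ) := by
    rw [← MDP.PV_sub]
    exact MDP.PV_mono fun y => le_max_right _ _
  have h5 : min 1 (optQ ι (memory K ι s (actions s π) r k) h x (π k h x)) ≤
      surplus M ι (memory K ι s (actions s π) r k) h x (π k h x) + M.meanR h x (π k h x) / H +
        M.PV h x (π k h x) (optV ι (memory K ι s (actions s π) r k) h.succ) := by
    have h6 : min 1 (optQ ι (memory K ι s (actions s π) r k) h x (π k h x) -
      M.meanR h x (π k h x) / H -
        M.PV h x (π k h x) (optV ι (memory K ι s (actions s π) r k) h.succ)) ≤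
        surplus M ι (memory K ι s (actions s π) r k) h x (π k h x) := le_max_right _ _
    rcases min_cases (1 : ℝ) (optQ ι (memory K ι s (actions s π) r k) h x (π k h x) -
      M.meanR h x (π k h x) / H -
        M.PV h x (π k h x) (optV ι (memory K ι s (actions s π) r k) h.succ)) with h7 | h7
    · rw [h7.1] at h6
      exact (min_le_left _ _).trans (by linarith)
    · rw [h7.1] at h6
      exact (min_le_right _ _).trans (by linarith)
  have h8 := hu h x
  rw [h1]
  linarith

theorem excess_nonneg (σ : MVPState (Fin H × S) A H) (u : Fin (H + 1) → S → ℝ) (h : Fin (H + 1))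
    (x : S) : 0 ≤ excess ι σ u h x := le_max_left _ _

theorem excess_le_one (hι : 1 ≤ ι) (hF : FollowsMVPV K ι s π r) {k : ℕ} (hk : k < K)
    {u : Fin (H + 1) → S → ℝ} (hu : ∀ h x, 0 ≤ u h x) (h : Fin (H + 1)) (x : S) :
    excess ι (memory K ι s (actions s π) r k) u h x ≤ 1 :=
  max_le zero_le_one (by linarith [hu h x, optV_le_one hι hF hk h x])

theorem optBonus_eq (σ : MVPState (Fin H × S) A H) (h : Fin H) (x : S) (a : A) :
    optBonus ι σ h x a =
      4 * √(wvar (estP σ h x a) (optV ι σ h.succ) * (ι / (max (σ.n (h, x) a) 1 : ℕ))) +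
        2 * √(σ.varR (h, x) a * (ι / (max (σ.n (h, x) a) 1 : ℕ))) +
        21 * (ι / (max (σ.n (h, x) a) 1 : ℕ)) := by
  simp only [optBonus, mul_div_assoc]

theorem Vstar_div_mem [Nonempty A] (h : Fin (H + 1)) (x : S) :
    0 ≤ M.Vstar h x / H ∧ M.Vstar h x / H ≤ 1 :=
  ⟨div_nonneg (M.Vstar_nonneg h x) (Nat.cast_nonneg _),
    div_le_one_of_le₀ (M.Vstar_le_H h x) (Nat.cast_nonneg _)⟩

/-- Optimism: the planned values dominate the scaled optimal values, by backward induction. -/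
theorem GoodEvent.Vstar_le_optV [Nonempty A] (hG : GoodEvent M K ι s π r) (hι : 1 ≤ ι)
    (hF : FollowsMVPV K ι s π r) {k : ℕ} (hk : k < K) (h : Fin (H + 1)) (x : S) :
    M.Vstar h x / H ≤ optV ι (memory K ι s (actions s π) r k) h x := by
  induction h using Fin.reverseInduction generalizing x with
  | last => rw [optV_last, M.Vstar_last, zero_div]
  | cast h ih =>
    obtain ⟨a, ha⟩ := M.exists_Vstar_castSucc_eq h x
    refine le_trans (le_min (Vstar_div_mem _ _).2 ?_) (optQ_le_optV (ι := ι) k h x a)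
    rcases Nat.eq_zero_or_pos ((memory K ι s (actions s π) r k).n (h, x) a) with hn | hn
    · -- without data the bonus alone exceeds `1`
      refine (Vstar_div_mem _ _).2.trans ?_
      have h1 := rHat_nonneg (K := K) (ι := ι) (s := s) (π := π) (r := r) k h x a
      have h2 : 0 ≤ ∑ y, estP (memory K ι s (actions s π) r k) h x a y *
          optV ι (memory K ι s (actions s π) r k) h.succ y :=
        Finset.sum_nonneg fun y _ => mul_nonneg (estP_nonneg k h x _ y) (optV_nonneg hι hF hk _ y)
      have h3 : 1 ≤ optBonus ι (memory K ι s (actions s π) r k) h x a := by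
        rw [optBonus, hn]
        have h4 : (21 : ℝ) * ι / (max 0 1 : ℕ) = 21 * ι := by simp
        rw [h4]
        have h5 := Real.sqrt_nonneg (wvar (estP (memory K ι s (actions s π) r k) h x a)
          (optV ι (memory K ι s (actions s π) r k) h.succ) * ι / (max 0 1 : ℕ))
        have h6 := Real.sqrt_nonneg ((memory K ι s (actions s π) r k).varR (h, x) a *
          ι / (max 0 1 : ℕ))
        linarith
      rw [optQ]
      linarith
    · have hg := hG.goodEst (by linarith) hk h x a hn
      have h1 := hg.optimism (by positivity) (W := optV ι (memory K ι s (actions s π) r k) h.succ)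
        (fun y => (Vstar_div_mem _ _).1) ih (fun y => optV_le_one hι hF hk _ y)
      rw [ha, optQ, optBonus_eq, max_eq_left (Nat.succ_le_of_lt hn), add_div, ← MDP.PV_div]
      exact h1

/-- On the good event the surplus is controlled by the variance of the optimal value function and
by the variance of the excess over it; `e` is `ι` over the sample size. -/
theorem GoodEvent.surplus_le [Nonempty A] (hG : GoodEvent M K ι s π r) (hι : 1 ≤ ι)
    (hF : FollowsMVPV K ι s π r) {k : ℕ} (hk : k < K) (h : Fin H) (x : S) (a : A) {e : ℝ}
    (he : e = ι / (max ((memory K ι s (actions s π) r k).n (h, x) a) 1 : ℕ)) :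
    surplus M ι (memory K ι s (actions s π) r k) h x a ≤
      16 * √((M.rewardVar h x a / H ^ 2 +
        wvar (M.P h x a) (fun y => M.Vstar h.succ y / H)) * e) +
      10 * √(M.Gam * wvar (M.P h x a)
        (excess ι (memory K ι s (actions s π) r k) (fun h x => M.Vstar h x / H) h.succ) * e) +
      41 * (M.Gam * e) := by
  have he0 : 0 ≤ e := by rw [he]; positivity
  have hexc : excess ι (memory K ι s (actions s π) r k) (fun h x => M.Vstar h x / H) h.succ =
      fun y => optV ι (memory K ι s (actions s π) r k) h.succ y - M.Vstar h.succ y / H := by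
    funext y
    exact max_eq_right (sub_nonneg.2 (hG.Vstar_le_optV hι hF hk _ y))
  rw [hexc]
  refine max_le (by positivity) ?_
  rcases Nat.eq_zero_or_pos ((memory K ι s (actions s π) r k).n (h, x) a) with hn | hn
  · rw [hn] at he
    have he1 : 1 ≤ e := by rw [he]; simpa using hι
    refine (min_le_left _ _).trans ?_
    have h1 := one_le_Gam M h x a
    have h2 : 1 ≤ M.Gam * e := by nlinarith
    have h3 := Real.sqrt_nonneg ((M.rewardVar h x a / H ^ 2 +
        wvar (M.P h x a) (fun y => M.Vstar h.succ y / H)) * e)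
    have h4 := Real.sqrt_nonneg (M.Gam * wvar (M.P h x a)
      (fun y => optV ι (memory K ι s (actions s π) r k) h.succ y - M.Vstar h.succ y / H) * e)
    linarith
  · have hg := hG.goodEst (by linarith) hk h x a hn
    rw [max_eq_left (Nat.succ_le_of_lt hn)] at he
    rw [← he] at hg
    refine (min_le_right _ _).trans ?_
    have h1 := hg.surplus_le he0 (W := optV ι (memory K ι s (actions s π) r k) h.succ)
      (fun y => (Vstar_div_mem _ _).1) (hG.Vstar_le_optV hι hF hk _)
      (fun y => optV_le_one hι hF hk _ y)
    rw [optQ, optBonus_eq, max_eq_left (Nat.succ_le_of_lt hn), ← he]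
    exact h1

/-! ### Counting visits -/

/-- A harmonic sum. The visits are counted before each episode, so the first visit contributes the
extra `1`. -/
theorem sum_inv_visits_le (h : Fin H) (x : S) (a : A) [DecidableEq S] [DecidableEq A] (n : ℕ) :
    ∑ k ∈ Finset.range n, (if s k h.castSucc = x ∧ π k h (s k h.castSucc) = a then
      1 / max (visits s π r k h x a) 1 else 0) ≤
      if visits s π r n h x a = 0 then 0 else 1 + 2 * Real.log (visits s π r n h x a) := by
  induction n with
  | zero => simp [visits, visitSum]
  | succ n ih =>
    have hs : visits s π r (n + 1) h x a = visits s π r n h x a +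
        if s n h.castSucc = x ∧ π n h (s n h.castSucc) = a then 1 else 0 := by
      rw [visits, visitSum, Finset.sum_range_succ, visits, visitSum]
      congr!
    rw [Finset.sum_range_succ, hs]
    by_cases hv : s n h.castSucc = x ∧ π n h (s n h.castSucc) = a
    · simp only [if_pos hv]
      have hN0 := visits_nonneg (s := s) (π := π) (r := r) (n := n) (h := h) (x := x) (a := a)
      have hN1 := visits_pos_one_le (s := s) (π := π) (r := r) (n := n) (h := h) (x := x) (a := a)
      generalize visits s π r n h x a = N at *
      rw [if_neg (by linarith : N + 1 ≠ 0)]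
      rcases hN0.eq_or_lt with h0 | h0
      · subst h0
        rw [if_pos rfl] at ih
        rw [max_eq_right zero_le_one, zero_add, Real.log_one]
        linarith
      · have h1 := hN1 h0
        rw [if_neg h0.ne'] at ih
        rw [max_eq_left h1]
        -- `1 / N ≤ 2 / (N + 1) ≤ 2 log ((N + 1) / N)` for `N ≥ 1`
        have h2 : Real.log N ≤ Real.log (N + 1) - 1 / (N + 1) := by
          have h3 := Real.log_le_sub_one_of_pos (x := N / (N + 1)) (by positivity)
          rw [Real.log_div (by positivity) (by positivity)] at h3
          have h4 : N / (N + 1) - 1 = -(1 / (N + 1)) := by field_simp; ring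
          linarith
        have h5 : 1 / N ≤ 2 * (1 / (N + 1)) := by
          rw [mul_one_div, div_le_div_iff₀ h0 (by positivity)]; linarith
        linarith
    · simp only [if_neg hv, add_zero]
      exact ih

theorem visits_le_four_mul (ι : ℝ) {k : ℕ} (hk : k < K) (h : Fin H) (x : S) (a : A) :
    visits s π r k h x a ≤ 4 * (memory K ι s (actions s π) r k).n (h, x) a :=
  (cellInv_memory ι K s π r k h x a).visits_le_four_mul hk

/-- The inverse sample sizes met along the trajectories add up to a logarithm for each triple. -/
theorem sum_inv_samples_le (hι : 0 ≤ ι) (hK : 1 ≤ K) :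
    ∑ k ∈ Finset.range K, ∑ h : Fin H, ι / (max ((memory K ι s (actions s π) r k).n
        (h, s k h.castSucc) (π k h (s k h.castSucc))) 1 : ℕ) ≤
      H * Fintype.card S * Fintype.card A * (4 * ι * (1 + 2 * Real.log K)) := by
  classical
  have h1 : ∀ k ∈ Finset.range K, ∀ h : Fin H, ι / (max ((memory K ι s (actions s π) r k).n
        (h, s k h.castSucc) (π k h (s k h.castSucc))) 1 : ℕ) ≤
      4 * ι * ∑ q : S × A, (if s k h.castSucc = q.1 ∧ π k h (s k h.castSucc) = q.2 then
        1 / max (visits s π r k h q.1 q.2) 1 else 0) := by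
    intro k hk h
    rw [Finset.sum_eq_single (s k h.castSucc, π k h (s k h.castSucc))]
    · simp only [and_self, if_true]
      have h2 := visits_le_four_mul (s := s) (π := π) (r := r) ι (Finset.mem_range.1 hk) h
        (s k h.castSucc) (π k h (s k h.castSucc))
      generalize (memory K ι s (actions s π) r k).n
        (h, s k h.castSucc) (π k h (s k h.castSucc)) = n at *
      generalize visits s π r k h (s k h.castSucc) (π k h (s k h.castSucc)) = N at *
      rw [mul_one_div, div_le_div_iff₀ (by positivity) (by positivity)]
      have h3 : max N 1 ≤ 4 * ((max n 1 : ℕ) : ℝ) := by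
        push_cast
        refine max_le (h2.trans ?_) ?_
        · gcongr; exact le_max_left _ _
        · linarith [le_max_right (n : ℝ) 1]
      nlinarith
    · rintro ⟨x, a⟩ _ hne
      rw [if_neg]
      rintro ⟨rfl, rfl⟩
      exact hne rfl
    · simp
  calc _ ≤ ∑ k ∈ Finset.range K, ∑ h : Fin H, 4 * ι * ∑ q : S × A,
        (if s k h.castSucc = q.1 ∧ π k h (s k h.castSucc) = q.2 then
          1 / max (visits s π r k h q.1 q.2) 1 else 0) :=
        Finset.sum_le_sum fun k hk => Finset.sum_le_sum fun h _ => h1 k hk h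
    _ = ∑ h : Fin H, ∑ q : S × A, 4 * ι * ∑ k ∈ Finset.range K,
        (if s k h.castSucc = q.1 ∧ π k h (s k h.castSucc) = q.2 then
          1 / max (visits s π r k h q.1 q.2) 1 else 0) := by
        rw [Finset.sum_comm]
        refine Finset.sum_congr rfl fun h _ => ?_
        simp only [Finset.mul_sum]
        rw [Finset.sum_comm]
    _ ≤ ∑ h : Fin H, ∑ q : S × A, 4 * ι * (1 + 2 * Real.log K) := by
        refine Finset.sum_le_sum fun h _ => Finset.sum_le_sum fun q _ => ?_
        refine mul_le_mul_of_nonneg_left ?_ (by positivity)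
        refine (sum_inv_visits_le h q.1 q.2 K).trans ?_
        have hlog : 0 ≤ Real.log K := Real.log_nonneg (by exact_mod_cast hK)
        split_ifs with h0
        · linarith
        · have h3 := visits_pos_one_le (lt_of_le_of_ne visits_nonneg (Ne.symm h0))
          have h4 := Real.log_le_log (by linarith) (visits_le (s := s) (π := π) (r := r)
            (n := K) (h := h) (x := q.1) (a := q.2))
          linarith
    _ = _ := by
        simp only [Finset.sum_const, Finset.card_univ, Fintype.card_prod, Fintype.card_fin,
          nsmul_eq_mul, Nat.cast_mul]
        ring

end

/-! ### Potentials along the trajectories -/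

/-- The potential `1 - X / 4`, where `X` is the excess over the played policy, `m` the mean of the next
excess and `β` the surplus. -/
theorem surplus_potential_step {m β X : ℝ} (hm1 : m ≤ 1) (hβ0 : 0 ≤ β) (hβ1 : β ≤ 1)
    (hX : X ≤ β + m) : (1 - m / 4) * Real.exp (-(β / 2)) ≤ 1 - X / 4 := by
  have h1 : Real.exp (-(β / 2)) ≤ 1 - β / 3 := by
    rw [Real.exp_neg, inv_le_comm₀ (Real.exp_pos _) (by linarith)]
    refine le_trans ?_ (Real.add_one_le_exp (β / 2))
    rw [inv_le_iff_one_le_mul₀ (by linarith)]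
    nlinarith
  nlinarith [mul_le_mul_of_nonneg_left h1 (by linarith : 0 ≤ 1 - m / 4)]

theorem sub_le_mul_exp_neg {f v : ℝ} (hf : f ≤ 2) (hv : 0 ≤ v) (hf0 : 0 ≤ f) :
    f - v ≤ f * Real.exp (-(v / 2)) := by
  nlinarith [mul_le_mul_of_nonneg_left (Real.add_one_le_exp (-(v / 2))) hf0,
    mul_nonneg hv (sub_nonneg.2 hf)]

/-- The potential `2 - X ^ 2`, where `X` is the excess over the optimal values, `β` the surplus, and
`m` and `v` the mean and the variance of the next excess; `2 - m ^ 2 - v` is the mean of the next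
potential. -/
theorem excess_potential_step {m v β X : ℝ} (hm0 : 0 ≤ m) (hm1 : m ≤ 1) (hv : 0 ≤ v)
    (hβ0 : 0 ≤ β) (hX0 : 0 ≤ X) (hX1 : X ≤ 1) (hX : X ≤ β + m) :
    (2 - m ^ 2 - v) * Real.exp (-(2 * β - v / 2)) ≤ 2 - X ^ 2 := by
  have h1 := sub_le_mul_exp_neg (f := 2 - m ^ 2) (v := v) (by nlinarith) hv (by nlinarith)
  have h2 : 2 - m ^ 2 ≤ (2 - X ^ 2) * Real.exp (2 * β) := by
    have h3 := Real.add_one_le_exp (2 * β)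
    have h4 : X ^ 2 ≤ m ^ 2 + 2 * β := by
      rcases le_total X m with h | h <;> nlinarith
    nlinarith [mul_le_mul_of_nonneg_left h3 (by nlinarith : 0 ≤ 2 - X ^ 2),
      mul_nonneg hβ0 (by nlinarith : 0 ≤ 1 - X ^ 2)]
  have h5 : Real.exp (-(2 * β - v / 2)) = Real.exp (v / 2) * Real.exp (-(2 * β)) := by
    rw [← Real.exp_add]; congr 1; ring
  have h6 : Real.exp (-(v / 2)) * Real.exp (v / 2) = 1 := by rw [← Real.exp_add]; simp
  have h7 : Real.exp (2 * β) * Real.exp (-(2 * β)) = 1 := by rw [← Real.exp_add]; simp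
  rw [h5]
  calc (2 - m ^ 2 - v) * (Real.exp (v / 2) * Real.exp (-(2 * β)))
      ≤ (2 - m ^ 2) * Real.exp (-(v / 2)) * (Real.exp (v / 2) * Real.exp (-(2 * β))) := by gcongr
    _ = (2 - m ^ 2) * Real.exp (-(2 * β)) := by
        rw [mul_assoc, ← mul_assoc (Real.exp (-(v / 2))), h6, one_mul]
    _ ≤ (2 - X ^ 2) * Real.exp (2 * β) * Real.exp (-(2 * β)) := by gcongr
    _ = 2 - X ^ 2 := by rw [mul_assoc, h7, mul_one]

/-- The potential `1 + 2 Y - Y ^ 2`, where `Y` is the gap of the played policy, and `m` and `v` are the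
mean and the variance of the next gap. -/
theorem gap_potential_step {m v Y : ℝ} (hm0 : 0 ≤ m) (hv : 0 ≤ v) (hY1 : Y ≤ 1) (hY : m ≤ Y) :
    (1 + 2 * m - m ^ 2 - v) * Real.exp (v / 2) ≤ 1 + 2 * Y - Y ^ 2 := by
  have h1 := sub_le_mul_exp_neg (f := 1 + 2 * Y - Y ^ 2) (v := v)
    (by nlinarith [sq_nonneg (Y - 1)]) hv (by nlinarith)
  have h6 : Real.exp (-(v / 2)) * Real.exp (v / 2) = 1 := by rw [← Real.exp_add]; simp
  have h2 : 1 + 2 * m - m ^ 2 ≤ 1 + 2 * Y - Y ^ 2 := by nlinarith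
  calc (1 + 2 * m - m ^ 2 - v) * Real.exp (v / 2)
      ≤ (1 + 2 * Y - Y ^ 2) * Real.exp (-(v / 2)) * Real.exp (v / 2) := by gcongr; linarith
    _ = _ := by rw [mul_assoc, h6, mul_one]

namespace MDP

variable {S A : Type*} [Fintype S] {H : ℕ} (M : MDP S A H)

/-- The distance of the value of `π` to the optimal value, scaled by `1 / H`. -/
def gap (π : Policy S A H) (h : Fin (H + 1)) (x : S) : ℝ := M.Vstar h x / H - M.V π h x / H

variable {M} in
theorem wvar_P (h : Fin H) (x : S) (a : A) (f : S → ℝ) :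
    wvar (M.P h x a) f = M.PV h x a (fun y => f y ^ 2) - M.PV h x a f ^ 2 :=
  wvar_eq (M.P_sum h x a) f

end MDP

namespace IsInteraction

variable {S A : Type*} [Fintype S] [MeasurableSpace S] [DiscreteMeasurableSpace S]
  [Fintype A] [Nonempty A] [MeasurableSpace A] [DiscreteMeasurableSpace A] {H K : ℕ}
  {M : MDP S A H} {ι : ℝ}
  {Ω : Type*} {mΩ : MeasurableSpace Ω} {μ : Measure Ω} [IsProbabilityMeasure μ]
  {𝓕 : Filtration ℕ mΩ} {s : ℕ → Fin (H + 1) → Ω → S} {π : ℕ → Ω → Policy S A H}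
  {r : ℕ → Fin H → Ω → unitInterval}

theorem measurable_at_policy (hI : IsInteraction M K μ 𝓕 s π r) {k : ℕ} (hk : k < K)
    (h : Fin H) (x : S) {f : Ω → A → ℝ} (hf : ∀ a, Measurable[𝓕 (k * (H + 1))] fun ω => f ω a) :
    Measurable[𝓕 (k * (H + 1))] fun ω => f ω (π k ω h x) := by
  have h0 := hI.policy_meas k hk h x
  let _ : MeasurableSpace Ω := 𝓕 (k * (H + 1))
  have h1 : Measurable fun q : Ω × A => f q.1 q.2 := measurable_from_prod_countable_left hf
  exact h1.comp (measurable_id.prodMk h0)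

theorem measurable_of_policy (hI : IsInteraction M K μ 𝓕 s π r) {k : ℕ} (hk : k < K)
    (g : Policy S A H → ℝ) : Measurable[𝓕 (k * (H + 1))] fun ω => g (π k ω) := by
  have h1 : Measurable[𝓕 (k * (H + 1))] (π k) := by
    refine @measurable_pi_lambda _ _ _ (_) _ _ fun h => @measurable_pi_lambda _ _ _ (_) _ _
      fun x => hI.policy_meas k hk h x
  exact (Measurable.of_discrete (f := g)).comp h1

/-- The memory before episode `k`, as a random variable. -/
abbrev mem (K : ℕ) (ι : ℝ) (s : ℕ → Fin (H + 1) → Ω → S) (π : ℕ → Ω → Policy S A H)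
    (r : ℕ → Fin H → Ω → unitInterval) (k : ℕ) (ω : Ω) : MVPState (Fin H × S) A H :=
  memory K ι (fun k h => s k h ω) (actions (fun k h => s k h ω) fun k => π k ω)
    (fun k h => r k h ω) k

theorem measurable_excess (hI : IsInteraction M K μ 𝓕 s π r) {k : ℕ} (hk : k < K)
    (h : Fin (H + 1)) (x : S) (u : Policy S A H → Fin (H + 1) → S → ℝ) :
    Measurable[𝓕 (k * (H + 1))] fun ω => excess ι (mem K ι s π r k ω) (u (π k ω)) h x := by
  have h0 := hI.measurable_of_policy hk fun p => u p h x
  let _ : MeasurableSpace Ω := 𝓕 (k * (H + 1))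
  exact measurable_const.max ((measurable_optV ι (hI.cellMeasurable_memory ι hk.le) h x).sub h0)

theorem measurable_surplus (hI : IsInteraction M K μ 𝓕 s π r) {k : ℕ} (hk : k < K)
    (h : Fin H) (x : S) : Measurable[𝓕 (k * (H + 1))]
      fun ω => surplus M ι (mem K ι s π r k ω) h x (π k ω h x) := by
  refine hI.measurable_at_policy hk h x (f := fun ω a => surplus M ι (mem K ι s π r k ω) h x a)
    fun a => ?_
  have hσ := hI.cellMeasurable_memory ι hk.le
  let _ : MeasurableSpace Ω := 𝓕 (k * (H + 1))
  refine measurable_const.max (measurable_const.min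
    (((measurable_optQ ι hσ h x a).sub_const _).sub ?_))
  exact Finset.measurable_sum _ fun y _ => (measurable_optV ι hσ h.succ y).const_mul _

/-- The optimistic values exceed those of the played policies by at most a multiple of the surpluses
collected along the trajectories. -/
theorem measure_excess_sum_le (hI : IsInteraction M K μ 𝓕 s π r) (hι : 1 ≤ ι)
    (hF : ∀ ω, FollowsMVPV K ι (fun k h => s k h ω) (fun k => π k ω) (fun k h => r k h ω)) (L : ℝ) :
    μ {ω | L < ∑ k ∈ Finset.range K, (excess ι (mem K ι s π r k ω)
        (fun h x => M.V (π k ω) h x / H) 0 (s k 0 ω) / 4 -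
      ∑ h : Fin H, surplus M ι (mem K ι s π r k ω) h (s k h.castSucc ω)
        (π k ω h (s k h.castSucc ω)) / 2)} ≤ ENNReal.ofReal (Real.exp (-L)) := by
  have hV0 : ∀ p h x, 0 ≤ M.V p h x / H := fun p h x =>
    div_nonneg (M.V_nonneg _ _ _) (Nat.cast_nonneg _)
  have hX1 : ∀ k < K, ∀ ω h x, excess ι (mem K ι s π r k ω)
      (fun h x => M.V (π k ω) h x / H) h x ≤ 1 := fun k hk ω h x =>
    excess_le_one hι (hF ω) hk (hV0 _) h x
  refine hI.measure_potential_le (Φ := fun k h ω y => 1 - excess ι (mem K ι s π r k ω)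
      (fun h x => M.V (π k ω) h x / H) h y / 4)
    (c := fun k h ω x => surplus M ι (mem K ι s π r k ω) h x (π k ω h x) / 2)
    (fun k hk h y => ?_) (fun k hk h y => ?_) (fun k hk h ω y => ?_) (fun k hk h ω x => ?_)
    (fun k hk ω => ?_) L
  · exact ((hI.measurable_excess hk h y fun p h x => M.V p h x / H).div_const 4).const_sub 1
  · exact (hI.measurable_surplus hk h y).div_const 2
  · linarith [hX1 k hk ω h y]
  · have h1 := excess_le (M := M) hι (hF ω) hk (u := fun h x => M.V (π k ω) h x / H)
      (fun h x => by rw [MDP.PV_div, ← add_div, M.V_castSucc]) h x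
    have h2 := surplus_potential_step (MDP.PV_le fun y => hX1 k hk ω h.succ y)
      (surplus_nonneg _ _ _ _) (surplus_le_one _ _ _ _) h1
    refine le_trans (le_of_eq ?_) h2
    congr 1
    rw [MDP.PV_sub, MDP.PV_const, MDP.PV_div]
  · have h1 : excess ι (mem K ι s π r k ω) (fun h x => M.V (π k ω) h x / H) (Fin.last H)
        (s k (Fin.last H) ω) = 0 := by
      rw [excess, optV_last, M.V_last]; simp
    rw [h1]
    have h2 := Real.add_one_le_exp (-(excess ι (mem K ι s π r k ω)
        (fun h x => M.V (π k ω) h x / H) 0 (s k 0 ω) / 4))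
    have h3 := mul_le_mul_of_nonneg_left h2 (Real.exp_pos (excess ι (mem K ι s π r k ω)
        (fun h x => M.V (π k ω) h x / H) 0 (s k 0 ω) / 4)).le
    rw [← Real.exp_add, add_neg_cancel, Real.exp_zero] at h3
    linarith

/-- The variances of the distance of the optimistic values to the optimal ones add up to at most a
multiple of the surpluses. -/
theorem measure_excess_var_le (hI : IsInteraction M K μ 𝓕 s π r) (hι : 1 ≤ ι)
    (hF : ∀ ω, FollowsMVPV K ι (fun k h => s k h ω) (fun k => π k ω) (fun k h => r k h ω)) (L : ℝ) :
    μ {ω | L < ∑ k ∈ Finset.range K, (0 -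
      ∑ h : Fin H, (2 * surplus M ι (mem K ι s π r k ω) h (s k h.castSucc ω)
        (π k ω h (s k h.castSucc ω)) - wvar (M.P h (s k h.castSucc ω)
        (π k ω h (s k h.castSucc ω))) (excess ι (mem K ι s π r k ω)
        (fun h x => M.Vstar h x / H) h.succ) / 2))} ≤ ENNReal.ofReal (Real.exp (-L)) := by
  have hX0 : ∀ k ω h x, 0 ≤ excess ι (mem K ι s π r k ω)
      (fun h x => M.Vstar h x / H) h x := fun k ω h x => excess_nonneg _ _ h x
  have hX1 : ∀ k < K, ∀ ω h x, excess ι (mem K ι s π r k ω)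
      (fun h x => M.Vstar h x / H) h x ≤ 1 := fun k hk ω h x =>
    excess_le_one hι (hF ω) hk (fun h x => (Vstar_div_mem h x).1) h x
  refine hI.measure_potential_le (Φ := fun k h ω y => 2 - excess ι (mem K ι s π r k ω)
      (fun h x => M.Vstar h x / H) h y ^ 2)
    (c := fun k h ω x => 2 * surplus M ι (mem K ι s π r k ω) h x (π k ω h x) -
      wvar (M.P h x (π k ω h x)) (excess ι (mem K ι s π r k ω)
        (fun h x => M.Vstar h x / H) h.succ) / 2) (g := fun _ _ => 0)
    (fun k hk h y => ?_) (fun k hk h y => ?_) (fun k hk h ω y => ?_) (fun k hk h ω x => ?_)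
    (fun k hk ω => ?_) L
  · exact ((hI.measurable_excess hk h y fun p h x => M.Vstar h x / H).pow_const 2).const_sub 2
  · refine ((hI.measurable_surplus hk h y).const_mul 2).sub (Measurable.div_const ?_ 2)
    refine hI.measurable_at_policy hk h y (f := fun ω a => wvar (M.P h y a)
      (excess ι (mem K ι s π r k ω) (fun h x => M.Vstar h x / H) h.succ)) fun a => ?_
    have h1 := fun z => hI.measurable_excess (ι := ι) hk h.succ z fun p h x => M.Vstar h x / H
    let _ : MeasurableSpace Ω := 𝓕 (k * (H + 1))
    exact measurable_wvar (fun z => measurable_const) h1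
  · nlinarith [hX1 k hk ω h y, hX0 k ω h y]
  · have h1 := excess_le (M := M) hι (hF ω) hk (u := fun h x => M.Vstar h x / H)
      (fun h x => by
        rw [MDP.PV_div, ← add_div]
        exact div_le_div_of_nonneg_right (M.le_Vstar_castSucc _ _ _) (Nat.cast_nonneg _)) h x
    have h2 := excess_potential_step (MDP.PV_nonneg fun y => hX0 k ω _ y)
      (MDP.PV_le fun y => hX1 k hk ω h.succ y)
      (wvar_nonneg (M.P_nonneg h x (π k ω h x)) (excess ι (mem K ι s π r k ω)
        (fun h x => M.Vstar h x / H) h.succ)) (surplus_nonneg _ _ _ _)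
      (hX0 k ω _ _) (hX1 k hk ω _ _) h1
    refine le_trans (le_of_eq ?_) h2
    congr 1
    rw [MDP.wvar_P, MDP.PV_sub, MDP.PV_const]
    ring
  · have h1 : excess ι (mem K ι s π r k ω) (fun h x => M.Vstar h x / H) (Fin.last H)
        (s k (Fin.last H) ω) = 0 := by
      rw [excess, optV_last, M.Vstar_last]; simp
    rw [h1, Real.exp_zero]
    nlinarith [hX0 k ω 0 (s k 0 ω)]

/-- The variances of the gaps of the played policies add up to at most a multiple of the regret. -/
theorem measure_gap_var_le (hI : IsInteraction M K μ 𝓕 s π r) (L : ℝ) :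
    μ {ω | L < ∑ k ∈ Finset.range K, (-(2 * M.gap (π k ω) 0 (s k 0 ω)) -
      ∑ h : Fin H, -(wvar (M.P h (s k h.castSucc ω) (π k ω h (s k h.castSucc ω)))
        (M.gap (π k ω) h.succ) / 2))} ≤ ENNReal.ofReal (Real.exp (-L)) := by
  have hY0 : ∀ p h x, 0 ≤ M.gap p h x := fun p h x => sub_nonneg.2
    (div_le_div_of_nonneg_right (M.V_le_Vstar p h x) (Nat.cast_nonneg _))
  have hY1 : ∀ p h x, M.gap p h x ≤ 1 := fun p h x => by
    have h1 := (Vstar_div_mem (M := M) h x).2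
    have h2 : 0 ≤ M.V p h x / H := div_nonneg (M.V_nonneg _ _ _) (Nat.cast_nonneg _)
    rw [MDP.gap]; linarith
  refine hI.measure_potential_le (Φ := fun k h ω y => 1 + 2 * M.gap (π k ω) h y -
      M.gap (π k ω) h y ^ 2)
    (c := fun k h ω x => -(wvar (M.P h x (π k ω h x)) (M.gap (π k ω) h.succ) / 2))
    (fun k hk h y => ?_) (fun k hk h y => ?_) (fun k hk h ω y => ?_) (fun k hk h ω x => ?_)
    (fun k hk ω => ?_) L
  · exact hI.measurable_of_policy hk fun p => 1 + 2 * M.gap p h y - M.gap p h y ^ 2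
  · exact hI.measurable_of_policy hk fun p => -(wvar (M.P h y (p h y)) (M.gap p h.succ) / 2)
  · nlinarith [hY0 (π k ω) h y, hY1 (π k ω) h y]
  · have h1 : M.PV h x (π k ω h x) (M.gap (π k ω) h.succ) ≤ M.gap (π k ω) h.castSucc x := by
      change M.PV h x (π k ω h x)
        (fun y => M.Vstar h.succ y / H - M.V (π k ω) h.succ y / H) ≤ _
      rw [MDP.gap, MDP.PV_sub, MDP.PV_div, MDP.PV_div, M.V_castSucc, ← sub_div, ← sub_div]
      refine div_le_div_of_nonneg_right ?_ (Nat.cast_nonneg _)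
      linarith [M.le_Vstar_castSucc h x (π k ω h x)]
    have h2 := gap_potential_step (MDP.PV_nonneg fun y => hY0 _ _ y)
      (wvar_nonneg (M.P_nonneg h x (π k ω h x)) (M.gap (π k ω) h.succ)) (hY1 _ _ _) h1
    rw [neg_neg]
    refine le_trans (le_of_eq ?_) h2
    congr 1
    rw [MDP.wvar_P, MDP.PV_sub, MDP.PV_add, MDP.PV_const, MDP.PV_smul]
    ring
  · have h1 : M.gap (π k ω) (Fin.last H) (s k (Fin.last H) ω) = 0 := by
      rw [MDP.gap, M.Vstar_last, M.V_last]; simp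
    rw [h1]
    have h2 := Real.add_one_le_exp (2 * M.gap (π k ω) 0 (s k 0 ω))
    have h3 : Real.exp (-(2 * M.gap (π k ω) 0 (s k 0 ω))) *
        Real.exp (2 * M.gap (π k ω) 0 (s k 0 ω)) = 1 := by rw [← Real.exp_add]; simp
    nlinarith [mul_le_mul_of_nonneg_left h2 (Real.exp_pos (-(2 * M.gap (π k ω) 0 (s k 0 ω)))).le,
      mul_nonneg (Real.exp_pos (-(2 * M.gap (π k ω) 0 (s k 0 ω)))).le
        (sq_nonneg (M.gap (π k ω) 0 (s k 0 ω)))]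

/-- The conditional variances collected by the played policies are at most a multiple of their
expectations, by the potential `1 + Z` for the expected remaining total variance `Z`, scaled to
`[0, 1]`. -/
theorem measure_stepVar_le (hI : IsInteraction M K μ 𝓕 s π r) (L : ℝ) :
    μ {ω | L < ∑ k ∈ Finset.range K, (-(M.addV (π k ω) (M.stepVar (π k ω)) 0 (s k 0 ω) / H ^ 2) -
      ∑ h : Fin H, -(M.stepVar (π k ω) h (s k h.castSucc ω) / H ^ 2 / 2))} ≤
      ENNReal.ofReal (Real.exp (-L)) := by
  have hZ0 : ∀ p h x, 0 ≤ M.addV p (M.stepVar p) h x / (H : ℝ) ^ 2 := fun p h x =>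
    div_nonneg (M.addV_nonneg (M.stepVar_nonneg p) h x) (sq_nonneg _)
  have hZ1 : ∀ p h x, M.addV p (M.stepVar p) h x / (H : ℝ) ^ 2 ≤ 1 := fun p h x =>
    div_le_one_of_le₀ (M.addV_stepVar_le p h x) (sq_nonneg _)
  refine hI.measure_potential_le
    (Φ := fun k h ω y => 1 + M.addV (π k ω) (M.stepVar (π k ω)) h y / H ^ 2)
    (c := fun k h ω x => -(M.stepVar (π k ω) h x / H ^ 2 / 2))
    (fun k hk h y => ?_) (fun k hk h y => ?_) (fun k hk h ω y => ?_) (fun k hk h ω x => ?_)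
    (fun k hk ω => ?_) L
  · exact hI.measurable_of_policy hk fun p => 1 + M.addV p (M.stepVar p) h y / H ^ 2
  · exact hI.measurable_of_policy hk fun p => -(M.stepVar p h y / H ^ 2 / 2)
  · linarith [hZ0 (π k ω) h y]
  · have h0 := hZ0 (π k ω) h.castSucc x
    have h1 := hZ1 (π k ω) h.castSucc x
    have hv : 0 ≤ M.stepVar (π k ω) h x / (H : ℝ) ^ 2 :=
      div_nonneg (M.stepVar_nonneg _ _ _) (sq_nonneg _)
    have h2 := sub_le_mul_exp_neg (f := 1 + M.addV (π k ω) (M.stepVar (π k ω)) h.castSucc x / H ^ 2)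
      (by linarith) hv (by linarith)
    have h3 : M.PV h x (π k ω h x)
        (fun y => 1 + M.addV (π k ω) (M.stepVar (π k ω)) h.succ y / H ^ 2) =
        1 + M.addV (π k ω) (M.stepVar (π k ω)) h.castSucc x / H ^ 2 -
          M.stepVar (π k ω) h x / H ^ 2 := by
      rw [MDP.PV_add, MDP.PV_const, MDP.PV_div, M.addV_castSucc]
      change _ = 1 + (_ + M.PV h x (π k ω h x) fun y => M.addV (π k ω) (M.stepVar (π k ω)) h.succ y)
        / _ - _
      ring
    rw [h3, neg_neg]
    have h4 : Real.exp (-(M.stepVar (π k ω) h x / H ^ 2 / 2)) *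
        Real.exp (M.stepVar (π k ω) h x / H ^ 2 / 2) = 1 := by rw [← Real.exp_add]; simp
    have h5 := mul_le_mul_of_nonneg_right h2 (Real.exp_pos (M.stepVar (π k ω) h x / H ^ 2 / 2)).le
    rw [mul_assoc, h4, mul_one] at h5
    exact h5
  · rw [M.addV_last, zero_div, add_zero]
    have h2 := Real.add_one_le_exp (M.addV (π k ω) (M.stepVar (π k ω)) 0 (s k 0 ω) / H ^ 2)
    have h3 : Real.exp (-(M.addV (π k ω) (M.stepVar (π k ω)) 0 (s k 0 ω) / H ^ 2)) *
        Real.exp (M.addV (π k ω) (M.stepVar (π k ω)) 0 (s k 0 ω) / H ^ 2) = 1 := by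
      rw [← Real.exp_add]; simp
    nlinarith [mul_le_mul_of_nonneg_left h2
      (Real.exp_pos (-(M.addV (π k ω) (M.stepVar (π k ω)) 0 (s k 0 ω) / H ^ 2))).le]

end IsInteraction

/-! ### The regret on the good event -/

section Deterministic

variable {S A : Type*} [Fintype S] [Fintype A] {H K : ℕ} {M : MDP S A H} {ι : ℝ}
  {s : ℕ → Fin (H + 1) → S} {π : ℕ → Policy S A H} {r : ℕ → Fin H → unitInterval}

/-- The sum of `f k h` over all episodes and steps. -/
def total (K H : ℕ) (f : ℕ → Fin H → ℝ) : ℝ := ∑ k ∈ Finset.range K, ∑ h : Fin H, f k h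

theorem total_mono {f g : ℕ → Fin H → ℝ} (hfg : ∀ k < K, ∀ h, f k h ≤ g k h) :
    total K H f ≤ total K H g :=
  Finset.sum_le_sum fun k hk => Finset.sum_le_sum fun h _ => hfg k (Finset.mem_range.1 hk) h

theorem total_add (f g : ℕ → Fin H → ℝ) :
    total K H (fun k h => f k h + g k h) = total K H f + total K H g := by
  simp only [total, Finset.sum_add_distrib]

theorem total_const_mul (c : ℝ) (f : ℕ → Fin H → ℝ) :
    total K H (fun k h => c * f k h) = c * total K H f := by
  simp only [total, Finset.mul_sum]

theorem total_nonneg {f : ℕ → Fin H → ℝ} (hf : ∀ k h, 0 ≤ f k h) : 0 ≤ total K H f :=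
  Finset.sum_nonneg fun k _ => Finset.sum_nonneg fun h _ => hf k h

theorem total_sqrt_mul_le {f g : ℕ → Fin H → ℝ} (hf : ∀ k h, 0 ≤ f k h) (hg : ∀ k h, 0 ≤ g k h) :
    total K H (fun k h => √(f k h * g k h)) ≤ √(total K H f * total K H g) := by
  simp only [total, ← Finset.sum_product' (Finset.range K) Finset.univ]
  simp only [fun q : ℕ × Fin H => Real.sqrt_mul (hf q.1 q.2) (g q.1 q.2)]
  rw [Real.sqrt_mul (Finset.sum_nonneg fun q _ => hf q.1 q.2)]
  exact Real.sum_sqrt_mul_sqrt_le _ (fun q => hf q.1 q.2) fun q => hg q.1 q.2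

/-- The conditional variance at step `h` for the optimal value function, scaled by `1 / H²`. -/
def optVar (M : MDP S A H) (h : Fin H) (x : S) (a : A) : ℝ :=
  M.rewardVar h x a / H ^ 2 + wvar (M.P h x a) fun y => M.Vstar h.succ y / H

theorem optVar_nonneg (h : Fin H) (x : S) (a : A) : 0 ≤ optVar M h x a :=
  add_nonneg (div_nonneg (M.rewardVar_nonneg _ _ _) (sq_nonneg _))
    (wvar_nonneg (M.P_nonneg _ _ _) _)

theorem total_optVar (s : ℕ → Fin (H + 1) → S) (π : ℕ → Policy S A H) :
    total K H (fun k h => optVar M h (s k h.castSucc) (π k h (s k h.castSucc))) =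
      totalVar M K s π / H ^ 2 := by
  simp only [total, totalVar, MDP.trajVar, Finset.sum_div, optVar, wvar_div, ← add_div]
  rfl

/-- The variance for the optimal values is at most twice that for the values of the policy plus twice
that of the gap. -/
theorem optVar_le (p : Policy S A H) (h : Fin H) (x : S) :
    optVar M h x (p h x) ≤ 2 * (M.stepVar p h x / H ^ 2) +
      2 * wvar (M.P h x (p h x)) (M.gap p h.succ) := by
  have h1 := wvar_le_two_mul (M.P_nonneg h x (p h x)) (fun y => M.Vstar h.succ y / H)
    fun y => M.V p h.succ y / H
  rw [wvar_div _ (M.V p h.succ)] at h1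
  change _ ≤ _ + 2 * wvar _ (M.gap p h.succ) at h1
  have h2 : 0 ≤ M.rewardVar h x (p h x) / (H : ℝ) ^ 2 :=
    div_nonneg (M.rewardVar_nonneg _ _ _) (sq_nonneg _)
  rw [optVar, MDP.stepVar, add_div]
  linarith

theorem regret_div (s : ℕ → Fin (H + 1) → S) (π : ℕ → Policy S A H) :
    regret M K s π / H = ∑ k ∈ Finset.range K, M.gap (π k) 0 (s k 0) := by
  simp only [regret, MDP.gap, Finset.sum_div, sub_div]

/-- Solving the system of inequalities between the regret `R`, the total surplus `B`, the total
variance `T`, the total variance `W` of the excess and a bound `V` on the expected total variances of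
the policies. The square roots containing `W` and `R` are split by the inequality of the two means so
that these terms can be absorbed. -/
theorem regret_le_of_system {R B T W G q L V : ℝ} (hR0 : 0 ≤ R) (hW0 : 0 ≤ W)
    (hq0 : 0 ≤ q) (hV0 : 0 ≤ V) (hL0 : 0 ≤ L) (hqG : q ≤ G) (hLG : L ≤ G)
    (hB : B ≤ 16 * √(T * q) + 10 * √(G * W) + 41 * G) (hW : W ≤ 4 * B + 2 * L)
    (hR : R ≤ 2 * B + 4 * L) (hT : T ≤ 4 * V + 8 * R + 8 * L) :
    R ≤ 256 * √(min T V * q) + 40000 * G := by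
  have hG0 : 0 ≤ G := hq0.trans hqG
  have amgm : ∀ {a b : ℝ}, 0 ≤ a → 0 ≤ b → ∀ c : ℝ, 0 < c → √(a * b) ≤ a / (2 * c) + c * b / 2 := by
    intro a b ha hb c hc
    rw [Real.sqrt_le_left (by positivity)]
    have : (a / (2 * c) + c * b / 2) ^ 2 - a * b = (a / (2 * c) - c * b / 2) ^ 2 := by
      field_simp; ring
    nlinarith [sq_nonneg (a / (2 * c) - c * b / 2)]
  -- weight `40` gives `10 √(W G) ≤ W / 8 + O(G) ≤ B / 2 + O(G)`, which is absorbed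
  have h1 := amgm hW0 hG0 40 (by norm_num)
  rw [mul_comm W G] at h1
  have hR1 : R ≤ 64 * √(T * q) + 2000 * G := by linarith
  have hmain : R ≤ 256 * √(T * q) + 40000 * G := by
    linarith [Real.sqrt_nonneg (T * q)]
  rcases min_cases T V with h | h
  · rw [h.1]; exact hmain
  · rw [h.1]
    have h2 : √(T * q) ≤ 2 * √(V * q) + √((8 * R + 8 * L) * q) := by
      rw [Real.sqrt_le_left (by positivity)]
      have e1 := Real.sq_sqrt (mul_nonneg hV0 hq0)
      have e2 := Real.sq_sqrt (mul_nonneg (by linarith : 0 ≤ 8 * R + 8 * L) hq0)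
      have e3 : 0 ≤ √(V * q) * √((8 * R + 8 * L) * q) := by positivity
      nlinarith [mul_le_mul_of_nonneg_right hT hq0]
    -- weight `512` gives `64 √(8 R q) ≤ R / 2 + O(q)`, which is absorbed
    have h3 := amgm (by linarith : 0 ≤ 8 * R + 8 * L) hq0 512 (by norm_num)
    linarith

/-- The regret bound, deterministically from the accuracy of the estimates and the four
trajectory inequalities. -/
theorem GoodEvent.regret_le [Nonempty S] [Nonempty A] {L : ℝ} (hL : 1 ≤ L) (hH : 1 ≤ H)
    (hK : 1 ≤ K) (hG : GoodEvent M K (99 * L) s π r) (hF : FollowsMVPV K (99 * L) s π r)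
    (h1 : ∑ k ∈ Finset.range K, (excess (99 * L) (memory K (99 * L) s (actions s π) r k)
        (fun h x => M.V (π k) h x / H) 0 (s k 0) / 4 -
      ∑ h : Fin H, surplus M (99 * L) (memory K (99 * L) s (actions s π) r k) h (s k h.castSucc)
        (π k h (s k h.castSucc)) / 2) ≤ L)
    (h2 : ∑ k ∈ Finset.range K, (0 -
      ∑ h : Fin H, (2 * surplus M (99 * L) (memory K (99 * L) s (actions s π) r k) h
        (s k h.castSucc) (π k h (s k h.castSucc)) - wvar (M.P h (s k h.castSucc)
        (π k h (s k h.castSucc))) (excess (99 * L) (memory K (99 * L) s (actions s π) r k)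
        (fun h x => M.Vstar h x / H) h.succ) / 2)) ≤ L)
    (h3 : ∑ k ∈ Finset.range K, (-(2 * M.gap (π k) 0 (s k 0)) -
      ∑ h : Fin H, -(wvar (M.P h (s k h.castSucc) (π k h (s k h.castSucc)))
        (M.gap (π k) h.succ) / 2)) ≤ L)
    (h4 : ∑ k ∈ Finset.range K, (-(M.addV (π k) (M.stepVar (π k)) 0 (s k 0) / H ^ 2) -
      ∑ h : Fin H, -(M.stepVar (π k) h (s k h.castSucc) / H ^ 2 / 2)) ≤ L) :
    regret M K s π ≤ 40000 * (4 * (99 * L) * (1 + 2 * Real.log K)) *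
      (√(min (totalVar M K s π) (M.maxVar * K) * (H * Fintype.card S * Fintype.card A)) +
        (H : ℝ) ^ 2 * M.Gam * Fintype.card S * Fintype.card A) := by
  have hι : 1 ≤ 99 * L := by linarith
  have hH0 : (0 : ℝ) < H := by exact_mod_cast hH
  set σ := memory K (99 * L) s (actions s π) r with hσ
  set ℓ := 4 * (99 * L) * (1 + 2 * Real.log K) with hℓ
  set D : ℝ := H * Fintype.card S * Fintype.card A with hD
  have hlog : 0 ≤ Real.log K := Real.log_nonneg (by exact_mod_cast hK)
  have hℓL : L ≤ ℓ := by rw [hℓ]; nlinarith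
  have hℓ1 : 1 ≤ ℓ := hL.trans hℓL
  have hD1 : 1 ≤ D := by
    rw [hD]
    have e1 : (1 : ℝ) ≤ H := by exact_mod_cast hH
    have e2 : (1 : ℝ) ≤ Fintype.card S := by exact_mod_cast Fintype.card_pos
    have e3 : (1 : ℝ) ≤ Fintype.card A := by exact_mod_cast Fintype.card_pos
    exact one_le_mul_of_one_le_of_one_le (one_le_mul_of_one_le_of_one_le e1 e2) e3
  have hΓ1 : (1 : ℝ) ≤ M.Gam :=
    one_le_Gam M ⟨0, hH⟩ (Classical.arbitrary S) (Classical.arbitrary A)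
  set q := D * ℓ with hq
  have hq0 : 0 ≤ q := by positivity
  have hLq : L ≤ q := hℓL.trans (le_mul_of_one_le_left (by linarith) hD1)
  have hqG : q ≤ M.Gam * q := le_mul_of_one_le_left hq0 hΓ1
  -- the sums over the trajectories
  set e : ℕ → Fin H → ℝ := fun k h => 99 * L / (max ((σ k).n (h, s k h.castSucc)
    (π k h (s k h.castSucc))) 1 : ℕ) with he
  have he0 : ∀ k h, 0 ≤ e k h := fun k h => by rw [he]; positivity
  have hesum : total K H e ≤ q := sum_inv_samples_le (by linarith) hK
  set t : ℕ → Fin H → ℝ := fun k h => optVar M h (s k h.castSucc) (π k h (s k h.castSucc)) with ht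
  have ht0 : ∀ k h, 0 ≤ t k h := fun k h => optVar_nonneg _ _ _
  set w : ℕ → Fin H → ℝ := fun k h => wvar (M.P h (s k h.castSucc) (π k h (s k h.castSucc)))
    (excess (99 * L) (σ k) (fun h x => M.Vstar h x / H) h.succ) with hw
  have hw0 : ∀ k h, 0 ≤ w k h := fun k h => wvar_nonneg (M.P_nonneg _ _ _) _
  set b : ℕ → Fin H → ℝ := fun k h => surplus M (99 * L) (σ k) h (s k h.castSucc)
    (π k h (s k h.castSucc)) with hb
  set g : ℕ → Fin H → ℝ := fun k h => wvar (M.P h (s k h.castSucc) (π k h (s k h.castSucc)))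
    (M.gap (π k) h.succ) with hg
  set v : ℕ → Fin H → ℝ := fun k h => M.stepVar (π k) h (s k h.castSucc) / (H : ℝ) ^ 2 with hv
  have hR : regret M K s π / H ≤ 2 * total K H b + 4 * L := by
    have e1 : regret M K s π / H ≤ ∑ k ∈ Finset.range K, excess (99 * L) (σ k)
        (fun h x => M.V (π k) h x / H) 0 (s k 0) := by
      rw [regret_div]
      refine Finset.sum_le_sum fun k hk => le_max_of_le_right ?_
      exact sub_le_sub_right (hG.Vstar_le_optV hι hF (Finset.mem_range.1 hk) 0 _) _
    rw [Finset.sum_sub_distrib, ← Finset.sum_div] at h1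
    simp only [← Finset.sum_div] at h1
    change _ - total K H b / 2 ≤ L at h1
    linarith
  have hW : total K H w ≤ 4 * total K H b + 2 * L := by
    simp only [zero_sub, Finset.sum_neg_distrib, Finset.sum_sub_distrib, ← Finset.sum_div,
      ← Finset.mul_sum] at h2
    change -(2 * total K H b - total K H w / 2) ≤ L at h2
    linarith
  have hT : total K H t ≤ 4 * (M.maxVar * K / H ^ 2) + 8 * (regret M K s π / H) + 8 * L := by
    have e1 : total K H t ≤ 2 * total K H v + 2 * total K H g := by
      rw [← total_const_mul, ← total_const_mul, ← total_add]
      exact total_mono fun k _ h => optVar_le (π k) h _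
    have e2 : total K H g ≤ 4 * (regret M K s π / H) + 2 * L := by
      simp only [Finset.sum_sub_distrib, Finset.sum_neg_distrib, ← Finset.sum_div,
        ← Finset.mul_sum] at h3
      rw [← regret_div] at h3
      change -(2 * (regret M K s π / H)) - -(total K H g / 2) ≤ L at h3
      linarith
    have e3 : total K H v ≤ 2 * (M.maxVar * K / H ^ 2) + 2 * L := by
      have e4 : ∑ k ∈ Finset.range K, M.addV (π k) (M.stepVar (π k)) 0 (s k 0) / (H : ℝ) ^ 2 ≤
          M.maxVar * K / H ^ 2 := by
        rw [← Finset.sum_div]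
        refine div_le_div_of_nonneg_right ?_ (sq_nonneg _)
        refine (Finset.sum_le_card_nsmul _ _ _ fun k _ =>
          M.addV_stepVar_le_maxVar (π k) (s k 0)).trans ?_
        simp [mul_comm]
      have e5 : ∑ k ∈ Finset.range K, ∑ h : Fin H,
          M.stepVar (π k) h (s k h.castSucc) / (H : ℝ) ^ 2 / 2 = total K H v / 2 := by
        simp only [total, Finset.sum_div]; rfl
      simp only [Finset.sum_sub_distrib, Finset.sum_neg_distrib] at h4
      rw [e5] at h4
      linarith
    linarith
  have hB : total K H b ≤ 16 * √(total K H t * q) + 10 * √(M.Gam * q * total K H w) +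
      41 * (M.Gam * q) := by
    have e1 : total K H b ≤ 16 * total K H (fun k h => √(t k h * e k h)) +
        10 * total K H (fun k h => √(w k h * (M.Gam * e k h))) +
        41 * total K H (fun k h => M.Gam * e k h) := by
      rw [← total_const_mul, ← total_const_mul, ← total_const_mul, ← total_add, ← total_add]
      refine total_mono fun k hk h => ?_
      refine (hG.surplus_le hι hF hk h _ _ rfl).trans (le_of_eq ?_)
      congr 3
      congr 1
      simp only [hw, he]
      ring
    have e2 := total_sqrt_mul_le (K := K) ht0 he0
    have e3 := total_sqrt_mul_le (K := K) (g := fun k h => M.Gam * e k h) hw0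
      fun k h => mul_nonneg (by linarith) (he0 k h)
    rw [total_const_mul] at e1 e3
    have hΓe : M.Gam * total K H e ≤ M.Gam * q := mul_le_mul_of_nonneg_left hesum (by linarith)
    have e4 : √(total K H t * total K H e) ≤ √(total K H t * q) :=
      Real.sqrt_le_sqrt (mul_le_mul_of_nonneg_left hesum (total_nonneg ht0))
    have e5 : √(total K H w * (M.Gam * total K H e)) ≤ √(M.Gam * q * total K H w) := by
      rw [mul_comm]
      exact Real.sqrt_le_sqrt (mul_le_mul_of_nonneg_right hΓe (total_nonneg hw0))
    linarith
  have hR0 : 0 ≤ regret M K s π :=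
    Finset.sum_nonneg fun k _ => sub_nonneg.2 (M.V_le_Vstar _ _ _)
  have hV0 : 0 ≤ M.maxVar := (M.addV_nonneg (M.stepVar_nonneg _) _ _).trans
    (M.addV_stepVar_le_maxVar (fun _ _ => Classical.arbitrary A) (Classical.arbitrary S))
  have key := regret_le_of_system (div_nonneg hR0 hH0.le) (total_nonneg hw0)
    hq0 (by positivity : 0 ≤ M.maxVar * K / H ^ 2) (by linarith) hqG (hLq.trans hqG) hB hW hR hT
  rw [ht, total_optVar, min_div_div_right (sq_nonneg (H : ℝ)), div_le_iff₀ hH0] at key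
  set m := min (totalVar M K s π) (M.maxVar * K) with hm
  have hm0 : 0 ≤ m := by
    refine le_min ?_ (by positivity)
    have := total_nonneg (K := K) ht0
    rw [ht, total_optVar] at this
    have h0 := mul_nonneg this (sq_nonneg (H : ℝ))
    rwa [div_mul_cancel₀ _ (by positivity)] at h0
  have hsq : √(m / H ^ 2 * q) * H ≤ ℓ * √(m * D) := by
    have e1 : √(m / H ^ 2 * q) * H = √(m * D) * √ℓ := by
      have : m / (H : ℝ) ^ 2 * q = m * D * ℓ / H ^ 2 := by rw [hq]; ring
      rw [this, Real.sqrt_div (by positivity), Real.sqrt_sq hH0.le, div_mul_cancel₀ _ hH0.ne',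
        Real.sqrt_mul (by positivity)]
    have e2 : √ℓ ≤ ℓ := by
      rw [Real.sqrt_le_left (by linarith)]; nlinarith
    rw [e1, mul_comm]
    exact mul_le_mul_of_nonneg_right e2 (Real.sqrt_nonneg _)
  have hlow : M.Gam * q * H = ℓ * ((H : ℝ) ^ 2 * M.Gam * Fintype.card S * Fintype.card A) := by
    rw [hq, hD]; ring
  have hsq0 : 0 ≤ ℓ * √(m * D) := by positivity
  calc regret M K s π ≤ 256 * (√(m / H ^ 2 * q) * H) + 40000 * (M.Gam * q * H) := by linarith
    _ ≤ 40000 * (ℓ * √(m * D)) +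
        40000 * (ℓ * ((H : ℝ) ^ 2 * M.Gam * Fintype.card S * Fintype.card A)) := by
        rw [hlow]; linarith
    _ = _ := by ring

end Deterministic

/-! ### The probability of the good event -/

/-- The functions of reward and next state whose empirical means matter at step `h`: the scaled
reward, the scaled optimal value, and the indicators of the states. -/
def testFun {S A : Type*} [Fintype S] {H : ℕ} (M : MDP S A H) (h : Fin H) :
    Option (Option S) → unitInterval → S → ℝ
  | none => fun ρ _ => (ρ : ℝ) / H
  | some none => fun _ y => M.Vstar h.succ y / H
  | some (some z) => nextInd z

theorem testFun_mem {S A : Type*} [Fintype S] [Fintype A] [Nonempty A] {H : ℕ} (M : MDP S A H)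
    (h : Fin H) (o : Option (Option S)) (ρ : unitInterval) (y : S) :
    0 ≤ testFun M h o ρ y ∧ testFun M h o ρ y ≤ 1 := by
  have hH : (1 : ℝ) ≤ H := by exact_mod_cast h.pos
  rcases o with _ | _ | z
  · exact ⟨div_nonneg ρ.2.1 (by linarith), div_le_one_of_le₀ (ρ.2.2.trans hH) (by linarith)⟩
  · exact Vstar_div_mem _ _
  · exact ⟨Set.indicator_nonneg (fun _ _ => zero_le_one) _,
      Set.indicator_le' (fun _ _ => le_rfl) (fun _ _ => zero_le_one) _⟩

theorem measurable_testFun {S A : Type*} [Fintype S] {H : ℕ} (M : MDP S A H)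
    (h : Fin H) (o : Option (Option S)) (y : S) : Measurable fun ρ => testFun M h o ρ y := by
  rcases o with _ | _ | z
  · exact measurable_subtype_coe.div_const _
  · exact measurable_const
  · simp only [testFun, nextInd]; exact measurable_const

namespace IsInteraction

variable {S A : Type*} [Fintype S] [MeasurableSpace S] [DiscreteMeasurableSpace S]
  [Fintype A] [Nonempty A] [MeasurableSpace A] [DiscreteMeasurableSpace A] {H K : ℕ}
  {M : MDP S A H}
  {Ω : Type*} {mΩ : MeasurableSpace Ω} {μ : Measure Ω} [IsProbabilityMeasure μ]
  {𝓕 : Filtration ℕ mΩ} {s : ℕ → Fin (H + 1) → Ω → S} {π : ℕ → Ω → Policy S A H}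
  {r : ℕ → Fin H → Ω → unitInterval}

/-- A union bound over episodes, triples `(h, x, a)` and test functions. -/
theorem measure_not_goodEvent_le (hI : IsInteraction M K μ 𝓕 s π r) {L : ℝ} (hL : 1 ≤ L) :
    μ {ω | ¬ GoodEvent M K (99 * L) (fun k h => s k h ω) (fun k => π k ω)
      (fun k h => r k h ω)} ≤
      (K * (H * (Fintype.card S * (Fintype.card A * (Fintype.card S + 2)))) * (2 * K + 3) : ℕ) *
        ENNReal.ofReal (Real.exp (-L)) := by
  set B : ℕ × Fin H × S × A × Option (Option S) → Set Ω := fun q =>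
    {ω | ¬ Concentrated M (99 * L) (fun k h => s k h ω) (fun k => π k ω)
      (fun k h => r k h ω) q.1 q.2.1 q.2.2.1 q.2.2.2.1 (testFun M q.2.1 q.2.2.2.2)} with hB
  set J : Finset (ℕ × Fin H × S × A × Option (Option S)) :=
    Finset.range K ×ˢ Finset.univ with hJ
  set Z : Set Ω := {ω | ¬ ∀ k < K, ∀ h : Fin H,
      0 < M.P h (s k h.castSucc ω) (π k ω h (s k h.castSucc ω)) (s k h.succ ω)} with hZ
  have h0 : μ Z = 0 := hI.ae_pos_of_visit
  have h1 : {ω | ¬ GoodEvent M K (99 * L) (fun k h => s k h ω) (fun k => π k ω)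
      (fun k h => r k h ω)} ⊆ Z ∪ ⋃ q ∈ J, B q := by
    intro ω hω
    by_contra hno
    simp only [Set.mem_union, Set.mem_iUnion, not_or, not_exists] at hno
    have hc : ∀ n < K, ∀ h x a o, Concentrated M (99 * L) (fun k h => s k h ω) (fun k => π k ω)
        (fun k h => r k h ω) n h x a (testFun M h o) := fun n hn h x a o =>
      not_not.1 (hno.2 (n, h, x, a, o) (by simp [hJ, hn]))
    exact hω ⟨fun n hn h x a => hc n hn h x a none, fun n hn h x a => hc n hn h x a (some none),
      fun n hn h x a z => hc n hn h x a (some (some z)), not_not.1 hno.1⟩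
  have hcard : J.card =
      K * (H * (Fintype.card S * (Fintype.card A * (Fintype.card S + 2)))) := by
    simp [hJ, Finset.card_product]
  refine (measure_mono h1).trans ((measure_union_le _ _).trans ?_)
  rw [h0, zero_add]
  refine (measure_biUnion_finset_le _ _).trans ?_
  refine (Finset.sum_le_card_nsmul _ _ _ fun q hq =>
    hI.measure_not_concentrated_le (Finset.mem_range.1 (Finset.mem_product.1 hq).1).le q.2.1
      q.2.2.1 q.2.2.2.1 (measurable_testFun M _ _) (fun ρ y => (testFun_mem M _ _ ρ y).1)
      (fun ρ y => (testFun_mem M _ _ ρ y).2) hL).trans ?_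
  rw [hcard, nsmul_eq_mul, ← mul_assoc, ← Nat.cast_mul]

/-- The regret bound in terms of the confidence parameter `99 L` of the algorithm. -/
theorem one_sub_le_measureReal_regret_le [Nonempty S] (hI : IsInteraction M K μ 𝓕 s π r)
    (hH : 1 ≤ H) (hK : 1 ≤ K) {L : ℝ} (hL : 1 ≤ L)
    (hF : ∀ ω, FollowsMVPV K (99 * L) (fun k h => s k h ω) (fun k => π k ω)
      (fun k h => r k h ω)) :
    1 - ((K * (H * (Fintype.card S * (Fintype.card A * (Fintype.card S + 2)))) * (2 * K + 3) : ℕ) +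
        4) * Real.exp (-L) ≤
      μ.real {ω | regret M K (fun k h => s k h ω) (fun k => π k ω) ≤
        40000 * (4 * (99 * L) * (1 + 2 * Real.log K)) *
          (√(min (totalVar M K (fun k h => s k h ω) fun k => π k ω) (M.maxVar * K) *
            (H * Fintype.card S * Fintype.card A)) +
          (H : ℝ) ^ 2 * M.Gam * Fintype.card S * Fintype.card A)} := by
  have b0 := hI.measure_not_goodEvent_le hL
  have b1 := hI.measure_excess_sum_le (by linarith) hF L
  have b2 := hI.measure_excess_var_le (by linarith) hF L
  have b3 := hI.measure_gap_var_le L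
  have b4 := hI.measure_stepVar_le L
  set N := K * (H * (Fintype.card S * (Fintype.card A * (Fintype.card S + 2)))) * (2 * K + 3)
  set G := {ω | regret M K (fun k h => s k h ω) (fun k => π k ω) ≤
        40000 * (4 * (99 * L) * (1 + 2 * Real.log K)) *
          (√(min (totalVar M K (fun k h => s k h ω) fun k => π k ω) (M.maxVar * K) *
            (H * Fintype.card S * Fintype.card A)) +
          (H : ℝ) ^ 2 * M.Gam * Fintype.card S * Fintype.card A)}
  have hcover : (Set.univ : Set Ω) ⊆ G ∪ (_ ∪ (_ ∪ (_ ∪ (_ ∪ _)))) := fun ω _ => by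
    by_contra hno
    simp only [Set.mem_union, not_or] at hno
    obtain ⟨hn, g0, g1, g2, g3, g4⟩ := hno
    exact hn (GoodEvent.regret_le hL hH hK (not_not.1 g0) (hF ω) (not_lt.1 g1) (not_lt.1 g2)
      (not_lt.1 g3) (not_lt.1 g4))
  have hμ : (1 : ℝ≥0∞) ≤ μ G + ((N : ℕ) + 4) * ENNReal.ofReal (Real.exp (-L)) := by
    rw [← measure_univ (μ := μ)]
    refine (measure_mono hcover).trans ((measure_union_le _ _).trans (add_le_add_right ?_ _))
    refine (measure_union_le _ _).trans ((add_le_add b0 ((measure_union_le _ _).trans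
      (add_le_add b1 ((measure_union_le _ _).trans (add_le_add b2
      ((measure_union_le _ _).trans (add_le_add b3 b4))))))).trans (le_of_eq ?_))
    ring
  have hfin : μ G + ((N : ℕ) + 4) * ENNReal.ofReal (Real.exp (-L)) ≠ ∞ := by finiteness
  have h2 := ENNReal.toReal_mono hfin hμ
  rw [ENNReal.toReal_add (by finiteness) (by finiteness), ENNReal.toReal_mul,
    ENNReal.toReal_ofReal (Real.exp_pos _).le, ENNReal.toReal_add (by finiteness) (by finiteness)]
    at h2
  simp only [ENNReal.toReal_one, ENNReal.toReal_natCast, ENNReal.toReal_ofNat] at h2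
  rw [measureReal_def]
  linarith

end IsInteraction

/-! ### The choice of the confidence parameter -/

/-- The union bound over episodes, triples, test functions and exponents is paid for by `ι`. -/
theorem failure_prob_le {nH nS nA nK : ℕ} (hH : 1 ≤ nH) (hS : 1 ≤ nS) (hA : 1 ≤ nA) (hK : 1 ≤ nK)
    {δ : ℝ} (hδ0 : 0 < δ) (hδ1 : δ < 1) :
    (((nK * (nH * (nS * (nA * (nS + 2)))) * (2 * nK + 3) : ℕ) : ℝ) + 4) *
      Real.exp (-(Real.log (3000 ^ 2 * (nH : ℝ) ^ 12 * (nS : ℝ) ^ 7 * (nA : ℝ) ^ 5 *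
        (nK : ℝ) ^ 5 / δ ^ 2) + 1)) ≤ δ := by
  have h1 : nK * (nH * (nS * (nA * (nS + 2)))) * (2 * nK + 3) + 4 ≤
      3000 ^ 2 * nH ^ 12 * nS ^ 7 * nA ^ 5 * nK ^ 5 := by
    calc _ ≤ nK * (nH * (nS * (nA * (nS + 2 * nS)))) * (2 * nK + 3 * nK) +
          4 * (nH ^ 1 * nS ^ 2 * nA ^ 1 * nK ^ 2) := by
          gcongr
          · omega
          · omega
          · have : 0 < nH ^ 1 * nS ^ 2 * nA ^ 1 * nK ^ 2 := by positivity
            omega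
      _ = 19 * nH ^ 1 * nS ^ 2 * nA ^ 1 * nK ^ 2 := by ring
      _ ≤ _ := by
          gcongr <;> first | assumption | norm_num
  set x : ℝ := 3000 ^ 2 * (nH : ℝ) ^ 12 * (nS : ℝ) ^ 7 * (nA : ℝ) ^ 5 * (nK : ℝ) ^ 5 with hx
  have hx0 : 0 < x := by positivity
  have h2 : (((nK * (nH * (nS * (nA * (nS + 2)))) * (2 * nK + 3) : ℕ) : ℝ) + 4) ≤ x := by
    rw [hx]; exact_mod_cast h1
  have h3 : Real.exp (-(Real.log (x / δ ^ 2) + 1)) ≤ δ / x := by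
    calc Real.exp (-(Real.log (x / δ ^ 2) + 1)) ≤ Real.exp (-Real.log (x / δ ^ 2)) :=
          Real.exp_le_exp.2 (by linarith)
      _ = δ ^ 2 / x := by
          rw [Real.exp_neg, Real.exp_log (by positivity), inv_div]
      _ ≤ δ / x := by gcongr; nlinarith
  calc _ ≤ x * (δ / x) := mul_le_mul h2 h3 (Real.exp_pos _).le hx0.le
    _ = δ := by field_simp

/-- The confidence parameter is logarithmic in `H S A K / δ`. -/
theorem confidence_le {nH nS nA nK : ℕ} (hH : 1 ≤ nH) (hS : 1 ≤ nS) (hA : 1 ≤ nA) (hK : 1 ≤ nK)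
    {δ : ℝ} (hδ0 : 0 < δ) (hδ1 : δ < 1) :
    1 ≤ Real.log (3000 ^ 2 * (nH : ℝ) ^ 12 * (nS : ℝ) ^ 7 * (nA : ℝ) ^ 5 *
        (nK : ℝ) ^ 5 / δ ^ 2) + 1 ∧
    Real.log (3000 ^ 2 * (nH : ℝ) ^ 12 * (nS : ℝ) ^ 7 * (nA : ℝ) ^ 5 *
        (nK : ℝ) ^ 5 / δ ^ 2) + 1 ≤ 6001 * (1 + Real.log (nH * nS * nA * nK / δ)) ∧
    Real.log nK ≤ Real.log (nH * nS * nA * nK / δ) := by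
  have hH' : (1 : ℝ) ≤ nH := by exact_mod_cast hH
  have hS' : (1 : ℝ) ≤ nS := by exact_mod_cast hS
  have hA' : (1 : ℝ) ≤ nA := by exact_mod_cast hA
  have hK' : (1 : ℝ) ≤ nK := by exact_mod_cast hK
  have hlog : Real.log nK ≤ Real.log (nH * nS * nA * nK / δ) := by
    refine Real.log_le_log (by linarith) ?_
    rw [le_div_iff₀ hδ0]
    have e1 : 1 * (nK : ℝ) ≤ nH * nS * nA * nK := by
      refine mul_le_mul_of_nonneg_right ?_ (by linarith)
      exact one_le_mul_of_one_le_of_one_le (one_le_mul_of_one_le_of_one_le hH' hS') hA'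
    nlinarith
  refine ⟨?_, ?_, hlog⟩
  · have : 0 ≤ Real.log (3000 ^ 2 * (nH : ℝ) ^ 12 * (nS : ℝ) ^ 7 * (nA : ℝ) ^ 5 *
        (nK : ℝ) ^ 5 / δ ^ 2) := by
      refine Real.log_nonneg ?_
      rw [le_div_iff₀ (by positivity), one_mul]
      have e1 : δ ^ 2 ≤ 1 := pow_le_one₀ hδ0.le hδ1.le
      have e2 : (1 : ℕ) ≤ 3000 ^ 2 * nH ^ 12 * nS ^ 7 * nA ^ 5 * nK ^ 5 :=
        Nat.one_le_iff_ne_zero.2 (by positivity)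
      exact e1.trans (by exact_mod_cast e2)
    linarith
  · have e1 : Real.log (3000 ^ 2 * (nH : ℝ) ^ 12 * (nS : ℝ) ^ 7 * (nA : ℝ) ^ 5 *
        (nK : ℝ) ^ 5 / δ ^ 2) ≤ Real.log (3000 ^ 2 * (nH * nS * nA * nK / δ) ^ 12) := by
      refine Real.log_le_log (by positivity) ?_
      rw [div_pow, mul_pow, mul_pow, mul_pow, ← mul_div_assoc]
      refine div_le_div₀ (by positivity) ?_ (by positivity)
        (pow_le_pow_of_le_one hδ0.le hδ1.le (by norm_num))
      rw [← mul_assoc, ← mul_assoc, ← mul_assoc]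
      gcongr <;> first | assumption | norm_num
    rw [Real.log_mul (by norm_num) (by positivity), Real.log_pow, Real.log_pow] at e1
    have e2 : Real.log 3000 ≤ 3000 := by
      linarith [Real.log_le_sub_one_of_pos (show (0 : ℝ) < 3000 by norm_num)]
    have e3 : 0 ≤ Real.log (nH * nS * nA * nK / δ) := (Real.log_nonneg hK').trans hlog
    push_cast at e1
    linarith

end

end RL

/-- There are universal constants `C`, `p` such that MVP-V, applied to any tabular MDP through
reward normalisation and state-space layering, has with probability at least `1 - δ` regret at most
`C (1 + ln(H S A K / δ))^p (√(min{Var_K^Σ, Var^⋆ K} H S A) + H² Γ S A)`. -/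
theorem corollary2 :
    ∃ (C : ℝ) (p : ℕ),
      ∀ (S A : Type*) [Fintype S] [Nonempty S] [MeasurableSpace S] [DiscreteMeasurableSpace S]
        [Fintype A] [Nonempty A] [MeasurableSpace A] [DiscreteMeasurableSpace A]
        (H K : ℕ) (_ : 1 ≤ H) (_ : 1 ≤ K) (δ : ℝ) (_ : 0 < δ) (_ : δ < 1)
        (M : RL.MDP S A H)
        (Ω : Type*) (mΩ : MeasurableSpace Ω) (μ : MeasureTheory.Measure Ω)
        [MeasureTheory.IsProbabilityMeasure μ] (𝓕 : MeasureTheory.Filtration ℕ mΩ)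
        (s : ℕ → Fin (H + 1) → Ω → S) (π : ℕ → Ω → RL.Policy S A H)
        (r : ℕ → Fin H → Ω → unitInterval),
        RL.IsInteraction M K μ 𝓕 s π r →
        (∀ ω, RL.FollowsMVPV K (RL.iota H (Fintype.card S) (Fintype.card A) K δ)
          (fun k h => s k h ω) (fun k => π k ω) (fun k h => r k h ω)) →
        1 - δ ≤ μ.real {ω |
          RL.regret M K (fun k h => s k h ω) (fun k => π k ω) ≤
            C * (1 + Real.log (H * Fintype.card S * Fintype.card A * K / δ)) ^ p *
              (√(min (RL.totalVar M K (fun k h => s k h ω) (fun k => π k ω)) (M.maxVar * K) *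
                  (H * Fintype.card S * Fintype.card A)) +
                (H : ℝ) ^ 2 * M.Gam * Fintype.card S * Fintype.card A)} := by
  refine ⟨40000 * (792 * 6001), 2, ?_⟩
  intro S A _ _ _ _ _ _ _ _ H K hH hK δ hδ0 hδ1 M Ω mΩ μ _ 𝓕 s π r hI hF
  obtain ⟨hL, hLx, hKx⟩ := RL.confidence_le hH (Fintype.card_pos (α := S))
    (Fintype.card_pos (α := A)) hK hδ0 hδ1
  have hprob := RL.failure_prob_le hH (Fintype.card_pos (α := S))
    (Fintype.card_pos (α := A)) hK hδ0 hδ1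
  have h1 := hI.one_sub_le_measureReal_regret_le hH hK hL hF
  refine (sub_le_sub_left hprob 1).trans (h1.trans (MeasureTheory.measureReal_mono ?_))
  intro ω hω
  rw [Set.mem_ofPred_eq] at hω ⊢
  refine hω.trans ?_
  set x := Real.log (H * Fintype.card S * Fintype.card A * K / δ)
  have hlogK : 0 ≤ Real.log K := Real.log_nonneg (by exact_mod_cast hK)
  refine mul_le_mul_of_nonneg_right ?_ (by positivity)
  rw [mul_assoc 40000]
  refine mul_le_mul_of_nonneg_left ?_ (by norm_num)
  calc _ ≤ 4 * (99 * (6001 * (1 + x))) * (2 * (1 + x)) := by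
        gcongr <;> linarith
    _ = _ := by ring
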